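/- **Setting.** Let $K$ be a field, $K_0(\mathcal V_K)$ the Grothendieck ring of $K$-varieties (generated by isomorphism classes $[X]$, with $[X]=[Z]+[X\smallsetminus Z]$ for $Z\subset X$ closed and $[X][Y]=[X\times Y]$), $\mathbb L=[\mathbb A^1]$ and $\mathbb T=\mathbb L-1$. For a connected graph $G$ with $n$ edges, let $\Psi_G=\sum_S\prod_{e\notin S}t_e$ (sum over the spanning trees $S$ of $G$) and let $\mathbb U(G)=[\mathbb A^n\smallsetminus\{\Psi_G=0\}]\in K_0(\mathcal V_K)$. A *melonic construction* is a list $T=(t_1,\dots,t_n)$ of tuples $t_s=(b_s,p_s,k_s)$, where $b_s$ is a non-empty tuple of positive integers, $0\le p_s<s$, $1\le k_s\le |b_{p_s}|$ (with $b_0=(1)$), $p_s>0$ for $s>1$, and for all $i\geq 1$ and $j$ at most (the $j$-th entry of $b_i$) indices $s$ satisfy $(p_s,k_s)=(i,j)$. It determines a *melonic graph* up to isomorphism: start from a single edge (stage $0$, one $1$-banana); at stage $s$, with $b_s=(a_1,\dots,a_r)$, replace one edge of the $k_s$-th banana constructed at stage $p_s$ by a string consisting of an $a_1$-banana, …, an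 $a_r$-banana (an $a$-banana is $a$ parallel edges joining two vertices). Write $\mathbb U(T)$ for the class of the resulting graph. $T$ is *reduced* if, for $i\ge1$, whenever the $j$-th entry of $b_i$ is $1$ no $s$ has $(p_s,k_s)=(i,j)$. Two constructions are *equivalent* if their graphs are isomorphic. Define the following polynomials in $\mathbb T$ with integer coefficients (the divisions are exact), for $m\ge 1$: $$f_m=\frac{\mathbb T^m-(-1)^m}{\mathbb T+1},\quad g_m=m\mathbb T^{m-1}-\frac{\mathbb T^m-(-1)^m}{\mathbb T+1},\quad h_m=\frac{\mathbb T^m+(-1)^m\mathbb T}{\mathbb T+1},\quad \mathbb B_m=m\mathbb T^{m-1}+\mathbb T\,\frac{\mathbb T^m-(-1)^m}{\mathbb T+1}.$$ **Proposition.** 1. Every melonic construction is equivalent to a reduced melonic construction. 2. Let $T=(t_1,\dots,t_n)$ be a reduced melonic construction with $n\ge2$ and $t_n=((a_1,\dots,a_r),p,k)$, where $r>1$ and $a_m=\max(a_1,\dots,a_r)>1$. Let $T'$ be obtained from $T$ by replacing $a_m$ by $1$ in $t_n$; let $T''$ be obtained from $T$ by omitting $a_m$ in $t_n$; let $T'''$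 be obtained from $T$ by omitting $t_n$ and decreasing by $1$ the $k$-th entry of $b_p$. Then $T',T'',T'''$ are melonic constructions whose graphs have fewer edges than the graph of $T$, and $$\mathbb U(T)=f_{a_m}\,\mathbb U(T')+g_{a_m}\,\mathbb U(T'')+\Big(\prod_{i\ne m}\mathbb B_{a_i}\Big)\,h_{a_m}\,\mathbb U(T''').$$ 3. (a) Equivalent constructions have the same class. (b) If $T=(((a_1,\dots,a_r),0,1))$ has depth one, then $\mathbb U(T)=\prod_{i=1}^r\mathbb B_{a_i}$. (c) If $T$ is reduced of depth $n\ge2$ and $t_n=((a),p,k)$, then $\mathbb U(T)=\mathbb U(\hat T)$, where $\hat T$ is obtained from $T$ by omitting $t_n$ and increasing the $k$-th entry of $b_p$ by $a-1$. (d) If $T$ is reduced of depth $n\ge2$ and $t_n=((1,\dots,1),p,k)$ with $r$ ones, then $\mathbb U(T)=(\mathbb T+1)^{r-1}\,\mathbb U(t_1,\dots,t_{n-1})$. 4. These rules determine $\mathbb U$ on all melonic graphs: if $F$ is a function on melonic constructions with values in $K_0(\mathcal V_K)$ satisfying the rule in 2 and the rules 3(a)–(d) with $F$ in place of $\mathbb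 U$, then $F(T)=\mathbb U(T)$ for every melonic construction $T$. -/

import Mathlib

open CategoryTheory MonoidalCategory AlgebraicGeometry

universe u

noncomputable section

/-! ## The Grothendieck ring of varieties -/

/-- A `K`-scheme is a variety if it is separated and of finite type over `Spec K`. -/
def IsVariety (K : Type u) [Field K] : ObjectProperty (Over (Spec (.of K) : Scheme.{u})) :=
  fun X => IsSeparated X.hom ∧ LocallyOfFiniteType X.hom ∧ QuasiCompact X.hom

/-- Varieties are stable under products over `Spec K`, and `Spec K` is a variety. -/
instance isVariety_isMonoidal (K : Type u) [Field K] : (IsVariety K).IsMonoidal where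
  prop_unit := by
    refine ⟨inferInstanceAs (IsSeparated (𝟙 (Spec (.of K)))),
      inferInstanceAs (LocallyOfFiniteType (𝟙 (Spec (.of K)))),
      inferInstanceAs (QuasiCompact (𝟙 (Spec (.of K))))⟩
  prop_tensor := by
    rintro X Y ⟨_, _, _⟩ ⟨_, _, _⟩
    refine ⟨?_, ?_, ?_⟩ <;> (rw [Over.tensorObj_hom]; infer_instance)

/-- The category of `K`-varieties; its monoidal product is the product over `Spec K`. -/
abbrev Variety (K : Type u) [Field K] : Type (u + 1) := (IsVariety K).FullSubcategory

/-- The commutative monoid ring `ℤ[M]` on the monoid `M` of isomorphism classes of `K`-varieties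
under the product over `Spec K`: the free abelian group on the isomorphism classes, with
`[X] * [Y] = [X × Y]`. -/
abbrev FreeVarietyRing (K : Type u) [Field K] : Type (u + 1) :=
  MonoidAlgebra ℤ (Skeleton (Variety K))

/-- The generator attached to the isomorphism class of a variety. -/
def freeClass {K : Type u} [Field K] (X : Variety K) : FreeVarietyRing K :=
  MonoidAlgebra.of ℤ (Skeleton (Variety K)) (toSkeleton X)

/-- The elements `[X] - [Z] - [X ∖ Z]`, for `Z` a closed subscheme of a variety `X`. -/
def scissorRelations (K : Type u) [Field K] : Set (FreeVarietyRing K) :=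
  {x | ∃ (X Z W : Variety K) (i : Z ⟶ X) (j : W ⟶ X),
    IsClosedImmersion i.hom.left ∧ IsOpenImmersion j.hom.left ∧
    Set.range j.hom.left = (Set.range i.hom.left)ᶜ ∧
    x = freeClass X - freeClass Z - freeClass W}

/-- The Grothendieck ring `K₀(𝒱_K)`. (A product of a scissor relation with the class of a variety
is again a scissor relation, so that the ideal they generate is the subgroup they generate.) -/
abbrev K0 (K : Type u) [Field K] : Type (u + 1) :=
  FreeVarietyRing K ⧸ Ideal.span (scissorRelations K)

/-- The class `[X]` of a variety in the Grothendieck ring. -/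
def K0.mk {K : Type u} [Field K] (X : Variety K) : K0 K :=
  Ideal.Quotient.mk _ (freeClass X)

/-- The affine space `𝔸^σ` over `K`. -/
def affineSpace (K : Type u) [Field K] (σ : Type) [Finite σ] : Variety K where
  obj := Over.mk (Spec.map (CommRingCat.ofHom (MvPolynomial.C : K →+* MvPolynomial σ K)))
  property := by
    refine ⟨?_, ?_, ?_⟩
    · change IsSeparated (Spec.map _); infer_instance
    · change LocallyOfFiniteType (Spec.map _)
      rw [HasRingHomProperty.Spec_iff (P := @LocallyOfFiniteType)]
      exact RingHom.finiteType_algebraMap.mpr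
        (inferInstance : Algebra.FiniteType K (MvPolynomial σ K))
    · change QuasiCompact (Spec.map _); infer_instance

/-- The open subset `Ψ ≠ 0` of the affine space `𝔸^σ`. -/
def nonvanishing {K : Type u} [Field K] {σ : Type} (Ψ : MvPolynomial σ K) :
    (Spec (.of (MvPolynomial σ K)) : Scheme.{u}).Opens :=
  PrimeSpectrum.basicOpen Ψ

/-- The variety `𝔸^σ ∖ {Ψ = 0}`, the complement of an affine hypersurface. -/
def hypersurfaceComplement {K : Type u} [Field K] {σ : Type} [Finite σ]
    (Ψ : MvPolynomial σ K) : Variety K where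
  obj := Over.mk ((nonvanishing Ψ).ι ≫
    Spec.map (CommRingCat.ofHom (MvPolynomial.C : K →+* MvPolynomial σ K)))
  property := by
    obtain ⟨_, h2, _⟩ := (affineSpace K σ).property
    have hU : IsAffine (nonvanishing Ψ : Scheme.{u}) := by
      have h := (isAffineOpen_top (Spec (.of (MvPolynomial σ K)) : Scheme.{u})).basicOpen
        ((Scheme.ΓSpecIso (.of (MvPolynomial σ K))).inv Ψ)
      rw [basicOpen_eq_of_affine'] at h
      have h' : IsAffineOpen (nonvanishing Ψ) := by simpa [nonvanishing] using h
      exact h'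
    refine ⟨?_, ?_, ?_⟩
    · change IsSeparated (_ ≫ Spec.map _); infer_instance
    · exact MorphismProperty.comp_mem _ _ _
        (inferInstance : LocallyOfFiniteType (nonvanishing Ψ).ι) h2
    · change QuasiCompact (_ ≫ Spec.map _); infer_instance

/-- The Lefschetz class `𝕃 = [𝔸¹]`. -/
def lefschetz (K : Type u) [Field K] : K0 K := K0.mk (affineSpace K Unit)

/-- The class `𝕋 = [𝔸¹ ∖ 𝔸⁰] = 𝕃 - 1` of the torus. -/
def torus (K : Type u) [Field K] : K0 K := lefschetz K - 1

/-! ## Graph polynomials and Grothendieck classes of graphs -/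

/-- The vertices `x` and `y` are joined by a path of `G` using only edges in `S`. -/
def Graph.JoinedBy {α β : Type} (G : Graph α β) (S : Set β) (x y : α) : Prop :=
  Relation.ReflTransGen (fun v w => ∃ e ∈ S, G.IsLink e v w) x y

/-- The edges in `S` form a spanning tree of `G`: they connect all the vertices, and they contain
no cycle, i.e. no edge of `S` joins two vertices which are joined by the other edges of `S`. -/
structure Graph.IsSpanningTree {α β : Type} (G : Graph α β) (S : Set β) : Prop where
  subset : S ⊆ G.edgeSet
  nonempty : G.vertexSet.Nonempty
  connected : ∀ x ∈ G.vertexSet, ∀ y ∈ G.vertexSet, G.JoinedBy S x y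
  acyclic : ∀ e ∈ S, ∀ x y, G.IsLink e x y → ¬ G.JoinedBy (S \ {e}) x y

open Classical in
/-- The Kirchhoff–Symanzik polynomial of a graph with finitely many edges: the sum over the
spanning trees of the product of the variables of the edges not in the tree. -/
def Graph.kirchhoff (K : Type u) [Field K] {α β : Type} (G : Graph α β) [Finite G.edgeSet] :
    MvPolynomial G.edgeSet K :=
  letI := Fintype.ofFinite G.edgeSet
  ∑ S ∈ (Finset.univ : Finset (Finset G.edgeSet)).filter
      (fun S : Finset G.edgeSet => G.IsSpanningTree (Subtype.val '' (S : Set G.edgeSet))),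
    ∏ e ∈ Sᶜ, MvPolynomial.X e

/-- The Grothendieck class `𝕌(G)`: the class of the complement, in the affine space whose
coordinates are the edges of `G`, of the affine hypersurface `Ψ_G = 0`. -/
def Graph.grothendieckClass (K : Type u) [Field K] {α β : Type} (G : Graph α β)
    [Finite G.edgeSet] : K0 K :=
  K0.mk (hypersurfaceComplement (G.kirchhoff K))

/-- Isomorphism of graphs. -/
def Graph.Isomorphic {α β α' β' : Type} (G : Graph α β) (H : Graph α' β') : Prop :=
  ∃ (f : G.vertexSet ≃ H.vertexSet) (g : G.edgeSet ≃ H.edgeSet),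
    ∀ (e : G.edgeSet) (x y : G.vertexSet), G.IsLink e x y ↔ H.IsLink (g e) (f x) (f y)

/-! ## Melonic constructions -/

/-- A tuple `((a₁, …, a_r), p, k)`, the instruction to replace one edge of the `k`-th banana
constructed at stage `p` by a string of bananas with `a₁, …, a_r` edges. -/
structure MelonicTuple where
  b : List ℕ
  p : ℕ
  k : ℕ

/-- The sizes of the bananas constructed at stage `s`; stage `0` is a single edge, and
`T = (t₁, …, tₙ)` lists the stages `1, …, n`. -/
def stageBananas (T : List MelonicTuple) : ℕ → List ℕ
  | 0 => [1]
  | s + 1 => ((T.map MelonicTuple.b)[s]?).getD []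

/-- The number of later replacements performed in the `k`-th banana of stage `p`. -/
def numReplaced (T : List MelonicTuple) (p k : ℕ) : ℕ :=
  T.countP (fun t => t.p = p ∧ t.k = k)

/-- Melonic constructions. The stage `s` is the entry of index `s - 1` of the list `T`, and the
`j`-th banana of a tuple `b` is the entry of index `j - 1` of the list `b`. -/
structure IsMelonic (T : List MelonicTuple) : Prop where
  ne_nil : ∀ t ∈ T, t.b ≠ []
  pos : ∀ t ∈ T, ∀ a ∈ t.b, 0 < a
  p_lt : ∀ (s : ℕ) (hs : s < T.length), T[s].p < s + 1
  one_le_k : ∀ t ∈ T, 1 ≤ t.k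
  k_le : ∀ t ∈ T, t.k ≤ (stageBananas T t.p).length
  p_pos : ∀ (s : ℕ) (hs : s < T.length), 0 < s → 0 < T[s].p
  numReplaced_le : ∀ (i : ℕ) (hi : i < T.length) (j : ℕ) (hj : j < T[i].b.length),
    numReplaced T (i + 1) (j + 1) ≤ T[i].b[j]

/-- A construction is reduced if it does not replace the edge of a `1`-banana past stage `0`. -/
def IsReducedMelonic (T : List MelonicTuple) : Prop :=
  ∀ (i : ℕ) (hi : i < T.length) (j : ℕ) (hj : j < T[i].b.length),
    T[i].b[j] = 1 → ∀ t ∈ T, ¬ (t.p = i + 1 ∧ t.k = j + 1)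

/-! ## The melonic graph of a construction -/

/-- An edge from `src` to `tgt`, belonging to the banana number `banana` of the stage `stage`. -/
structure LabelledEdge where
  stage : ℕ
  banana : ℕ
  src : ℕ
  tgt : ℕ
  deriving DecidableEq

/-- A stage of the construction of a melonic graph: a multigraph with vertices `0, …, numV - 1`
and with labelled (directed) edges. Parallel edges of one banana are repeated list entries. -/
structure MelonicState where
  numV : ℕ
  edges : List LabelledEdge
  src_lt : ∀ e ∈ edges, e.src < numV
  tgt_lt : ∀ e ∈ edges, e.tgt < numV

/-- The string of bananas with sizes `b = (a₁, …, a_r)` constructed at stage `s` between the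
vertices `u` and `w`, the `r - 1` intermediate vertices being `N, N + 1, …, N + r - 2`. -/
def bananaString (s N u w : ℕ) (b : List ℕ) : List LabelledEdge :=
  b.zipIdx.flatMap fun (a, j) => List.replicate a
    { stage := s
      banana := j + 1
      src := if j = 0 then u else N + (j - 1)
      tgt := if j + 1 = b.length then w else N + j }

theorem bananaString_bound {s N u w : ℕ} {b : List ℕ} (hu : u < N) (hw : w < N)
    {e : LabelledEdge} (he : e ∈ bananaString s N u w b) :
    e.src < N + (b.length - 1) ∧ e.tgt < N + (b.length - 1) := by
  simp only [bananaString, List.mem_flatMap, List.mem_replicate, Prod.exists] at he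
  obtain ⟨a, j, hj, -, rfl⟩ := he
  have := List.snd_lt_of_mem_zipIdx hj
  simp only at this ⊢
  constructor <;> split_ifs <;> omega

/-- Stage `s` of the construction: one edge of the `k`-th banana constructed at stage `p` is
replaced by a string of bananas. (All the edges which are left of this banana are parallel, and
listed as equal entries, so it does not matter which one is replaced.) -/
def MelonicState.step (P : MelonicState) (s : ℕ) (t : MelonicTuple) : MelonicState :=
  match h : P.edges.find? (fun e => e.stage = t.p ∧ e.banana = t.k) with
  | none => P
  | some e =>
    { numV := P.numV + (t.b.length - 1)
      edges := P.edges.erase e ++ bananaString s P.numV e.src e.tgt t.b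
      src_lt := fun e' he' => by
        have he := List.mem_of_find?_eq_some h
        rcases List.mem_append.mp he' with h' | h'
        · exact (P.src_lt _ (List.mem_of_mem_erase h')).trans_le (Nat.le_add_right _ _)
        · exact (bananaString_bound (P.src_lt _ he) (P.tgt_lt _ he) h').1
      tgt_lt := fun e' he' => by
        have he := List.mem_of_find?_eq_some h
        rcases List.mem_append.mp he' with h' | h'
        · exact (P.tgt_lt _ (List.mem_of_mem_erase h')).trans_le (Nat.le_add_right _ _)
        · exact (bananaString_bound (P.src_lt _ he) (P.tgt_lt _ he) h').2 }

/-- Stage `0`: a single edge. -/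
def MelonicState.initial : MelonicState where
  numV := 2
  edges := [⟨0, 1, 0, 1⟩]
  src_lt := by simp
  tgt_lt := by simp

/-- The result of performing the stages `1, …, n` of a construction `T = (t₁, …, tₙ)`. -/
def melonicState (T : List MelonicTuple) : MelonicState :=
  T.zipIdx.foldl (fun P (t, i) => P.step (i + 1) t) MelonicState.initial

/-- The multigraph underlying a stage of the construction, without labels and directions. -/
def MelonicState.toGraph (P : MelonicState) : Graph (Fin P.numV) (Fin P.edges.length) where
  vertexSet := Set.univ
  edgeSet := Set.univ
  IsLink e x y := (P.edges[e].src = x ∧ P.edges[e].tgt = y) ∨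
    (P.edges[e].src = y ∧ P.edges[e].tgt = x)
  isLink_symm _ _ := ⟨fun _ _ h => h.symm⟩
  eq_or_eq_of_isLink_of_isLink := by
    intro e x y v w h h'
    simp only [Fin.ext_iff]
    omega
  edge_mem_iff_exists_isLink e := by
    refine ⟨fun _ => ?_, fun _ => Set.mem_univ e⟩
    exact ⟨⟨_, P.src_lt _ (List.getElem_mem e.2)⟩, ⟨_, P.tgt_lt _ (List.getElem_mem e.2)⟩,
      Or.inl ⟨rfl, rfl⟩⟩
  left_mem_of_isLink _ _ _ _ := Set.mem_univ _

/-- The melonic graph determined by a melonic construction. -/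
def melonicGraph (T : List MelonicTuple) :
    Graph (Fin (melonicState T).numV) (Fin (melonicState T).edges.length) :=
  (melonicState T).toGraph

/-- The Grothendieck class `𝕌(T)` of the melonic graph determined by `T`. -/
def melonicClass (K : Type u) [Field K] (T : List MelonicTuple) : K0 K :=
  (melonicGraph T).grothendieckClass K

/-! ## The coefficients -/

open Polynomial in
/-- `f_m = (T^m - (-1)^m) / (T + 1)`. -/
def fPoly (m : ℕ) : Polynomial ℤ := (X ^ m - (-1) ^ m) /ₘ (X + 1)

open Polynomial in
/-- `g_m = m T^(m-1) - (T^m - (-1)^m) / (T + 1)`. -/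
def gPoly (m : ℕ) : Polynomial ℤ := (m : Polynomial ℤ) * X ^ (m - 1) - fPoly m

open Polynomial in
/-- `h_m = (T^m + (-1)^m T) / (T + 1)`. -/
def hPoly (m : ℕ) : Polynomial ℤ := (X ^ m + (-1) ^ m * X) /ₘ (X + 1)

open Polynomial in
/-- `B_m = m T^(m-1) + T (T^m - (-1)^m) / (T + 1)`. -/
def bananaPoly (m : ℕ) : Polynomial ℤ := (m : Polynomial ℤ) * X ^ (m - 1) + X * fPoly m

open Polynomial in
/-- The division defining `f_m` is exact. -/
theorem fPoly_spec (m : ℕ) : (X + 1) * fPoly m = X ^ m - (-1) ^ m := by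
  have h : (X + 1 : ℤ[X]) = X - C (-1) := by simp
  rw [fPoly, h, mul_divByMonic_eq_iff_isRoot]
  simp [IsRoot]

open Polynomial in
/-- The division defining `h_m` is exact. -/
theorem hPoly_spec (m : ℕ) : (X + 1) * hPoly m = X ^ m + (-1) ^ m * X := by
  have h : (X + 1 : ℤ[X]) = X - C (-1) := by simp
  rw [hPoly, h, mul_divByMonic_eq_iff_isRoot]
  simp [IsRoot]

/-! ## The recursion -/

/-- The list obtained from `T` by applying `φ` to the size of the `k`-th banana of stage `p`. -/
def resize (T : List MelonicTuple) (p k : ℕ) (φ : ℕ → ℕ) : List MelonicTuple :=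
  T.modify (p - 1) fun t => { t with b := t.b.modify (k - 1) φ }

open Polynomial in
/-- The rules of the recursion, for a function `F` on melonic constructions with values in a
commutative ring containing an element `t`. -/
structure MelonicRecursion {R : Type*} [CommRing R] (t : R) (F : List MelonicTuple → R) :
    Prop where
  /-- Equivalent constructions, i.e. constructions with isomorphic graphs, have the same value. -/
  equivalent : ∀ T T' : List MelonicTuple, IsMelonic T → IsMelonic T' →
    (melonicGraph T).Isomorphic (melonicGraph T') → F T = F T'
  /-- Constructions of depth one. -/
  depth_one : ∀ b : List ℕ, IsMelonic [⟨b, 0, 1⟩] →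
    F [⟨b, 0, 1⟩] = (b.map fun a => aeval t (bananaPoly a)).prod
  /-- If the last stage is `((a), p, k)`, omit it and add `a - 1` to the `k`-th entry of stage
  `p`. -/
  single : ∀ (T : List MelonicTuple) (a p k : ℕ), T ≠ [] →
    IsMelonic (T ++ [⟨[a], p, k⟩]) → IsReducedMelonic (T ++ [⟨[a], p, k⟩]) →
    F (T ++ [⟨[a], p, k⟩]) = F (resize T p k (· + (a - 1)))
  /-- If the last stage is `((1, …, 1), p, k)`, omit it. -/
  ones : ∀ (T : List MelonicTuple) (r p k : ℕ), T ≠ [] →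
    IsMelonic (T ++ [⟨List.replicate r 1, p, k⟩]) →
    IsReducedMelonic (T ++ [⟨List.replicate r 1, p, k⟩]) →
    F (T ++ [⟨List.replicate r 1, p, k⟩]) = (t + 1) ^ (r - 1) * F T
  /-- If the last stage is `((a₁, …, a_r), p, k)` with `r > 1` and `a = max aᵢ > 1`, use the
  constructions in which `a` is replaced by `1`, resp. omitted, and the one in which the last
  stage is omitted and the size of the `k`-th banana of stage `p` is decreased by `1`. -/
  main : ∀ (T : List MelonicTuple) (as bs : List ℕ) (a p k : ℕ), T ≠ [] →
    IsMelonic (T ++ [⟨as ++ a :: bs, p, k⟩]) →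
    IsReducedMelonic (T ++ [⟨as ++ a :: bs, p, k⟩]) →
    as ++ bs ≠ [] → 1 < a → (∀ x ∈ as ++ bs, x ≤ a) →
    F (T ++ [⟨as ++ a :: bs, p, k⟩]) =
      aeval t (fPoly a) * F (T ++ [⟨as ++ 1 :: bs, p, k⟩]) +
      aeval t (gPoly a) * F (T ++ [⟨as ++ bs, p, k⟩]) +
      (as.map fun x => aeval t (bananaPoly x)).prod *
        (bs.map fun x => aeval t (bananaPoly x)).prod *
        aeval t (hPoly a) * F (resize T p k (· - 1))

end

noncomputable section

/-! ## Classes of affine varieties -/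

/-! The recursion is deletion–contraction. For an edge `e` which is not a loop, Ψ_G = t_e Ψ_{G∖e} +
Ψ_{G/e}; for a loop the second term is absent (`treePoly_consEnds_eq_ite`). Cutting the complement
of a hypersurface tA + B = 0 along A = 0 gives its class as 𝕋[A ≠ 0] + 𝕃([B ≠ 0] − [AB ≠ 0])
(`complClass_linear`).

Put m parallel edges between distinct vertices x, y of a graph. Let u_m be the class of the result,
c_m the class after identifying x and y, and w_m the class of the common complement of the two
hypersurfaces (`pairClass`). Then u_{m+1} = 𝕋u_m + 𝕃(c_m − w_m), c_{m+1} = 𝕋c_m and w_{m+1} = 𝕋c_m −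
w_m. The class w_0 is not controlled, but u_1 eliminates it: u_m = f_m u_1 + g_m c_0 + h_m u_0
(`multiplication_recurrence`, `listClass_replicate_append`).

Apply this to the banana a_m of the last string. Then u_1 and c_0 are the classes of T' and T'',
while in u_0 the string breaks into two chains, each attached to the rest of the graph at one
vertex. A disconnected graph has Ψ = 0, so the same formula shows that a banana attached at one
vertex contributes 𝔹 (`edgeClass_pendant`). The chains therefore contribute the product of the
𝔹_{a_i}, and the graph of T''' is left (`edgeClass_string`). Edges in series occur in Ψ only through
the sum of their variables, whence the powers of 𝕃 (`edgeClass_subdivide`).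

To compare constructions, the predicate `Builds` allows the new vertices to be arbitrary. It
determines the graph up to relabelling (`Builds.exists_relabel`), and the graph in the statement is
one instance (`Builds.melonicState`). Hence T, T', T'', T''' can be realised around one common rest
graph; `Builds.resize` changes the number of edges in a banana.

A string that replaces a `1`-banana can instead be written directly into the stage which created
that banana (`Builds.splice`); by induction this gives reduced constructions
(`Builds.exists_reduced`). Finally, the rules determine the class by induction on the number of
edges and then on the depth (`MelonicRecursion.eq_melonicClass`). -/

theorem K0.mk_eq_of_iso {K : Type u} [Field K] {X Y : Variety K} (e : X ≅ Y) :
    K0.mk X = K0.mk Y := by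
  have : toSkeleton X = toSkeleton Y := toSkeleton_eq_toSkeleton_iff.mpr ⟨e⟩
  rw [K0.mk, K0.mk, freeClass, freeClass, this]

theorem K0.mk_eq_of_overIso {K : Type u} [Field K] {X Y : Variety K} (e : X.obj ≅ Y.obj) :
    K0.mk X = K0.mk Y :=
  K0.mk_eq_of_iso ((IsVariety K).isoMk e)

theorem K0.mk_tensor {K : Type u} [Field K] (X Y : Variety K) :
    K0.mk (X ⊗ Y) = K0.mk X * K0.mk Y := by
  rw [K0.mk, K0.mk, K0.mk, freeClass, freeClass, freeClass, Skeleton.toSkeleton_tensorObj,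
    map_mul, map_mul]

theorem K0.mk_unit (K : Type u) [Field K] : K0.mk (𝟙_ (Variety K)) = 1 := by
  have h : toSkeleton (𝟙_ (Variety K)) = 1 := (Skeleton.one_eq).symm
  rw [K0.mk, freeClass, h, map_one, map_one]

theorem K0.mk_scissor {K : Type u} [Field K] (X Z W : Variety K) (i : Z ⟶ X) (j : W ⟶ X)
    (hi : IsClosedImmersion i.hom.left) (hj : IsOpenImmersion j.hom.left)
    (h : Set.range j.hom.left = (Set.range i.hom.left)ᶜ) :
    K0.mk X = K0.mk Z + K0.mk W := by
  have : Ideal.Quotient.mk (Ideal.span (scissorRelations K))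
      (freeClass X - freeClass Z - freeClass W) = 0 :=
    Ideal.Quotient.eq_zero_iff_mem.mpr (Ideal.subset_span ⟨X, Z, W, i, j, hi, hj, h, rfl⟩)
  rw [map_sub, map_sub, sub_sub, sub_eq_zero] at this
  exact this

/-- The spectrum of a finitely generated algebra, as a variety. -/
def specVariety (K : Type u) [Field K] (A : Type u) [CommRing A] [Algebra K A]
    [Algebra.FiniteType K A] : Variety K where
  obj := Over.mk (Spec.map (CommRingCat.ofHom (algebraMap K A)))
  property := by
    refine ⟨?_, ?_, ?_⟩
    · change IsSeparated (Spec.map _); infer_instance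
    · change LocallyOfFiniteType (Spec.map _)
      rw [HasRingHomProperty.Spec_iff (P := @LocallyOfFiniteType)]
      exact RingHom.finiteType_algebraMap.mpr inferInstance
    · change QuasiCompact (Spec.map _); infer_instance

/-- The morphism of spectra attached to a homomorphism of algebras. -/
def specVarietyMap {K : Type u} [Field K] {A B : Type u} [CommRing A] [Algebra K A]
    [Algebra.FiniteType K A] [CommRing B] [Algebra K B] [Algebra.FiniteType K B]
    (f : A →ₐ[K] B) : specVariety K B ⟶ specVariety K A :=
  ObjectProperty.homMk (Over.homMk (Spec.map (CommRingCat.ofHom (f : A →+* B))) (by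
    change Spec.map _ ≫ Spec.map _ = Spec.map _
    rw [← Spec.map_comp, ← CommRingCat.ofHom_comp]
    congr 2
    exact f.comp_algebraMap))

section

variable (K : Type u) [Field K]

/-- The class of the spectrum of a finitely generated algebra. -/
def K0.ofAlg (A : Type u) [CommRing A] [Algebra K A] [Algebra.FiniteType K A] : K0 K :=
  K0.mk (specVariety K A)

variable {K} {A B : Type u} [CommRing A] [Algebra K A] [Algebra.FiniteType K A]
  [CommRing B] [Algebra K B] [Algebra.FiniteType K B]

theorem K0.ofAlg_congr (e : A ≃ₐ[K] B) : K0.ofAlg K A = K0.ofAlg K B := by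
  refine K0.mk_eq_of_overIso (Over.isoMk (Scheme.Spec.mapIso
    (e.symm.toRingEquiv.toCommRingCatIso).op) ?_)
  change Spec.map _ ≫ Spec.map _ = Spec.map _
  rw [← Spec.map_comp]
  congr 1
  ext x
  exact e.symm.commutes x

open TensorProduct in
instance finiteType_tensorProduct : Algebra.FiniteType K (A ⊗[K] B) :=
  Algebra.FiniteType.trans (S := A) inferInstance inferInstance

open TensorProduct in
theorem K0.ofAlg_tensor : K0.ofAlg K (A ⊗[K] B) = K0.ofAlg K A * K0.ofAlg K B := by
  rw [K0.ofAlg, K0.ofAlg, K0.ofAlg, ← K0.mk_tensor]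
  refine K0.mk_eq_of_overIso (Over.isoMk (pullbackSpecIso K A B).symm ?_)
  refine (pullbackSpecIso_inv_fst_assoc K A B _).trans ?_
  refine (Spec.map_comp _ _).symm.trans ?_
  rw [← CommRingCat.ofHom_comp]
  rfl

variable (K) in
theorem K0.ofAlg_self : K0.ofAlg K K = 1 := by
  have h : Spec.map (CommRingCat.ofHom (algebraMap K K)) = 𝟙 (Spec (.of K)) := by
    rw [Algebra.algebraMap_self, CommRingCat.ofHom_id]
    exact Spec.map_id _
  have h' : (specVariety K K).obj = Over.mk (𝟙 (Spec (.of K))) := congrArg Over.mk h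
  rw [← K0.mk_unit]
  exact K0.mk_eq_of_overIso (eqToIso h')

/-- The affine form of the scissor relation: Spec B is the zero locus of `f` in Spec A, and Spec C
is the basic open set of `f`. -/
theorem K0.ofAlg_of_surjective_of_away (q : A →ₐ[K] B) (hq : Function.Surjective q) (f : A)
    (hker : RingHom.ker (q : A →+* B) = Ideal.span {f})
    (C : Type u) [CommRing C] [Algebra K C] [Algebra.FiniteType K C] [Algebra A C]
    [IsScalarTower K A C] [IsLocalization.Away f C] :
    K0.ofAlg K A = K0.ofAlg K B + K0.ofAlg K C := by
  refine K0.mk_scissor _ _ _ (specVarietyMap q)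
    (specVarietyMap (IsScalarTower.toAlgHom K A C)) ?_ ?_ ?_
  · exact IsClosedImmersion.spec_of_surjective (CommRingCat.ofHom (q : A →+* B)) hq
  · exact IsOpenImmersion.of_isLocalization (R := A) (S := C) f
  · change Set.range (PrimeSpectrum.comap (algebraMap A C)) =
      (Set.range (PrimeSpectrum.comap (q : A →+* B)))ᶜ
    rw [PrimeSpectrum.localization_away_comap_range C f,
      range_comap_of_surjective _ (q : A →+* B) hq,
      hker, PrimeSpectrum.zeroLocus_span, PrimeSpectrum.basicOpen_eq_zeroLocus_compl]

/-- Over the zero ring the scissor relation for `0`, which is a unit there, reads [∅] = [∅] + [∅].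
-/
theorem K0.ofAlg_of_subsingleton [Subsingleton A] : K0.ofAlg K A = 0 := by
  have : IsLocalization.Away (0 : A) A :=
    IsLocalization.away_of_isUnit_of_bijective A
      (by rw [Subsingleton.elim (0 : A) 1]; exact isUnit_one) Function.bijective_id
  have h := K0.ofAlg_of_surjective_of_away (AlgHom.id K A) Function.surjective_id 0
    (by ext x; simp [Subsingleton.elim x 0]) A
  simpa using h

end

/-! ## Loci in affine spaces -/

instance finiteType_localizationAway {K A : Type u} [Field K] [CommRing A] [Algebra K A]
    [Algebra.FiniteType K A] (f : A) : Algebra.FiniteType K (Localization.Away f) :=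
  have := IsLocalization.Away.finitePresentation (S := Localization.Away f) f
  Algebra.FiniteType.trans (S := A) inferInstance inferInstance

section

variable {K : Type u} [Field K] {σ τ : Type}

/-- The coordinate ring of the locus `e = 0`, `g ≠ 0` in an affine space. -/
def LocusAlg (e g : MvPolynomial σ K) : Type u :=
  Localization.Away (Ideal.Quotient.mk (Ideal.span {e}) g)

instance (e g : MvPolynomial σ K) : CommRing (LocusAlg e g) :=
  inferInstanceAs (CommRing (Localization.Away (Ideal.Quotient.mk (Ideal.span {e}) g)))

instance (e g : MvPolynomial σ K) : Algebra K (LocusAlg e g) :=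
  inferInstanceAs (Algebra K (Localization.Away (Ideal.Quotient.mk (Ideal.span {e}) g)))

instance (e g : MvPolynomial σ K) : Algebra (MvPolynomial σ K ⧸ Ideal.span {e}) (LocusAlg e g) :=
  inferInstanceAs (Algebra _ (Localization.Away (Ideal.Quotient.mk (Ideal.span {e}) g)))

instance (e g : MvPolynomial σ K) :
    IsScalarTower K (MvPolynomial σ K ⧸ Ideal.span {e}) (LocusAlg e g) :=
  inferInstanceAs (IsScalarTower K _ (Localization.Away (Ideal.Quotient.mk (Ideal.span {e}) g)))

instance (e g : MvPolynomial σ K) :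
    IsLocalization.Away (Ideal.Quotient.mk (Ideal.span {e}) g) (LocusAlg e g) :=
  inferInstanceAs (IsLocalization.Away _
    (Localization.Away (Ideal.Quotient.mk (Ideal.span {e}) g)))

instance [Finite σ] (e g : MvPolynomial σ K) : Algebra.FiniteType K (LocusAlg e g) :=
  inferInstanceAs (Algebra.FiniteType K
    (Localization.Away (Ideal.Quotient.mk (Ideal.span {e}) g)))

namespace LocusAlg

variable {e g : MvPolynomial σ K} {e' g' : MvPolynomial τ K}
  {R : Type u} [CommRing R] [Algebra K R]

variable (e g) in
/-- The quotient map from the polynomial ring to the coordinate ring of a locus. -/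
def ofPoly : MvPolynomial σ K →ₐ[K] LocusAlg e g :=
  (IsScalarTower.toAlgHom K (MvPolynomial σ K ⧸ Ideal.span {e}) (LocusAlg e g)).comp
    (Ideal.Quotient.mkₐ K (Ideal.span {e}))

variable (e g) in
/-- The generic point of a locus. -/
def point (i : σ) : LocusAlg e g := ofPoly e g (MvPolynomial.X i)

theorem aeval_point (p : MvPolynomial σ K) : MvPolynomial.aeval (point e g) p = ofPoly e g p := by
  have : MvPolynomial.aeval (point e g) = ofPoly e g :=
    MvPolynomial.algHom_ext fun i => by rw [MvPolynomial.aeval_X]; rfl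
  rw [this]

theorem ofPoly_equation : ofPoly e g e = 0 := by
  change algebraMap _ (LocusAlg e g) (Ideal.Quotient.mk (Ideal.span {e}) e) = 0
  rw [Ideal.Quotient.eq_zero_iff_mem.mpr (Ideal.mem_span_singleton_self e), map_zero]

theorem isUnit_ofPoly : IsUnit (ofPoly e g g) :=
  IsLocalization.Away.algebraMap_isUnit (Ideal.Quotient.mk (Ideal.span {e}) g)

theorem hom_ext {φ ψ : LocusAlg e g →ₐ[K] R} (h : ∀ i, φ (point e g i) = ψ (point e g i)) :
    φ = ψ := by
  have h1 : φ.comp (ofPoly e g) = ψ.comp (ofPoly e g) := MvPolynomial.algHom_ext h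
  refine IsLocalization.algHom_ext (Submonoid.powers (Ideal.Quotient.mk (Ideal.span {e}) g)) ?_
  exact Ideal.Quotient.algHom_ext _ h1

/-- The homomorphism from the coordinate ring of a locus given by a point of the locus. -/
def lift (x : σ → R) (he : MvPolynomial.aeval x e = 0) (hg : IsUnit (MvPolynomial.aeval x g)) :
    LocusAlg e g →ₐ[K] R :=
  IsLocalization.Away.liftAlgHom (Ideal.Quotient.mk (Ideal.span {e}) g)
    (f := Ideal.Quotient.liftₐ (Ideal.span {e}) (MvPolynomial.aeval x) (by
      intro a ha
      obtain ⟨c, rfl⟩ := Ideal.mem_span_singleton.mp ha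
      rw [map_mul, he, zero_mul])) hg

theorem lift_ofPoly (x : σ → R) (he : MvPolynomial.aeval x e = 0)
    (hg : IsUnit (MvPolynomial.aeval x g)) (p : MvPolynomial σ K) :
    lift x he hg (ofPoly e g p) = MvPolynomial.aeval x p := by
  exact IsLocalization.Away.lift_eq (Ideal.Quotient.mk (Ideal.span {e}) g) hg _

@[simp]
theorem lift_point (x : σ → R) (he : MvPolynomial.aeval x e = 0)
    (hg : IsUnit (MvPolynomial.aeval x g)) (i : σ) : lift x he hg (point e g i) = x i := by
  rw [point, lift_ofPoly, MvPolynomial.aeval_X]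

/-- Two loci with inverse coordinate transformations are isomorphic. -/
def equiv (x : σ → LocusAlg e' g') (y : τ → LocusAlg e g)
    (hxe : MvPolynomial.aeval x e = 0) (hxg : IsUnit (MvPolynomial.aeval x g))
    (hye : MvPolynomial.aeval y e' = 0) (hyg : IsUnit (MvPolynomial.aeval y g'))
    (hxy : ∀ i, lift y hye hyg (x i) = point e g i)
    (hyx : ∀ j, lift x hxe hxg (y j) = point e' g' j) : LocusAlg e g ≃ₐ[K] LocusAlg e' g' :=
  AlgEquiv.ofAlgHom (lift x hxe hxg) (lift y hye hyg)
    (hom_ext fun j => by simp [hyx]) (hom_ext fun i => by simp [hxy])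

end LocusAlg

open LocusAlg

variable [Finite σ] [Finite τ]

/-- The class of the locus `e = 0`, `g ≠ 0` in an affine space. -/
def locusClass (e g : MvPolynomial σ K) : K0 K := K0.ofAlg K (LocusAlg e g)

/-- The form in which all coordinate changes are made: each locus supplies a point of the other with
values in its own coordinate ring, and the two substitutions are inverse on the generic points. -/
theorem locusClass_eq {e g : MvPolynomial σ K} {e' g' : MvPolynomial τ K}
    (x : σ → LocusAlg e' g') (y : τ → LocusAlg e g)
    (hxe : MvPolynomial.aeval x e = 0) (hxg : IsUnit (MvPolynomial.aeval x g))
    (hye : MvPolynomial.aeval y e' = 0) (hyg : IsUnit (MvPolynomial.aeval y g'))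
    (hxy : ∀ i, lift y hye hyg (x i) = point e g i)
    (hyx : ∀ j, lift x hxe hxg (y j) = point e' g' j) : locusClass e g = locusClass e' g' :=
  K0.ofAlg_congr (LocusAlg.equiv x y hxe hxg hye hyg hxy hyx)

/-- The class of the complement of a hypersurface in an affine space. -/
def complClass (g : MvPolynomial σ K) : K0 K := K0.mk (hypersurfaceComplement g)

/-- The open subscheme and the spectrum of the localization are open immersions into affine space
with the same image, hence isomorphic. -/
theorem complClass_eq_ofAlg (g : MvPolynomial σ K) :
    complClass g = K0.ofAlg K (Localization.Away g) := by
  let j := Spec.map (CommRingCat.ofHom (algebraMap (MvPolynomial σ K) (Localization.Away g)))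
  have hr : Set.range (nonvanishing g).ι = Set.range j := by
    rw [Scheme.Opens.range_ι]
    exact (PrimeSpectrum.localization_away_comap_range (Localization.Away g) g).symm
  have : IsOpenImmersion j := IsOpenImmersion.of_isLocalization (R := MvPolynomial σ K) g
  let φ := IsOpenImmersion.isoOfRangeEq (nonvanishing g).ι j hr
  refine K0.mk_eq_of_overIso (Over.isoMk φ ?_)
  change φ.hom ≫ Spec.map _ = (nonvanishing g).ι ≫ _
  rw [← IsOpenImmersion.isoOfRangeEq_hom_fac _ j hr, Category.assoc]
  congr 1
  rw [← Spec.map_comp, ← CommRingCat.ofHom_comp]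
  congr 2

theorem complClass_eq_locusClass (g : MvPolynomial σ K) : complClass g = locusClass 0 g := by
  rw [complClass_eq_ofAlg]
  let φ : Localization.Away g →ₐ[K] LocusAlg 0 g :=
    IsLocalization.Away.liftAlgHom g (f := ofPoly 0 g) isUnit_ofPoly
  let ψ : LocusAlg 0 g →ₐ[K] Localization.Away g :=
    lift (fun i => algebraMap (MvPolynomial σ K) _ (MvPolynomial.X i)) (map_zero _) (by
      have : MvPolynomial.aeval (R := K)
          (fun i => algebraMap (MvPolynomial σ K) (Localization.Away g) (MvPolynomial.X i)) =
          IsScalarTower.toAlgHom K _ _ := MvPolynomial.algHom_ext fun i => by simp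
      rw [this]
      exact IsLocalization.Away.algebraMap_isUnit g)
  have hφ (p) : φ (algebraMap (MvPolynomial σ K) _ p) = ofPoly 0 g p :=
    IsLocalization.Away.lift_eq g isUnit_ofPoly p
  refine K0.ofAlg_congr (AlgEquiv.ofAlgHom φ ψ (hom_ext fun i => ?_) ?_)
  · change φ (ψ (point 0 g i)) = point 0 g i
    rw [lift_point, hφ]
    rfl
  · refine IsLocalization.algHom_ext (Submonoid.powers g) (MvPolynomial.algHom_ext fun i => ?_)
    change ψ (φ (algebraMap _ _ _)) = algebraMap _ _ _
    rw [hφ]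
    exact lift_point _ _ _ i

theorem locusClass_eq_zero_of_eq_zero {e g : MvPolynomial σ K} (h : g = 0) :
    locusClass e g = 0 := by
  have : Subsingleton (LocusAlg e g) := by
    subst h
    have := isUnit_ofPoly (e := e) (g := 0)
    rw [map_zero (ofPoly e 0), isUnit_zero_iff] at this
    exact subsingleton_of_zero_eq_one this
  exact K0.ofAlg_of_subsingleton

theorem complClass_zero : complClass (0 : MvPolynomial σ K) = 0 := by
  rw [complClass_eq_locusClass, locusClass_eq_zero_of_eq_zero rfl]

/-- In the locus `g ≠ 0`, the part `e = 0` is closed and its complement is `e * g ≠ 0`. The work is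
to identify the iterated quotient and localization with the corresponding `LocusAlg`, through
universal properties. -/
theorem locusClass_scissor (e g : MvPolynomial σ K) :
    locusClass 0 g = locusClass e g + locusClass 0 (e * g) := by
  let A := LocusAlg 0 g
  let f : A := ofPoly 0 g e
  have h := K0.ofAlg_of_surjective_of_away (Ideal.Quotient.mkₐ K (Ideal.span {f}))
    (Ideal.Quotient.mkₐ_surjective K _) f (Ideal.Quotient.mkₐ_ker K _) (Localization.Away f)
  have hq (p) : MvPolynomial.aeval
      (fun i => Ideal.Quotient.mkₐ K (Ideal.span {f}) (point 0 g i)) p =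
      Ideal.Quotient.mkₐ K (Ideal.span {f}) (ofPoly 0 g p) := by
    rw [← aeval_point, MvPolynomial.comp_aeval_apply]
  let ι : A →ₐ[K] Localization.Away f := IsScalarTower.toAlgHom K A _
  have hl (p) : MvPolynomial.aeval (fun i => ι (point 0 g i)) p = ι (ofPoly 0 g p) := by
    rw [← aeval_point, MvPolynomial.comp_aeval_apply]
  have h1 : K0.ofAlg K (A ⧸ Ideal.span {f}) = locusClass e g := by
    let φ : A →ₐ[K] LocusAlg e g :=
      lift (point e g) (map_zero _) (by rw [aeval_point]; exact isUnit_ofPoly)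
    let φ' : (A ⧸ Ideal.span {f}) →ₐ[K] LocusAlg e g := Ideal.Quotient.liftₐ _ φ (by
      intro a ha
      obtain ⟨c, rfl⟩ := Ideal.mem_span_singleton.mp ha
      rw [map_mul, lift_ofPoly, aeval_point, ofPoly_equation, zero_mul])
    let ψ : LocusAlg e g →ₐ[K] A ⧸ Ideal.span {f} :=
      lift (fun i => Ideal.Quotient.mkₐ K (Ideal.span {f}) (point 0 g i))
        (by rw [hq]; exact Ideal.Quotient.eq_zero_iff_mem.mpr (Ideal.mem_span_singleton_self f))
        (by rw [hq]; exact isUnit_ofPoly.map _)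
    refine K0.ofAlg_congr (AlgEquiv.ofAlgHom φ' ψ (hom_ext fun i => ?_)
      (Ideal.Quotient.algHom_ext _ (hom_ext fun i => ?_)))
    · change φ' (ψ (point e g i)) = point e g i
      rw [lift_point]
      change φ (point 0 g i) = point e g i
      rw [lift_point]
    · change ψ (φ (point 0 g i)) = _
      rw [lift_point, lift_point]
      rfl
  have h2 : K0.ofAlg K (Localization.Away f) = locusClass 0 (e * g) := by
    have hu : IsUnit (ofPoly 0 (e * g) e) ∧ IsUnit (ofPoly 0 (e * g) g) := by
      have := isUnit_ofPoly (e := 0) (g := e * g)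
      rwa [map_mul (ofPoly 0 (e * g)), IsUnit.mul_iff] at this
    let φ : A →ₐ[K] LocusAlg 0 (e * g) :=
      lift (point 0 (e * g)) (map_zero _) (by rw [aeval_point]; exact hu.2)
    have hφ : IsUnit (φ f) := by rw [lift_ofPoly, aeval_point]; exact hu.1
    let φ' : Localization.Away f →ₐ[K] LocusAlg 0 (e * g) :=
      IsLocalization.Away.liftAlgHom f (f := φ) hφ
    have hφ' (a) : φ' (ι a) = φ a := IsLocalization.Away.lift_eq f hφ a
    let ψ : LocusAlg 0 (e * g) →ₐ[K] Localization.Away f :=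
      lift (fun i => ι (point 0 g i)) (map_zero _) (by
        rw [hl, map_mul, map_mul]
        exact (IsLocalization.Away.algebraMap_isUnit f).mul (isUnit_ofPoly.map _))
    refine K0.ofAlg_congr (AlgEquiv.ofAlgHom φ' ψ (hom_ext fun i => ?_)
      (IsLocalization.algHom_ext (Submonoid.powers f) (hom_ext fun i => ?_)))
    · change φ' (ψ (point 0 (e * g) i)) = point 0 (e * g) i
      rw [lift_point, hφ', lift_point]
    · change ψ (φ' (ι (point 0 g i))) = ι (point 0 g i)
      rw [hφ', lift_point, lift_point]
  rw [← h1, ← h2]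
  exact h

end

/-! ### Functor of points, products, and hypersurfaces linear in one variable -/

section

open MvPolynomial LocusAlg

variable {K : Type u} [Field K] {σ τ : Type} [Finite σ] [Finite τ]

/-- Loci with the same points in every `K`-algebra coincide; the hypothesis is tested on the two
generic points. -/
theorem locusClass_congr {e g e' g' : MvPolynomial σ K}
    (h : ∀ (R : Type u) [CommRing R] [Algebra K R] (x : σ → R),
      (aeval x e = 0 ∧ IsUnit (aeval x g)) ↔ (aeval x e' = 0 ∧ IsUnit (aeval x g'))) :
    locusClass e g = locusClass e' g' := by
  have h1 := (h _ (point e' g')).mpr (by simp [aeval_point, ofPoly_equation, isUnit_ofPoly])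
  have h2 := (h _ (point e g)).mp (by simp [aeval_point, ofPoly_equation, isUnit_ofPoly])
  exact locusClass_eq (point e' g') (point e g) h1.1 h1.2 h2.1 h2.2 (by simp) (by simp)

theorem complClass_congr {g g' : MvPolynomial σ K}
    (h : ∀ (R : Type u) [CommRing R] [Algebra K R] (x : σ → R),
      IsUnit (aeval x g) ↔ IsUnit (aeval x g')) :
    complClass g = complClass g' := by
  rw [complClass_eq_locusClass, complClass_eq_locusClass]
  exact locusClass_congr fun R _ _ x => by simp [h R x]

theorem locusClass_eq_sub (e g : MvPolynomial σ K) :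
    locusClass e g = complClass g - complClass (e * g) := by
  rw [complClass_eq_locusClass, complClass_eq_locusClass, locusClass_scissor e g,
    add_sub_cancel_right]

theorem complClass_rename_equiv (f : σ ≃ τ) (g : MvPolynomial σ K) :
    complClass (rename f g) = complClass g := by
  rw [complClass_eq_locusClass, complClass_eq_locusClass]
  refine (locusClass_eq (fun i => point _ _ (f i)) (fun j => point _ _ (f.symm j)) (map_zero _) ?_
    (map_zero _) ?_ (fun i => ?_) (fun j => ?_)).symm
  · have := isUnit_ofPoly (e := 0) (g := rename f g)
    rwa [← aeval_point, aeval_rename] at this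
  · rw [aeval_rename]
    have : (fun j => point 0 g (f.symm j)) ∘ f = point 0 g := by ext; simp
    rw [this, aeval_point]
    exact isUnit_ofPoly
  · rw [lift_point, Equiv.symm_apply_apply]
  · rw [lift_point, Equiv.apply_symm_apply]

omit [Finite σ] in
theorem LocusAlg.exists_hom {e g : MvPolynomial σ K} {R : Type u} [CommRing R] [Algebra K R]
    (x : σ → R) (he : aeval x e = 0) (hg : IsUnit (aeval x g)) :
    ∃ φ : LocusAlg e g →ₐ[K] R, ∀ i, φ (point e g i) = x i :=
  ⟨lift x he hg, lift_point x he hg⟩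

/-- A criterion for `C` to be the tensor product: `φ` and the product of `ψ₁` and `ψ₂` are inverse,
one composite being checked on the two factors by `h₁`, `h₂` and the other one given by `h₃`. -/
theorem K0.ofAlg_eq_mul {A B C : Type u} [CommRing A] [Algebra K A] [Algebra.FiniteType K A]
    [CommRing B] [Algebra K B] [Algebra.FiniteType K B]
    [CommRing C] [Algebra K C] [Algebra.FiniteType K C]
    (φ : C →ₐ[K] TensorProduct K A B) (ψ₁ : A →ₐ[K] C) (ψ₂ : B →ₐ[K] C)
    (h₁ : φ.comp ψ₁ = Algebra.TensorProduct.includeLeft)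
    (h₂ : φ.comp ψ₂ = Algebra.TensorProduct.includeRight)
    (h₃ : (Algebra.TensorProduct.productMap ψ₁ ψ₂).comp φ = AlgHom.id K C) :
    K0.ofAlg K C = K0.ofAlg K A * K0.ofAlg K B := by
  rw [← K0.ofAlg_tensor]
  refine K0.ofAlg_congr (AlgEquiv.ofAlgHom φ (Algebra.TensorProduct.productMap ψ₁ ψ₂)
    (Algebra.TensorProduct.ext ?_ ?_) h₃)
  · rw [AlgHom.comp_assoc, Algebra.TensorProduct.productMap_left, h₁, AlgHom.id_comp]
  · ext x
    simp only [AlgHom.comp_apply, AlgHom.restrictScalars_apply,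
      Algebra.TensorProduct.includeRight_apply, Algebra.TensorProduct.productMap_apply_tmul,
      map_one, one_mul, AlgHom.id_apply]
    exact DFunLike.congr_fun h₂ x

/-- The conditions on the coordinate `none` and on the other coordinates are independent, so the
locus is a product with a locus in the line. The cases `h = 1` and `h = X ()` produce the factors 𝕃
and 𝕋. -/
theorem locusClass_option (e g : MvPolynomial σ K) (h : MvPolynomial Unit K) :
    locusClass (rename some e) (rename some g * rename (fun _ => none) h) =
      locusClass e g * locusClass 0 h := by
  obtain ⟨e', he'⟩ : ∃ e' : MvPolynomial (Option σ) K, e' = rename some e := ⟨_, rfl⟩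
  obtain ⟨g', hg'⟩ : ∃ g' : MvPolynomial (Option σ) K,
    g' = rename some g * rename (fun _ => none) h := ⟨_, rfl⟩
  rw [← he', ← hg', locusClass, locusClass, locusClass]
  obtain ⟨l, hl'⟩ : ∃ l : LocusAlg e g →ₐ[K] TensorProduct K (LocusAlg e g) (LocusAlg 0 h),
    l = Algebra.TensorProduct.includeLeft := ⟨_, rfl⟩
  obtain ⟨r, hr'⟩ : ∃ r : LocusAlg 0 h →ₐ[K] TensorProduct K (LocusAlg e g) (LocusAlg 0 h),
    r = Algebra.TensorProduct.includeRight := ⟨_, rfl⟩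
  obtain ⟨φ, hφ⟩ : ∃ φ : LocusAlg e' g' →ₐ[K] TensorProduct K (LocusAlg e g) (LocusAlg 0 h),
      ∀ o, φ (point e' g' o) = o.elim (r (point 0 h ())) (fun i => l (point e g i)) := by
    have hl (p) : aeval (fun i => l (point e g i)) p = l (ofPoly e g p) := by
      rw [← aeval_point, comp_aeval_apply]
    have hr (p) : aeval (fun i => r (point 0 h i)) p = r (ofPoly 0 h p) := by
      rw [← aeval_point, comp_aeval_apply]
    refine exists_hom _ ?_ ?_
    · rw [he', aeval_rename]
      exact (hl e).trans (by rw [ofPoly_equation, map_zero])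
    · rw [hg', map_mul, aeval_rename, aeval_rename]
      refine IsUnit.mul ?_ ?_
      · exact (hl g).symm ▸ isUnit_ofPoly.map l
      · exact (hr h).symm ▸ isUnit_ofPoly.map r
  have hu : IsUnit (aeval (point e' g') (rename some g)) ∧
      IsUnit (aeval (point e' g') (rename (fun _ : Unit => none) h)) := by
    rw [← IsUnit.mul_iff, ← map_mul (aeval (point e' g')), aeval_point, ← hg']
    exact isUnit_ofPoly
  simp only [aeval_rename] at hu
  obtain ⟨ψ₁, hψ₁⟩ := exists_hom (e := e) (point e' g' ∘ some)
    (by rw [← aeval_rename, aeval_point, ← he', ofPoly_equation]) hu.1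
  obtain ⟨ψ₂, hψ₂⟩ := exists_hom (e := 0) (point e' g' ∘ fun _ => none) (map_zero _) hu.2
  refine K0.ofAlg_eq_mul φ ψ₁ ψ₂ (hom_ext fun i => ?_) (hom_ext fun i => ?_) (hom_ext fun o => ?_)
  · rw [AlgHom.comp_apply, hψ₁, Function.comp_apply, hφ, ← hl']
    rfl
  · rw [AlgHom.comp_apply, hψ₂, Function.comp_apply, hφ, ← hr']
    rfl
  · rw [AlgHom.comp_apply, hφ, AlgHom.id_apply]
    cases o with
    | none =>
      rw [Option.elim_none, hr']
      exact (Algebra.TensorProduct.productMap_right_apply ψ₁ ψ₂ _).trans (hψ₂ _)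
    | some i =>
      rw [Option.elim_some, hl']
      exact (Algebra.TensorProduct.productMap_left_apply ψ₁ ψ₂ _).trans (hψ₁ _)

theorem complClass_one : complClass (1 : MvPolynomial σ K) = K0.mk (affineSpace K σ) := by
  have h : K0.mk (affineSpace K σ) = K0.ofAlg K (MvPolynomial σ K) := rfl
  have := IsLocalization.away_of_isUnit_of_bijective (MvPolynomial σ K)
    (isUnit_one (M := MvPolynomial σ K)) Function.bijective_id
  rw [complClass_eq_ofAlg, h]
  exact K0.ofAlg_congr ((IsLocalization.algEquiv (Submonoid.powers (1 : MvPolynomial σ K))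
    (Localization.Away (1 : MvPolynomial σ K)) (MvPolynomial σ K)).restrictScalars K)

theorem complClass_unit_one : complClass (1 : MvPolynomial Unit K) = lefschetz K :=
  complClass_one

theorem complClass_isEmpty_one [IsEmpty σ] : complClass (1 : MvPolynomial σ K) = 1 := by
  have h : K0.mk (affineSpace K σ) = K0.ofAlg K (MvPolynomial σ K) := rfl
  rw [complClass_one, h, ← K0.ofAlg_self]
  exact K0.ofAlg_congr (isEmptyAlgEquiv K σ)

theorem locusClass_unit_X : locusClass 0 (X () : MvPolynomial Unit K) = torus K := by
  have h1 : locusClass (X () : MvPolynomial Unit K) 1 = 1 := by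
    rw [← complClass_isEmpty_one (K := K) (σ := Empty), complClass_eq_locusClass]
    refine locusClass_eq (fun _ => 0) (fun j => j.elim) (by simp) (by simp) (by simp) (by simp)
      (fun i => ?_) (fun j => j.elim)
    have := ofPoly_equation (e := (X () : MvPolynomial Unit K)) (g := 1)
    rw [map_zero]
    exact this.symm
  have h2 := locusClass_eq_sub (X () : MvPolynomial Unit K) 1
  rw [h1, complClass_unit_one, mul_one, complClass_eq_locusClass] at h2
  rw [torus, h2]
  ring

theorem locusClass_rename_some (e g : MvPolynomial σ K) :
    locusClass (rename some e) (rename some g) = lefschetz K * locusClass e g := by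
  have := locusClass_option e g 1
  rwa [map_one, mul_one, ← complClass_eq_locusClass, complClass_unit_one, mul_comm] at this

theorem complClass_rename_some (g : MvPolynomial σ K) :
    complClass (rename some g) = lefschetz K * complClass g := by
  have := locusClass_rename_some 0 g
  rwa [map_zero, ← complClass_eq_locusClass, ← complClass_eq_locusClass] at this

theorem complClass_X_none_mul (g : MvPolynomial σ K) :
    complClass (X none * rename some g) = torus K * complClass g := by
  have := locusClass_option 0 g (X ())
  rwa [map_zero, rename_X, locusClass_unit_X, ← complClass_eq_locusClass,
    ← complClass_eq_locusClass, mul_comm, mul_comm (complClass g)] at this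

omit [Finite σ] in
theorem aeval_elim_rename_some {R : Type u} [CommRing R] [Algebra K R] (a : R) (x : σ → R)
    (p : MvPolynomial σ K) :
    aeval (fun o : Option σ => o.elim a x) (rename some p) = aeval x p := by
  rw [aeval_rename]
  rfl

/-- Where `A` is invertible, t ↦ tA + B is a change of the last coordinate, with inverse t ↦ (t −
B)/A. -/
theorem complClass_mul_linear (g A B : MvPolynomial σ K) :
    complClass (rename some A * (rename some g * (X none * rename some A + rename some B))) =
      complClass (X none * rename some (g * A)) := by
  rw [complClass_eq_locusClass, complClass_eq_locusClass]
  obtain ⟨G, hG⟩ : ∃ G : MvPolynomial (Option σ) K,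
    G = rename some A * (rename some g * (X none * rename some A + rename some B)) := ⟨_, rfl⟩
  obtain ⟨H, hH⟩ : ∃ H : MvPolynomial (Option σ) K, H = X none * rename some (g * A) := ⟨_, rfl⟩
  rw [← hG, ← hH]
  let p : σ → LocusAlg 0 G := fun i => point 0 G (some i)
  let q : σ → LocusAlg 0 H := fun i => point 0 H (some i)
  have hp : (fun o : Option σ => o.elim (point 0 G none) p) = point 0 G := by
    ext (_ | _) <;> rfl
  have hq : (fun o : Option σ => o.elim (point 0 H none) q) = point 0 H := by
    ext (_ | _) <;> rfl
  have hGu := isUnit_ofPoly (e := 0) (g := G)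
  have hHu := isUnit_ofPoly (e := 0) (g := H)
  rw [← aeval_point, congrArg (aeval (point 0 G)) hG, ← hp] at hGu
  rw [← aeval_point, congrArg (aeval (point 0 H)) hH, ← hq] at hHu
  simp only [map_mul, map_add, aeval_elim_rename_some, aeval_X, Option.elim_none,
    IsUnit.mul_iff] at hGu hHu
  obtain ⟨hA, hg, ht⟩ := hGu
  obtain ⟨ht', hg', hA'⟩ := hHu
  obtain ⟨u, hu⟩ := hA'
  refine locusClass_eq (fun o => o.elim ((point 0 H none - aeval q B) * ↑u⁻¹) q)
    (fun o => o.elim (point 0 G none * aeval p A + aeval p B) p) (map_zero _) ?_ (map_zero _) ?_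
    (fun o => ?_) (fun o => ?_)
  · simp only [hG, map_mul, map_add, aeval_elim_rename_some, aeval_X, Option.elim_none, ← hu,
      Units.inv_mul_cancel_right, sub_add_cancel]
    exact u.isUnit.mul (hg'.mul ht')
  · simp only [hH, map_mul, aeval_elim_rename_some, aeval_X, Option.elim_none]
    exact ht.mul (hg.mul hA)
  · obtain ⟨φ, hφ⟩ : ∃ φ, φ = lift (e := 0) (g := H)
      (fun o => o.elim (point 0 G none * aeval p A + aeval p B) p) (map_zero _) (by
        simp only [hH, map_mul, aeval_elim_rename_some, aeval_X, Option.elim_none]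
        exact ht.mul (hg.mul hA)) := ⟨_, rfl⟩
    rw [← hφ]
    have h (o) : φ (point 0 H o) = o.elim (point 0 G none * aeval p A + aeval p B) p := by
      rw [hφ, lift_point]
    have h' (f : MvPolynomial σ K) : φ (aeval q f) = aeval p f := by
      rw [comp_aeval_apply]
      congr 2
      ext i
      exact h (some i)
    cases o with
    | none =>
      have h1 : φ ↑u * φ ↑u⁻¹ = 1 := by rw [← map_mul, Units.mul_inv, map_one]
      rw [hu, h'] at h1
      rw [Option.elim_none, map_mul, map_sub, h, h', Option.elim_none, add_sub_cancel_right,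
        mul_assoc, h1, mul_one]
    | some i => exact h (some i)
  · obtain ⟨φ, hφ⟩ : ∃ φ, φ = lift (e := 0) (g := G)
      (fun o => o.elim ((point 0 H none - aeval q B) * ↑u⁻¹) q) (map_zero _) (by
        simp only [hG, map_mul, map_add, aeval_elim_rename_some, aeval_X, Option.elim_none, ← hu,
          Units.inv_mul_cancel_right, sub_add_cancel]
        exact u.isUnit.mul (hg'.mul ht')) := ⟨_, rfl⟩
    rw [← hφ]
    have h (o) : φ (point 0 G o) = o.elim ((point 0 H none - aeval q B) * ↑u⁻¹) q := by
      rw [hφ, lift_point]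
    have h' (f : MvPolynomial σ K) : φ (aeval p f) = aeval q f := by
      rw [comp_aeval_apply]
      congr 2
      ext i
      exact h (some i)
    cases o with
    | none =>
      rw [Option.elim_none, map_add, map_mul, h, h', h', Option.elim_none, ← hu,
        Units.inv_mul_cancel_right, sub_add_cancel]
    | some i => exact h (some i)

/-- The complement of a hypersurface which is linear in one of the variables. -/
theorem complClass_linear (g A B : MvPolynomial σ K) :
    complClass (rename some g * (X none * rename some A + rename some B)) =
      torus K * complClass (g * A) +
        lefschetz K * (complClass (g * B) - complClass (g * A * B)) := by
  have h := locusClass_scissor (rename some A)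
    (rename some g * (X none * rename some A + rename some B))
  rw [← complClass_eq_locusClass, ← complClass_eq_locusClass] at h
  -- On `A = 0` the linear form is just `B`, so the last variable becomes free and splits off a
  -- factor 𝕃.
  have h1 : locusClass (rename some A)
      (rename some g * (X none * rename some A + rename some B)) =
      locusClass (rename some A) (rename some (g * B)) := by
    refine locusClass_congr fun R _ _ x => and_congr_right fun hx => ?_
    rw [map_mul, map_add, map_mul (aeval x) (X none), hx, mul_zero, zero_add,
      map_mul (rename some), map_mul]
  rw [h, add_comm, complClass_mul_linear, complClass_X_none_mul, h1, locusClass_rename_some,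
    locusClass_eq_sub, ← mul_assoc, mul_comm A g]

/-- Remove t = 0 from the locus B(tA + B) ≠ 0. On t = 0 the condition is B² ≠ 0, that is B ≠ 0, and
`complClass_linear` with `g = B` computes the whole locus. This shape arises as the product of a
deletion and a contraction in `pairClass_cons`. -/
theorem complClass_X_none_mul_linear (A B : MvPolynomial σ K) :
    complClass (X none * (rename some B * (X none * rename some A + rename some B))) =
      torus K * complClass B - complClass (A * B) := by
  have h := locusClass_eq_sub (X none)
    (rename some B * (X none * rename some A + rename some B))
  have h1 : locusClass (X none) (rename some B * (X none * rename some A + rename some B)) =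
      complClass B := by
    rw [complClass_eq_locusClass]
    have h2 := ofPoly_equation (e := X none)
      (g := rename some B * (X none * rename some A + rename some B))
    have h3 := isUnit_ofPoly (e := X none)
      (g := rename some B * (X none * rename some A + rename some B))
    rw [← aeval_point, map_mul, aeval_rename, IsUnit.mul_iff] at h3
    refine locusClass_eq (fun o => o.elim 0 (point 0 B)) (fun i => point _ _ (some i)) ?_ ?_
      (map_zero _) h3.1 (fun o => ?_) (fun i => ?_)
    · rw [aeval_X]
      rfl
    · simp only [map_mul, map_add, aeval_elim_rename_some, aeval_X, Option.elim_none, zero_mul,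
        zero_add, aeval_point]
      exact isUnit_ofPoly.mul isUnit_ofPoly
    · cases o with
      | none => rw [Option.elim_none, map_zero]; exact h2.symm
      | some i => exact lift_point _ _ _ i
    · rw [lift_point]
      rfl
  have h2 : complClass (B * A * B) = complClass (A * B) :=
    complClass_congr fun R _ _ x => by simp only [map_mul, IsUnit.mul_iff]; tauto
  have h3 : complClass (B * B) = complClass B :=
    complClass_congr fun R _ _ x => by simp only [map_mul, IsUnit.mul_iff]; tauto
  rw [h1, complClass_linear, h2, h3, mul_comm B A, torus] at h
  rw [torus]
  linear_combination h

/-- Two variables which only occur through their sum. -/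
theorem complClass_add_linear (A B : MvPolynomial σ K) :
    complClass (X none * rename some (rename some A) +
      rename some (X none * rename some A + rename some B)) =
    lefschetz K * complClass (X none * rename some A + rename some B) := by
  rw [← complClass_rename_some, complClass_eq_locusClass, complClass_eq_locusClass]
  obtain ⟨G, hG⟩ : ∃ G : MvPolynomial (Option (Option σ)) K,
    G = X none * rename some (rename some A) +
      rename some (X none * rename some A + rename some B) := ⟨_, rfl⟩
  obtain ⟨H, hH⟩ : ∃ H : MvPolynomial (Option (Option σ)) K,
    H = rename some (X none * rename some A + rename some B) := ⟨_, rfl⟩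
  rw [← hG, ← hH]
  have key (R : Type u) [CommRing R] [Algebra K R] (z : Option (Option σ) → R)
      (w : Option (Option σ) → R) (h : ∀ i, z (some (some i)) = w (some (some i)))
      (h' : z none + z (some none) = w (some none)) : aeval z G = aeval w H := by
    have h1 : (z ∘ some) ∘ some = (w ∘ some) ∘ some := funext h
    simp only [hG, hH, map_add, map_mul, aeval_X, rename_X, aeval_rename, ← h', h1]
    ring
  have hGu := isUnit_ofPoly (e := 0) (g := G)
  have hHu := isUnit_ofPoly (e := 0) (g := H)
  rw [← aeval_point] at hGu hHu
  refine locusClass_eq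
    (fun o => o.elim (point 0 H none) (fun o => o.elim (point 0 H (some none) - point 0 H none)
      (fun i => point 0 H (some (some i)))))
    (fun o => o.elim (point 0 G none) (fun o => o.elim (point 0 G (some none) + point 0 G none)
      (fun i => point 0 G (some (some i))))) (map_zero _) ?_ (map_zero _) ?_
    (fun o => ?_) (fun o => ?_)
  · refine (congrArg IsUnit (key _ _ (point 0 H) (fun i => ?_) ?_)).mpr hHu
    · rfl
    · exact add_sub_cancel _ _
  · refine (congrArg IsUnit (key _ (point 0 G) _ (fun i => ?_) ?_)).mp hGu
    · rfl
    · exact add_comm _ _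
  · rcases o with _ | _ | i
    · exact lift_point _ _ _ _
    · simp only [Option.elim_some, Option.elim_none, map_sub, lift_point, add_sub_cancel_right]
    · exact lift_point _ _ _ _
  · rcases o with _ | _ | i
    · exact lift_point _ _ _ _
    · simp only [Option.elim_some, Option.elim_none, map_add, lift_point, sub_add_cancel]
    · exact lift_point _ _ _ _

end

/-! ## Spanning trees modulo an equivalence relation on the vertices -/

section

variable {V W ι κ : Type}

/-- The equivalence relation on vertices generated by `r` and by the edges in `S`. -/
def conn (ends : ι → V × V) (r : Setoid V) (S : Set ι) : Setoid V :=
  Relation.EqvGen.setoid fun x y => r x y ∨ ∃ i ∈ S, ends i = (x, y)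

/-- The universal property of the generated relation. Identities between such relations are proved
below by comparing the relations that lie above them. -/
theorem conn_le_iff {ends : ι → V × V} {r q : Setoid V} {S : Set ι} :
    conn ends r S ≤ q ↔ r ≤ q ∧ ∀ i ∈ S, q (ends i).1 (ends i).2 := by
  refine ⟨fun h => ⟨fun x y hxy => h (.rel _ _ (.inl hxy)),
    fun i hi => h (.rel _ _ (.inr ⟨i, hi, rfl⟩))⟩, fun ⟨h1, h2⟩ => Setoid.eqvGen_le ?_⟩
  rintro x y (hxy | ⟨i, hi, h⟩)
  · exact h1 hxy
  · have := h2 i hi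
    rwa [h] at this

theorem le_conn (ends : ι → V × V) (r : Setoid V) (S : Set ι) : r ≤ conn ends r S :=
  (conn_le_iff.mp le_rfl).1

theorem conn_ends (ends : ι → V × V) (r : Setoid V) {S : Set ι} {i : ι} (hi : i ∈ S) :
    conn ends r S (ends i).1 (ends i).2 :=
  (conn_le_iff.mp le_rfl).2 i hi

theorem conn_mono {ends : ι → V × V} {r r' : Setoid V} {S S' : Set ι} (hr : r ≤ r')
    (hS : S ⊆ S') : conn ends r S ≤ conn ends r' S' :=
  conn_le_iff.mpr ⟨hr.trans (le_conn _ _ _), fun _ hi => conn_ends _ _ (hS hi)⟩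

theorem conn_empty (ends : ι → V × V) (r : Setoid V) : conn ends r ∅ = r :=
  le_antisymm (conn_le_iff.mpr ⟨le_rfl, by simp⟩) (le_conn _ _ _)

/-- The equivalence relation obtained from `r` by identifying `x` and `y`. -/
def glue (r : Setoid V) (x y : V) : Setoid V where
  r a b := r a b ∨ (r a x ∧ r y b) ∨ (r a y ∧ r x b)
  iseqv := by
    have h1 : ∀ {a b}, r a b → r b a := r.symm'
    have h2 : ∀ {a b c}, r a b → r b c → r a c := r.trans'
    refine ⟨fun a => .inl (r.refl' a), ?_, ?_⟩
    · rintro a b (h | ⟨h, h'⟩ | ⟨h, h'⟩)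
      · exact .inl (h1 h)
      · exact .inr (.inr ⟨h1 h', h1 h⟩)
      · exact .inr (.inl ⟨h1 h', h1 h⟩)
    · rintro a b c (h | ⟨h, h'⟩ | ⟨h, h'⟩) (k | ⟨k, k'⟩ | ⟨k, k'⟩)
      · exact .inl (h2 h k)
      · exact .inr (.inl ⟨h2 h k, k'⟩)
      · exact .inr (.inr ⟨h2 h k, k'⟩)
      · exact .inr (.inl ⟨h, h2 h' k⟩)
      · exact .inr (.inl ⟨h, k'⟩)
      · exact .inl (h2 h k')
      · exact .inr (.inr ⟨h, h2 h' k⟩)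
      · exact .inl (h2 h k')
      · exact .inr (.inr ⟨h, k'⟩)

theorem glue_iff {r : Setoid V} {x y a b : V} :
    glue r x y a b ↔ r a b ∨ (r a x ∧ r y b) ∨ (r a y ∧ r x b) := Iff.rfl

theorem glue_le_iff {r q : Setoid V} {x y : V} : glue r x y ≤ q ↔ r ≤ q ∧ q x y := by
  refine ⟨fun h => ⟨fun a b hab => h (.inl hab), h (.inr (.inl ⟨r.refl' x, r.refl' y⟩))⟩, ?_⟩
  rintro ⟨h1, h2⟩ a b (h | ⟨h, h'⟩ | ⟨h, h'⟩)
  · exact h1 h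
  · exact q.trans' (h1 h) (q.trans' h2 (h1 h'))
  · exact q.trans' (h1 h) (q.trans' (q.symm' h2) (h1 h'))

theorem conn_insert (ends : ι → V × V) (r : Setoid V) (S : Set ι) (i : ι) :
    conn ends r (insert i S) = glue (conn ends r S) (ends i).1 (ends i).2 := by
  refine eq_of_forall_ge_iff fun q => ?_
  rw [conn_le_iff, glue_le_iff, conn_le_iff, Set.forall_mem_insert]
  tauto

theorem conn_glue (ends : ι → V × V) (r : Setoid V) (S : Set ι) (x y : V) :
    conn ends (glue r x y) S = glue (conn ends r S) x y := by
  refine eq_of_forall_ge_iff fun q => ?_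
  rw [conn_le_iff, glue_le_iff, glue_le_iff, conn_le_iff]
  tauto

/-- The edges in `S` form a spanning tree of the quotient by `r` of a graph with vertices `s`. -/
def IsTree (ends : ι → V × V) (s : Set V) (r : Setoid V) (S : Set ι) : Prop :=
  (∀ x ∈ s, ∀ y ∈ s, conn ends r S x y) ∧
    ∀ i ∈ S, ¬ conn ends r (S \ {i}) (ends i).1 (ends i).2

/-- An acyclic set of edges of the graph in which `x` and `y` are identified does not join
`x` and `y`. -/
theorem not_conn_of_acyclic_glue {ends : ι → V × V} {r : Setoid V} {S : Set ι} (hS : S.Finite)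
    {x y : V} (hxy : ¬ r x y)
    (h : ∀ i ∈ S, ¬ conn ends (glue r x y) (S \ {i}) (ends i).1 (ends i).2) :
    ¬ conn ends r S x y := by
  -- Add the edges of `S` one at a time. An edge that first joins `x` to `y` has its ends already
  -- joined, by earlier edges, one to `x` and the other to `y`. In the glued graph it would then
  -- close a cycle.
  refine Set.Finite.induction_on_subset (motive := fun T _ => ¬ conn ends r T x y) S hS ?_ ?_
  · rwa [conn_empty]
  · intro i S₀ hi hS₀ hiS₀ ih
    have h' := h i hi
    rw [conn_insert]
    have hle : conn ends (glue r x y) S₀ ≤ conn ends (glue r x y) (S \ {i}) :=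
      conn_mono le_rfl (Set.subset_sdiff_singleton hS₀ hiS₀)
    have hle' : conn ends r S₀ ≤ conn ends (glue r x y) S₀ :=
      conn_mono (glue_le_iff.mp le_rfl).1 subset_rfl
    have hg : conn ends (glue r x y) S₀ x y := le_conn _ _ _ (glue_le_iff.mp le_rfl).2
    have sy : ∀ {a b}, conn ends (glue r x y) S₀ a b → conn ends (glue r x y) S₀ b a :=
      Setoid.symm' _
    have tr : ∀ {a b c}, conn ends (glue r x y) S₀ a b → conn ends (glue r x y) S₀ b c →
      conn ends (glue r x y) S₀ a c := Setoid.trans' _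
    rintro (h1 | ⟨h1, h2⟩ | ⟨h1, h2⟩)
    · exact ih h1
    · exact h' (hle (tr (sy (hle' h1)) (tr hg (sy (hle' h2)))))
    · exact h' (hle (tr (hle' h2) (tr (sy hg) (hle' h1))))

/-- The family of edges with one more edge. -/
def consEnds (p : V × V) (ends : ι → V × V) : Option ι → V × V := fun o => o.elim p ends

theorem conn_consEnds_image (p : V × V) (ends : ι → V × V) (r : Setoid V) (S : Set ι) :
    conn (consEnds p ends) r (some '' S) = conn ends r S := by
  refine eq_of_forall_ge_iff fun q => ?_
  rw [conn_le_iff, conn_le_iff, Set.forall_mem_image]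
  rfl

/-- The deletion half of deletion–contraction: the trees which avoid the new edge. -/
theorem isTree_consEnds_image (p : V × V) (ends : ι → V × V) (s : Set V) (r : Setoid V)
    (S : Set ι) : IsTree (consEnds p ends) s r (some '' S) ↔ IsTree ends s r S := by
  rw [IsTree, IsTree, conn_consEnds_image, Set.forall_mem_image]
  have h (i : ι) : some '' S \ {some i} = some '' (S \ {i}) := by
    rw [Set.image_sdiff (Option.some_injective _), Set.image_singleton]
  refine and_congr_right fun _ => forall₂_congr fun i _ => ?_
  rw [h, conn_consEnds_image]
  rfl

/-- The contraction half: contracting the new edge means enlarging `r`, so that the vertex type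
never changes. Acyclicity at the new edge itself is not visible in the glued graph; it is recovered
from `not_conn_of_acyclic_glue`. -/
theorem isTree_consEnds_insert [Finite ι] (p : V × V) (ends : ι → V × V) (s : Set V)
    (r : Setoid V) (S : Set ι) : IsTree (consEnds p ends) s r (insert none (some '' S)) ↔
      ¬ r p.1 p.2 ∧ IsTree ends s (glue r p.1 p.2) S := by
  have hn : none ∉ some '' S := by simp
  have h0 : insert none (some '' S) \ {none} = some '' S := by
    rw [Set.insert_sdiff_self_of_notMem hn]
  have h (i : ι) : insert none (some '' S) \ {some i} = insert none (some '' (S \ {i})) := by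
    rw [Set.insert_sdiff_of_notMem _ (by simp), Set.image_sdiff (Option.some_injective _),
      Set.image_singleton]
  have hp : consEnds p ends none = p := rfl
  have hc (S : Set ι) : conn (consEnds p ends) r (insert none (some '' S)) =
      conn ends (glue r p.1 p.2) S := by
    rw [conn_insert, conn_consEnds_image, conn_glue]
    rfl
  rw [IsTree, IsTree, Set.forall_mem_insert, Set.forall_mem_image, h0, hc, conn_consEnds_image, hp]
  have h3 : (∀ ⦃i : ι⦄, i ∈ S → ¬ conn (consEnds p ends) r (insert none (some '' S) \ {some i})
      (consEnds p ends (some i)).1 (consEnds p ends (some i)).2) ↔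
      ∀ i ∈ S, ¬ conn ends (glue r p.1 p.2) (S \ {i}) (ends i).1 (ends i).2 := by
    refine forall₂_congr fun i _ => ?_
    rw [h, hc]
    rfl
  rw [h3]
  constructor
  · rintro ⟨h1, h2, h3⟩
    exact ⟨fun h => h2 (le_conn _ _ _ h), h1, h3⟩
  · rintro ⟨h1, h2, h3⟩
    exact ⟨h2, not_conn_of_acyclic_glue (Set.toFinite S) h1 h3, h3⟩

/-- The map `f` may identify vertices or miss some, and edges may be reversed; only the edges have
to correspond bijectively. One statement thus serves isomorphisms, changes of orientation and the
contraction of an edge by substituting one vertex for another. -/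
theorem conn_relabel {ends : ι → V × V} {ends' : κ → W × W} (e : ι ≃ κ) (f : V → W)
    (h : ∀ i, ends' (e i) = ((ends i).map f f) ∨ ends' (e i) = ((ends i).map f f).swap)
    (r' : Setoid W) (S : Set ι) (a b : V) :
    conn ends' r' (e '' S) (f a) (f b) ↔ conn ends (r'.comap f) S a b := by
  set q := conn ends (r'.comap f) S
  have hrq (a b) (hab : r' (f a) (f b)) : q a b := le_conn ends (r'.comap f) S hab
  have r1 : ∀ {a b}, r' a b → r' b a := r'.symm'
  have r2 : ∀ {a b c}, r' a b → r' b c → r' a c := r'.trans'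
  have q1 : ∀ {a b}, q a b → q b a := q.symm'
  have q2 : ∀ {a b c}, q a b → q b c → q a c := q.trans'
  -- An explicit description of the relation generated in `W`: a use of edges can be collected into
  -- one passage through the image of `f`, because every edge has its ends there.
  let Q : Setoid W :=
    { r := fun w w' => r' w w' ∨ ∃ a b, r' w (f a) ∧ q a b ∧ r' (f b) w'
      iseqv := by
        refine ⟨fun w => .inl (r'.refl' w), ?_, ?_⟩
        · rintro w w' (h | ⟨a, b, h1, h2, h3⟩)
          · exact .inl (r1 h)
          · exact .inr ⟨b, a, r1 h3, q1 h2, r1 h1⟩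
        · rintro w w' w'' (h | ⟨a, b, h1, h2, h3⟩) (k | ⟨c, d, k1, k2, k3⟩)
          · exact .inl (r2 h k)
          · exact .inr ⟨c, d, r2 h k1, k2, k3⟩
          · exact .inr ⟨a, b, h1, h2, r2 h3 k⟩
          · exact .inr ⟨a, d, h1, q2 h2 (q2 (hrq _ _ (r2 h3 k1)) k2), k3⟩ }
  constructor
  · intro hab
    have hle : conn ends' r' (e '' S) ≤ Q := by
      refine conn_le_iff.mpr ⟨fun _ _ => Or.inl, ?_⟩
      rw [Set.forall_mem_image]
      intro i hi
      have := conn_ends ends (r'.comap f) hi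
      obtain h | h := h i <;> rw [h]
      · exact .inr ⟨_, _, r'.refl' _, this, r'.refl' _⟩
      · exact .inr ⟨_, _, r'.refl' _, q1 this, r'.refl' _⟩
    obtain h | ⟨c, d, h1, h2, h3⟩ := hle hab
    · exact hrq _ _ h
    · exact q2 (hrq _ _ h1) (q2 h2 (hrq _ _ h3))
  · have hle : q ≤ (conn ends' r' (e '' S)).comap f := by
      refine conn_le_iff.mpr ⟨fun _ _ h => le_conn _ _ _ h, fun i hi => ?_⟩
      have := conn_ends ends' r' (Set.mem_image_of_mem e hi)
      obtain h | h := h i <;> rw [h] at this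
      · exact this
      · exact Setoid.symm' _ this
    exact fun h => hle h

theorem isTree_relabel {ends : ι → V × V} {ends' : κ → W × W} (e : ι ≃ κ) (f : V → W)
    (h : ∀ i, ends' (e i) = ((ends i).map f f) ∨ ends' (e i) = ((ends i).map f f).swap)
    (s : Set V) (r' : Setoid W) (S : Set ι) :
    IsTree ends' (f '' s) r' (e '' S) ↔ IsTree ends s (r'.comap f) S := by
  rw [IsTree, IsTree]
  simp only [Set.forall_mem_image, conn_relabel e f h]
  refine and_congr_right fun _ => forall₂_congr fun i _ => not_congr ?_
  have h1 : e '' S \ {e i} = e '' (S \ {i}) := by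
    rw [Set.image_sdiff e.injective, Set.image_singleton]
  rw [h1, ← conn_relabel e f h]
  obtain h | h := h i <;> rw [h]
  · rfl
  · exact Setoid.comm' _

/-! ## The polynomial of a graph -/

open MvPolynomial

open Classical in
/-- The sum over the spanning trees of the product of the variables outside of the tree. -/
def treePoly (K : Type u) [Field K] [Fintype ι] (ends : ι → V × V) (s : Set V) (r : Setoid V) :
    MvPolynomial ι K :=
  ∑ S : ι → Bool, if IsTree ends s r {i | S i = true} then ∏ i, bif S i then 1 else X i else 0

variable (K : Type u) [Field K]

theorem treePoly_relabel [Fintype ι] [Fintype κ] {ends : ι → V × V} {ends' : κ → W × W}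
    (e : ι ≃ κ) (f : V → W)
    (h : ∀ i, ends' (e i) = ((ends i).map f f) ∨ ends' (e i) = ((ends i).map f f).swap)
    (s : Set V) (r' : Setoid W) :
    treePoly K ends' (f '' s) r' = rename e (treePoly K ends s (r'.comap f)) := by
  classical
  rw [treePoly, treePoly, map_sum]
  refine (Fintype.sum_equiv (Equiv.arrowCongr e (Equiv.refl Bool)) _ _ fun S => ?_).symm
  have hS : {j | (Equiv.arrowCongr e (Equiv.refl Bool)) S j = true} = e '' {i | S i = true} := by
    ext j
    simp [Equiv.arrowCongr]
  simp only [hS, isTree_relabel e f h]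
  split_ifs
  · rw [map_prod]
    refine Fintype.prod_equiv e _ _ fun i => ?_
    simp only [Equiv.arrowCongr_apply, Equiv.coe_refl, Function.comp_apply, id_eq,
      Equiv.symm_apply_apply]
    cases S i <;> simp
  · exact map_zero _

theorem sum_option_arrow_bool {M : Type*} [AddCommMonoid M]
    {_ : Fintype (ι → Bool)} {_ : Fintype (Option ι → Bool)} (F : (Option ι → Bool) → M) :
    ∑ S, F S = ∑ S : ι → Bool, F (fun o => o.elim false S) + ∑ S, F (fun o => o.elim true S) := by
  let e : Bool × (ι → Bool) ≃ (Option ι → Bool) :=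
    { toFun := fun q o => o.elim q.1 q.2
      invFun := fun S => (S none, fun i => S (some i))
      left_inv := fun q => rfl
      right_inv := fun S => by ext (_ | _) <;> rfl }
  rw [← e.sum_comp F, Fintype.sum_prod_type, Fintype.sum_bool, add_comm]
  rfl

/-- A spanning tree avoiding the new edge contributes its variable; one containing it contributes
the factor 1 and is a spanning tree of the contraction. Loops are included because
`edgeClass_subdivide` allows the two ends to coincide. -/
theorem treePoly_consEnds_eq_ite [Fintype ι] (p : V × V) (ends : ι → V × V) (s : Set V)
    (r : Setoid V) [Decidable (r p.1 p.2)] :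
    treePoly K (consEnds p ends) s r =
      X none * rename some (treePoly K ends s r) +
        if r p.1 p.2 then 0 else rename some (treePoly K ends s (glue r p.1 p.2)) := by
  classical
  have ht (S : ι → Bool) : {o : Option ι | o.elim true S = true} =
      insert none (some '' {i | S i = true}) := by
    ext (_ | i) <;> simp
  have hf (S : ι → Bool) : {o : Option ι | o.elim false S = true} = some '' {i | S i = true} := by
    ext (_ | i) <;> simp
  have hr (S : ι → Bool) : rename some (∏ i, bif S i then 1 else (X i : MvPolynomial ι K)) =
      ∏ i, bif S i then 1 else (X (some i) : MvPolynomial (Option ι) K) := by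
    rw [map_prod]
    refine Finset.prod_congr rfl fun i _ => ?_
    cases S i <;> simp
  rw [treePoly, sum_option_arrow_bool]
  congr 1
  · rw [treePoly, map_sum, Finset.mul_sum]
    refine Finset.sum_congr rfl fun S _ => ?_
    rw [hf, Fintype.prod_option]
    by_cases h : IsTree ends s r {i | S i = true}
    · rw [if_pos h, if_pos ((isTree_consEnds_image ..).mpr h), hr]
      rfl
    · rw [if_neg h, if_neg (mt (isTree_consEnds_image ..).mp h), map_zero, mul_zero]
  · split_ifs with hp
    · refine Finset.sum_eq_zero fun S _ => ?_
      rw [ht, if_neg]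
      exact fun h => ((isTree_consEnds_insert ..).mp h).1 hp
    · rw [treePoly, map_sum]
      refine Finset.sum_congr rfl fun S _ => ?_
      rw [ht, Fintype.prod_option]
      by_cases h : IsTree ends s (glue r p.1 p.2) {i | S i = true}
      · rw [if_pos h, if_pos ((isTree_consEnds_insert ..).mpr ⟨hp, h⟩), hr]
        exact one_mul _
      · rw [if_neg h, if_neg fun h' => h ((isTree_consEnds_insert ..).mp h').2, map_zero]

theorem treePoly_consEnds [Fintype ι] (p : V × V) (ends : ι → V × V) (s : Set V)
    (r : Setoid V) (hp : ¬ r p.1 p.2) :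
    treePoly K (consEnds p ends) s r =
      X none * rename some (treePoly K ends s r) +
        rename some (treePoly K ends s (glue r p.1 p.2)) := by
  classical
  rw [treePoly_consEnds_eq_ite, if_neg hp]

theorem treePoly_consEnds_loop [Fintype ι] (p : V × V) (ends : ι → V × V) (s : Set V)
    (r : Setoid V) (hp : r p.1 p.2) :
    treePoly K (consEnds p ends) s r = X none * rename some (treePoly K ends s r) := by
  classical
  rw [treePoly_consEnds_eq_ite, if_pos hp, add_zero]

end

/-! ## Classes of multisets of edges -/

/-- Parallel edges are repeated list entries, so a permutation has to be turned into a bijection of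
positions, which then acts on the variables. -/
theorem List.Perm.exists_equiv_get {α : Type*} {l l' : List α} (h : l.Perm l') :
    ∃ e : Fin l.length ≃ Fin l'.length, ∀ i, l'.get (e i) = l.get i := by
  induction h with
  | nil => exact ⟨Equiv.refl _, fun _ => rfl⟩
  | @cons x l l' _ ih =>
    obtain ⟨e, he⟩ := ih
    refine ⟨(finSuccEquiv _).trans ((Equiv.optionCongr e).trans (finSuccEquiv _).symm),
      fun i => ?_⟩
    refine Fin.cases ?_ (fun i => ?_) i
    · simp
    · simpa using he i
  | swap x y l =>
    refine ⟨Equiv.swap (0 : Fin (l.length + 2)) 1, fun i => ?_⟩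
    refine Fin.cases ?_ (fun i => Fin.cases ?_ (fun i => ?_) i) i
    · rw [Equiv.swap_apply_left]; rfl
    · rw [show Fin.succ (0 : Fin (l.length + 1)) = 1 from rfl, Equiv.swap_apply_right]; rfl
    · rw [Equiv.swap_apply_of_ne_of_ne]
      · rfl
      · exact Fin.succ_ne_zero _
      · exact fun h => Fin.succ_ne_zero i (Fin.succ_injective _ h)
  | trans _ _ ih₁ ih₂ =>
    obtain ⟨e, he⟩ := ih₁
    obtain ⟨e', he'⟩ := ih₂
    exact ⟨e.trans e', fun i => (he' _).trans (he i)⟩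

section

variable {V W : Type} (K : Type u) [Field K]

open MvPolynomial

theorem treePoly_get_cons (p : V × V) (l : List (V × V)) (s : Set V) (r : Setoid V) :
    treePoly K (p :: l).get s r =
      rename (finSuccEquiv l.length).symm (treePoly K (consEnds p l.get) s r) := by
  have := treePoly_relabel K (ends := consEnds p l.get) (ends' := (p :: l).get)
    (finSuccEquiv l.length).symm id (fun i => .inl ?_) s r
  · rwa [Set.image_id, Setoid.comap_id] at this
  · cases i <;> rfl

/-- The class of the complement of the graph hypersurface of a quotient of a graph. -/
def listClass (s : Set V) (r : Setoid V) (l : List (V × V)) : K0 K :=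
  complClass (treePoly K l.get s r)

variable {K}

theorem listClass_perm {s : Set V} {r : Setoid V} {l l' : List (V × V)} (h : l.Perm l') :
    listClass K s r l = listClass K s r l' := by
  obtain ⟨e, he⟩ := h.exists_equiv_get
  have := treePoly_relabel K (ends := l.get) (ends' := l'.get) e id
    (fun i => .inl (he i)) s r
  rw [Set.image_id, Setoid.comap_id] at this
  rw [listClass, listClass, this, complClass_rename_equiv]

theorem listClass_map (f : V → W) (s : Set V) (r : Setoid W) (l : List (V × V)) :
    listClass K (f '' s) r (l.map (Prod.map f f)) = listClass K s (r.comap f) l := by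
  have := treePoly_relabel K (ends := l.get) (ends' := (l.map (Prod.map f f)).get)
    (finCongr (List.length_map _).symm) f (fun i => .inl (by simp)) s r
  rw [listClass, listClass, this, complClass_rename_equiv]

theorem listClass_cons_loop {s : Set V} {r : Setoid V} {p : V × V} (hp : r p.1 p.2)
    (l : List (V × V)) : listClass K s r (p :: l) = torus K * listClass K s r l := by
  rw [listClass, treePoly_get_cons, complClass_rename_equiv, treePoly_consEnds_loop K _ _ _ _ hp,
    complClass_X_none_mul, listClass]

/-- The class of the common complement of the hypersurfaces of the deletion and contraction. -/
def pairClass (K : Type u) [Field K] (s : Set V) (r : Setoid V) (x y : V) (l : List (V × V)) :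
    K0 K :=
  complClass (treePoly K l.get s r * treePoly K l.get s (glue r x y))

/-- This is `complClass_linear` with `g = 1`, `A` the polynomial of the deletion and `B` that of the
contraction. -/
theorem listClass_cons {s : Set V} {r : Setoid V} {x y : V} (h : ¬ r x y) (l : List (V × V)) :
    listClass K s r ((x, y) :: l) = torus K * listClass K s r l +
      lefschetz K * (listClass K s (glue r x y) l - pairClass K s r x y l) := by
  rw [listClass, treePoly_get_cons, complClass_rename_equiv, treePoly_consEnds K _ _ _ _ h]
  have := complClass_linear 1 (treePoly K l.get s r) (treePoly K l.get s (glue r x y))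
  rwa [map_one, one_mul, one_mul, one_mul] at this

/-- With a further edge from `x` to `y`, the pair (A, B) of deletion and contraction polynomials
becomes (tA + B, tB), since that edge is a loop after contraction. -/
theorem pairClass_cons {s : Set V} {r : Setoid V} {x y : V} (h : ¬ r x y) (l : List (V × V)) :
    pairClass K s r x y ((x, y) :: l) =
      torus K * listClass K s (glue r x y) l - pairClass K s r x y l := by
  have hg : glue r x y x y := (glue_le_iff.mp le_rfl).2
  rw [pairClass, treePoly_get_cons, treePoly_get_cons, ← map_mul, complClass_rename_equiv,
    treePoly_consEnds K _ _ _ _ h, treePoly_consEnds_loop K _ _ _ _ hg, mul_comm, mul_assoc,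
    complClass_X_none_mul_linear]
  rfl

end

/-! ### Solving the recurrence for parallel edges -/

section

open Polynomial

/-- Identities between the quotients `fPoly` and `hPoly` are checked after clearing the denominator.
-/
theorem X_add_one_mul_cancel {p q : ℤ[X]} (h : (X + 1) * p = (X + 1) * q) : p = q := by
  have : (X + 1 : ℤ[X]) ≠ 0 := (monic_X_add_C (1 : ℤ)).ne_zero
  exact mul_left_cancel₀ this h

theorem fPoly_zero : fPoly 0 = 0 :=
  X_add_one_mul_cancel (by rw [fPoly_spec]; simp)

theorem fPoly_succ (m : ℕ) : fPoly (m + 1) = X * fPoly m + (-1) ^ m :=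
  X_add_one_mul_cancel (by
    rw [fPoly_spec, mul_add, mul_left_comm, fPoly_spec]
    ring)

theorem hPoly_zero : hPoly 0 = 1 :=
  X_add_one_mul_cancel (by rw [hPoly_spec]; ring)

theorem hPoly_succ (m : ℕ) : hPoly (m + 1) = X * hPoly m - (-1) ^ m * X :=
  X_add_one_mul_cancel (by
    rw [hPoly_spec, mul_sub, mul_left_comm, hPoly_spec]
    ring)

theorem gPoly_zero : gPoly 0 = 0 := by
  rw [gPoly, fPoly_zero]
  simp

theorem gPoly_succ (m : ℕ) : gPoly (m + 1) = X * gPoly m + X ^ m - (-1) ^ m := by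
  rw [gPoly, gPoly, fPoly_succ]
  -- The exponent `m - 1` in `gPoly m` is truncated at `m = 0`, which is treated apart.
  cases m with
  | zero => simp [fPoly_zero]
  | succ m =>
    push_cast
    ring

theorem bananaPoly_eq (m : ℕ) : bananaPoly m = (X + 1) * fPoly m + gPoly m := by
  rw [bananaPoly, gPoly]
  ring

/-- The solution of the recurrences governing the multiplication of an edge. -/
theorem multiplication_recurrence {R : Type*} [CommRing R] (t : R) (u c w : ℕ → R)
    (hu : ∀ m, u (m + 1) = t * u m + (t + 1) * (c m - w m))
    (hc : ∀ m, c (m + 1) = t * c m) (hw : ∀ m, w (m + 1) = t * c m - w m) (m : ℕ) :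
    u m = aeval t (fPoly m) * u 1 + aeval t (gPoly m) * c 0 + aeval t (hPoly m) * u 0 := by
  have hc' (m : ℕ) : c m = t ^ m * c 0 := by
    induction m with
    | zero => simp
    | succ m ih => rw [hc, ih]; ring
  have hf (m : ℕ) : (t + 1) * aeval t (fPoly m) = t ^ m - (-1) ^ m := by
    simpa using congrArg (aeval t) (fPoly_spec m)
  -- The sequence `c` is geometric, and `w` is known up to the constant `w 0`.
  have hw' (m : ℕ) : w m = t * aeval t (fPoly m) * c 0 + (-1) ^ m * w 0 := by
    induction m with
    | zero => simp [fPoly_zero]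
    | succ m ih =>
      rw [hw, hc', ih, fPoly_succ]
      simp only [map_add, map_mul, aeval_X, map_pow, map_neg, map_one]
      linear_combination (-t * c 0) * hf m
  induction m with
  | zero => simp [fPoly_zero, gPoly_zero, hPoly_zero]
  | succ m ih =>
    -- Expanding `u 1` by `hu 0` brings in the same multiple of `w 0` on both sides, so that it
    -- cancels.
    rw [hu m, hc', hw', ih, fPoly_succ, gPoly_succ, hPoly_succ, hu 0]
    simp only [map_add, map_sub, map_mul, aeval_X, map_pow, map_neg, map_one]
    linear_combination (-t * c 0) * hf m

end

section

variable {V W : Type} {K : Type u} [Field K]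

open Polynomial in
/-- The class of a graph with an edge replaced by `m` parallel edges. -/
theorem listClass_replicate_append {s : Set V} {r : Setoid V} {x y : V} (h : ¬ r x y)
    (l : List (V × V)) (m : ℕ) :
    listClass K s r (List.replicate m (x, y) ++ l) =
      aeval (torus K) (fPoly m) * listClass K s r ((x, y) :: l) +
      aeval (torus K) (gPoly m) * listClass K s (glue r x y) l +
      aeval (torus K) (hPoly m) * listClass K s r l := by
  have hL : lefschetz K = torus K + 1 := by rw [torus, sub_add_cancel]
  refine multiplication_recurrence (torus K)
    (fun m => listClass K s r (List.replicate m (x, y) ++ l))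
    (fun m => listClass K s (glue r x y) (List.replicate m (x, y) ++ l))
    (fun m => pairClass K s r x y (List.replicate m (x, y) ++ l)) (fun m => ?_) (fun m => ?_)
    (fun m => ?_) m
  · rw [← hL]
    exact listClass_cons h _
  · exact listClass_cons_loop (p := (x, y)) (glue_le_iff.mp le_rfl).2 _
  · exact pairClass_cons h _

end

/-! ### Graphs as multisets of edges between natural numbers -/

section

variable (K : Type u) [Field K]

/-- The class of the complement of the graph hypersurface of the graph with vertices `s` and
edges `M`. -/
def edgeClass (s : Set ℕ) (M : Multiset (ℕ × ℕ)) : K0 K := listClass K s ⊥ M.toList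

variable {K}

theorem edgeClass_coe (s : Set ℕ) (l : List (ℕ × ℕ)) : edgeClass K s l = listClass K s ⊥ l :=
  listClass_perm (Multiset.coe_eq_coe.mp (Multiset.coe_toList _))

theorem listClass_forall₂ {V : Type} {s : Set V} {r : Setoid V} {l l' : List (V × V)}
    (h : List.Forall₂ (fun p q => q = p ∨ q = p.swap) l l') :
    listClass K s r l = listClass K s r l' := by
  have := treePoly_relabel K (ends := l.get) (ends' := l'.get) (finCongr h.length_eq) id
    (fun i => by simpa using h.get i.2 (h.length_eq ▸ i.2)) s r
  rw [Set.image_id, Setoid.comap_id] at this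
  rw [listClass, listClass, this, complClass_rename_equiv]

theorem edgeClass_swap (s : Set ℕ) (x y : ℕ) (m : ℕ) (M : Multiset (ℕ × ℕ)) :
    edgeClass K s (Multiset.replicate m (x, y) + M) =
      edgeClass K s (Multiset.replicate m (y, x) + M) := by
  induction M using Quotient.inductionOn with | h l => ?_
  rw [Multiset.quot_mk_to_coe, ← Multiset.coe_replicate, ← Multiset.coe_replicate,
    Multiset.coe_add, Multiset.coe_add, edgeClass_coe, edgeClass_coe]
  refine listClass_forall₂ (List.rel_append ?_ ?_)
  · induction m with
    | zero => exact .nil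
    | succ m ih => exact .cons (.inr rfl) ih
  · exact List.forall₂_same.mpr fun _ _ => .inl rfl

/-- Since `f` is injective only on `s`, both sides are compared with the same graph on the subtype
`s`, along its inclusion and along the restriction of `f`. -/
theorem edgeClass_image {s : Set ℕ} {M : Multiset (ℕ × ℕ)} (hM : ∀ p ∈ M, p.1 ∈ s ∧ p.2 ∈ s)
    {f : ℕ → ℕ} (hf : Set.InjOn f s) :
    edgeClass K (f '' s) (M.map (Prod.map f f)) = edgeClass K s M := by
  induction M using Quotient.inductionOn with | h l => ?_
  rw [Multiset.quot_mk_to_coe, Multiset.map_coe, edgeClass_coe, edgeClass_coe]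
  replace hM : ∀ p ∈ l, p.1 ∈ s ∧ p.2 ∈ s := hM
  obtain ⟨l', rfl⟩ : ∃ l' : List (s × s), l'.map (Prod.map Subtype.val Subtype.val) = l := by
    refine ⟨l.attach.map fun p => (⟨p.1.1, (hM _ p.2).1⟩, ⟨p.1.2, (hM _ p.2).2⟩), ?_⟩
    rw [List.map_map]
    exact List.attach_map_subtype_val l
  have h (g : s → ℕ) (hg : g.Injective) :
      listClass K (Set.range g) ⊥ (l'.map (Prod.map g g)) = listClass K Set.univ ⊥ l' := by
    have := listClass_map (K := K) g Set.univ ⊥ l'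
    have hb : (⊥ : Setoid ℕ).comap g = ⊥ := by
      ext a b
      exact hg.eq_iff
    rwa [Set.image_univ, hb] at this
  have h1 := h Subtype.val Subtype.val_injective
  have h2 := h (f ∘ Subtype.val) (Set.injOn_iff_injective.mp hf)
  rw [Subtype.range_coe] at h1
  rw [Set.range_comp, Subtype.range_coe] at h2
  rw [h1, ← h2, List.map_map]
  rfl

/-- The substitution of the vertex `x` for the vertex `y`. -/
def subst (y x : ℕ) (v : ℕ) : ℕ := if v = y then x else v

theorem subst_of_ne {x y v : ℕ} (h : v ≠ y) : subst y x v = v := if_neg h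

theorem subst_self (x y : ℕ) : subst y x y = x := if_pos rfl

/-- Passes from contraction as a quotient relation to contraction as an honest graph, in which `x`
takes the place of `y`. -/
theorem glue_bot (x y : ℕ) : (⊥ : Setoid ℕ).comap (subst y x) = glue ⊥ x y := by
  ext a b
  change subst y x a = subst y x b ↔ a = b ∨ (a = x ∧ y = b) ∨ (a = y ∧ x = b)
  unfold subst
  grind

theorem listClass_glue (s : Set ℕ) (x y : ℕ) (l : List (ℕ × ℕ)) :
    listClass K s (glue ⊥ x y) l =
      edgeClass K (subst y x '' s) (l.map (Prod.map (subst y x) (subst y x))) := by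
  rw [edgeClass_coe, listClass_map, glue_bot]

open Polynomial in
theorem edgeClass_replicate {s : Set ℕ} {x y : ℕ} (h : x ≠ y) (m : ℕ) (M : Multiset (ℕ × ℕ)) :
    edgeClass K s (Multiset.replicate m (x, y) + M) =
      aeval (torus K) (fPoly m) * edgeClass K s ((x, y) ::ₘ M) +
      aeval (torus K) (gPoly m) *
        edgeClass K (subst y x '' s) (M.map (Prod.map (subst y x) (subst y x))) +
      aeval (torus K) (hPoly m) * edgeClass K s M := by
  induction M using Quotient.inductionOn with | h l => ?_
  rw [Multiset.quot_mk_to_coe, ← Multiset.coe_replicate, Multiset.coe_add, Multiset.cons_coe,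
    Multiset.map_coe, ← listClass_glue, edgeClass_coe, edgeClass_coe, edgeClass_coe]
  exact listClass_replicate_append h l m

/-- The edges in `M` do not meet the vertex `z`. -/
def Avoids (M : Multiset (ℕ × ℕ)) (z : ℕ) : Prop := ∀ p ∈ M, p.1 ≠ z ∧ p.2 ≠ z

/-- The relation “both or neither equal `z`” contains every edge and separates `x` from `z`, so
there is no spanning tree. -/
theorem treePoly_isolated {l : List (ℕ × ℕ)} {s : Set ℕ} {x z : ℕ} (hl : Avoids l z)
    (hx : x ∈ s) (hz : z ∈ s) (hxz : x ≠ z) : treePoly K l.get s ⊥ = 0 := by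
  refine Finset.sum_eq_zero fun S _ => if_neg fun h => ?_
  let q : Setoid ℕ := (⊥ : Setoid Prop).comap (· = z)
  have hle : conn l.get ⊥ {i | S i = true} ≤ q := by
    refine conn_le_iff.mpr ⟨bot_le, fun i _ => ?_⟩
    have := hl (l.get i) (List.get_mem l i)
    change ((l.get i).1 = z) = ((l.get i).2 = z)
    exact propext (iff_of_false this.1 this.2)
  have : (x = z) = (z = z) := hle (h.1 x hx z hz)
  simp [hxz] at this

/-- A vertex met by no edge adds nothing once it is identified with a vertex of `s`. -/
theorem treePoly_subst {l : List (ℕ × ℕ)} {s : Set ℕ} {x z : ℕ} (hl : Avoids l z)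
    (hx : x ∈ s) (hz : z ∉ s) (r : Setoid ℕ) :
    treePoly K l.get (insert z s) (r.comap (subst z x)) = treePoly K l.get s r := by
  have := treePoly_relabel K (ends := l.get) (ends' := l.get) (Equiv.refl _) (subst z x)
    (fun i => .inl (by
      have := hl (l.get i) (List.get_mem l i)
      ext
      · exact (subst_of_ne this.1).symm
      · exact (subst_of_ne this.2).symm)) (insert z s) r
  have hs : subst z x '' insert z s = s := by
    rw [Set.image_insert_eq, subst_self]
    have : subst z x '' s = s := by
      refine (Set.image_congr fun v hv => subst_of_ne ?_).trans (Set.image_id _)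
      rintro rfl
      exact hz hv
    rw [this, Set.insert_eq_of_mem hx]
  rw [hs] at this
  rw [this]
  exact (MvPolynomial.rename_id_apply _).symm

open Polynomial in
/-- A banana attached to a graph at one vertex. -/
theorem edgeClass_pendant {s : Set ℕ} {x y : ℕ} (hx : x ∈ s) (hy : y ∉ s) (m : ℕ)
    {M : Multiset (ℕ × ℕ)} (hM : Avoids M y) :
    edgeClass K (insert y s) (Multiset.replicate m (x, y) + M) =
      aeval (torus K) (bananaPoly m) * edgeClass K s M := by
  have hxy : x ≠ y := by rintro rfl; exact hy hx
  induction M using Quotient.inductionOn with | h l => ?_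
  rw [Multiset.quot_mk_to_coe, ← Multiset.coe_replicate, Multiset.coe_add, edgeClass_coe,
    edgeClass_coe, listClass_replicate_append (by exact hxy), listClass_cons (by exact hxy)]
  -- Without the banana the vertex `y` is isolated. Hence u_0 and w_0 vanish, u_1 = 𝕃c_0, and the
  -- total factor is 𝕃f_m + g_m, which is `bananaPoly m`.
  have h0 : treePoly K l.get (insert y s) ⊥ = 0 :=
    treePoly_isolated hM (Set.mem_insert_of_mem _ hx) (Set.mem_insert _ _) hxy
  have h1 : listClass K (insert y s) ⊥ l = 0 := by rw [listClass, h0, complClass_zero]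
  have h2 : pairClass K (insert y s) ⊥ x y l = 0 := by
    rw [pairClass, h0, zero_mul, complClass_zero]
  have h3 : listClass K (insert y s) (glue ⊥ x y) l = listClass K s ⊥ l := by
    rw [listClass, ← glue_bot, treePoly_subst hM hx hy, listClass]
  rw [h1, h2, h3, bananaPoly_eq]
  simp only [map_add, map_mul, aeval_X, map_one, torus]
  ring

/-- Subdividing an edge multiplies the class by `𝕃`. -/
theorem edgeClass_subdivide {s : Set ℕ} {x y z : ℕ} (hx : x ∈ s) (hy : y ∈ s) (hz : z ∉ s)
    {M : Multiset (ℕ × ℕ)} (hM : Avoids M z) :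
    edgeClass K (insert z s) ((x, z) ::ₘ (z, y) ::ₘ M) =
      lefschetz K * edgeClass K s ((x, y) ::ₘ M) := by
  classical
  have hxz : x ≠ z := by rintro rfl; exact hz hx
  have hyz : y ≠ z := by rintro rfl; exact hz hy
  induction M using Quotient.inductionOn with | h l => ?_
  rw [Multiset.quot_mk_to_coe, Multiset.cons_coe, Multiset.cons_coe, Multiset.cons_coe,
    edgeClass_coe, edgeClass_coe]
  -- Expanding along both halves gives t₁A + t₂A + B, where A and B belong to the deletion and
  -- contraction of the undivided edge: deleting both halves isolates `z`, deleting one gives A,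
  -- contracting both gives B. If `x = y`, the term B is zero.
  have h0 : treePoly K l.get (insert z s) ⊥ = 0 :=
    treePoly_isolated hM (Set.mem_insert_of_mem _ hx) (Set.mem_insert _ _) hxz
  have e1 : treePoly K ((x, z) :: (z, y) :: l).get (insert z s) ⊥ =
      MvPolynomial.rename ((Equiv.optionCongr (finSuccEquiv l.length).symm).trans
        (finSuccEquiv (l.length + 1)).symm)
        (treePoly K (consEnds (x, z) (consEnds (z, y) l.get)) (insert z s) ⊥) := by
    have := treePoly_relabel K (ends := consEnds (x, z) (consEnds (z, y) l.get))
      (ends' := ((x, z) :: (z, y) :: l).get)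
      ((Equiv.optionCongr (finSuccEquiv l.length).symm).trans
        (finSuccEquiv (l.length + 1)).symm) id (fun i => .inl (by rcases i with _ | _ | i <;> rfl))
      (insert z s) ⊥
    rwa [Set.image_id, Setoid.comap_id] at this
  have h1 : treePoly K l.get (insert z s) (glue ⊥ z y) = treePoly K l.get s ⊥ := by
    have h : glue ⊥ z y = glue ⊥ y z := by
      ext a b
      simp only [glue_iff]
      tauto
    rw [h, ← glue_bot, treePoly_subst hM hy hz]
  have h2 : treePoly K l.get (insert z s) (glue ⊥ x z) = treePoly K l.get s ⊥ := by
    rw [← glue_bot, treePoly_subst hM hx hz]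
  have h3 : treePoly K l.get (insert z s) (glue (glue ⊥ x z) z y) =
      treePoly K l.get s (glue ⊥ x y) := by
    rw [← treePoly_subst hM hx hz]
    congr 1
    ext a b
    change _ ↔ subst z x a = subst z x b ∨ (subst z x a = x ∧ y = subst z x b) ∨
      (subst z x a = y ∧ x = subst z x b)
    simp only [glue_iff]
    change ((a = b ∨ (a = x ∧ z = b) ∨ (a = z ∧ x = b)) ∨
      ((a = z ∨ (a = x ∧ z = z) ∨ (a = z ∧ x = z)) ∧ (y = b ∨ (y = x ∧ z = b) ∨ (y = z ∧ x = b))) ∨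
      ((a = y ∨ (a = x ∧ z = y) ∨ (a = z ∧ x = y)) ∧
        (z = b ∨ (z = x ∧ z = b) ∨ (z = z ∧ x = b)))) ↔ _
    unfold subst
    grind
  have e2 : (glue (⊥ : Setoid ℕ) x z) z y ↔ x = y := by
    change (z = y ∨ (z = x ∧ z = y) ∨ (z = z ∧ x = y)) ↔ _
    grind
  rw [listClass, e1, complClass_rename_equiv, treePoly_consEnds K _ _ _ _ (by exact hxz),
    treePoly_consEnds K _ _ _ _ (by exact hyz.symm), h0, map_zero, mul_zero, zero_add, h1,
    treePoly_consEnds_eq_ite, h2, h3, listClass, treePoly_get_cons, complClass_rename_equiv,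
    treePoly_consEnds_eq_ite]
  have e3 : (⊥ : Setoid ℕ) x y ↔ x = y := Iff.rfl
  simp only [e2, e3]
  have := complClass_add_linear (treePoly K l.get s ⊥)
    (if x = y then 0 else treePoly K l.get s (glue ⊥ x y))
  rw [apply_ite (MvPolynomial.rename some), map_zero] at this
  exact this

end

/-! ## The classes of graphs -/

namespace Graph

section

variable {α β α' β' : Type} {G : Graph α β} {H : Graph α' β'}

/-- The map `ends` gives the endpoints of the edges of `G`. -/
def IsEnds (G : Graph α β) (ends : G.edgeSet → G.vertexSet × G.vertexSet) : Prop :=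
  ∀ (e : G.edgeSet) (x y : G.vertexSet), G.IsLink e x y ↔ ends e = (x, y) ∨ ends e = (y, x)

theorem exists_isEnds (G : Graph α β) : ∃ ends, G.IsEnds ends := by
  have h (e : G.edgeSet) : ∃ p : G.vertexSet × G.vertexSet, G.IsLink e p.1 p.2 := by
    obtain ⟨x, y, h⟩ := G.exists_isLink_of_mem_edgeSet e.2
    exact ⟨(⟨x, h.left_mem⟩, ⟨y, h.right_mem⟩), h⟩
  choose ends hends using h
  refine ⟨ends, fun e x y => ⟨fun h => ?_, ?_⟩⟩
  · obtain ⟨h1, h2⟩ | ⟨h1, h2⟩ := (hends e).eq_and_eq_or_eq_and_eq h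
    · exact .inl (Prod.ext (Subtype.ext h1) (Subtype.ext h2))
    · exact .inr (Prod.ext (Subtype.ext h1) (Subtype.ext h2))
  · have h' := hends e
    rintro (h | h) <;> rw [h] at h'
    · exact h'
    · exact h'.symm

/-- Links are symmetric, so joinability by paths is already an equivalence relation and agrees with
the generated one. -/
theorem IsEnds.joinedBy_iff {ends : G.edgeSet → G.vertexSet × G.vertexSet} (h : G.IsEnds ends)
    (S : Set G.edgeSet) (x y : G.vertexSet) :
    G.JoinedBy (Subtype.val '' S) x y ↔ conn ends ⊥ S x y := by
  constructor
  · suffices ∀ a b : α, G.JoinedBy (Subtype.val '' S) a b → ∀ (ha : a ∈ G.vertexSet)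
        (hb : b ∈ G.vertexSet), conn ends ⊥ S ⟨a, ha⟩ ⟨b, hb⟩ from
      fun hxy => this x y hxy x.2 y.2
    intro a b hab
    induction hab with
    | refl => exact fun _ _ => Setoid.refl' _ _
    | tail _ hbc ih =>
      intro ha hc
      obtain ⟨_, ⟨e, he, rfl⟩, hl⟩ := hbc
      refine Setoid.trans' _ (ih ha hl.left_mem) ?_
      have := conn_ends ends ⊥ he
      obtain h1 | h1 := (h e ⟨_, hl.left_mem⟩ ⟨_, hc⟩).mp hl <;> rw [h1] at this
      · exact this
      · exact Setoid.symm' _ this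
  · let q : Setoid G.vertexSet :=
      { r := fun x y => G.JoinedBy (Subtype.val '' S) x y
        iseqv := by
          refine ⟨fun x => .refl, fun hxy => ?_, fun h1 h2 => h1.trans h2⟩
          refine Relation.ReflTransGen.mono ?_ _ _ hxy.swap
          rintro v w ⟨e, he, hl⟩
          exact ⟨e, he, hl.symm⟩ }
    have hle : conn ends ⊥ S ≤ q := conn_le_iff.mpr ⟨bot_le, fun e he =>
      .single ⟨e, ⟨e, he, rfl⟩, (h e _ _).mpr (.inl rfl)⟩⟩
    exact fun hxy => hle hxy

theorem IsEnds.isSpanningTree_iff {ends : G.edgeSet → G.vertexSet × G.vertexSet}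
    (h : G.IsEnds ends) (hG : G.vertexSet.Nonempty) (S : Set G.edgeSet) :
    G.IsSpanningTree (Subtype.val '' S) ↔ IsTree ends Set.univ ⊥ S := by
  have hd (e : G.edgeSet) : (Subtype.val '' S) \ {e.1} = Subtype.val '' (S \ {e}) := by
    rw [Set.image_sdiff Subtype.val_injective, Set.image_singleton]
  constructor
  · rintro ⟨_, _, h1, h2⟩
    refine ⟨fun x _ y _ => (h.joinedBy_iff S x y).mp (h1 x x.2 y y.2), fun e he hc => ?_⟩
    refine h2 e ⟨e, he, rfl⟩ _ _ ((h e _ _).mpr (.inl rfl)) ?_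
    rw [hd]
    exact (h.joinedBy_iff _ _ _).mpr hc
  · rintro ⟨h1, h2⟩
    refine ⟨by rintro _ ⟨e, -, rfl⟩; exact e.2, hG,
      fun x hx y hy => (h.joinedBy_iff S ⟨x, hx⟩ ⟨y, hy⟩).mpr (h1 _ trivial _ trivial), ?_⟩
    rintro _ ⟨e, he, rfl⟩ x y hl hj
    rw [hd] at hj
    have := (h.joinedBy_iff _ ⟨x, hl.left_mem⟩ ⟨y, hl.right_mem⟩).mp hj
    refine h2 e he ?_
    obtain h3 | h3 := (h e ⟨x, hl.left_mem⟩ ⟨y, hl.right_mem⟩).mp hl <;> rw [h3]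
    · exact this
    · exact Setoid.symm' _ this

theorem IsEnds.kirchhoff_eq (K : Type u) [Field K] [Finite G.edgeSet] [Fintype G.edgeSet]
    {ends : G.edgeSet → G.vertexSet × G.vertexSet}
    (h : G.IsEnds ends) (hG : G.vertexSet.Nonempty) :
    G.kirchhoff K = treePoly K ends Set.univ ⊥ := by
  classical
  rw [kirchhoff, treePoly, Finset.sum_filter]
  let e : Finset G.edgeSet ≃ (G.edgeSet → Bool) :=
    { toFun := fun S i => decide (i ∈ S)
      invFun := fun S => Finset.univ.filter (S · = true)
      left_inv := fun S => by ext; simp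
      right_inv := fun S => by ext; simp }
  have hF : Fintype.ofFinite G.edgeSet = ‹Fintype G.edgeSet› := Subsingleton.elim _ _
  rw [hF]
  refine Finset.sum_equiv e (fun _ => by simp) fun S _ => ?_
  have hS : {i | e S i = true} = (S : Set G.edgeSet) := by ext; simp [e]
  rw [hS]
  by_cases hT : IsTree ends Set.univ ⊥ (S : Set G.edgeSet)
  · rw [if_pos hT, if_pos ((h.isSpanningTree_iff hG _).mpr hT), ← Finset.prod_compl_mul_prod S]
    have h1 : ∏ i ∈ S, (bif e S i then 1 else MvPolynomial.X i : MvPolynomial G.edgeSet K) = 1 :=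
      Finset.prod_eq_one fun i hi => by simp [e, hi]
    rw [h1, mul_one]
    refine Finset.prod_congr rfl fun i hi => ?_
    simp [e, Finset.mem_compl.mp hi]
  · rw [if_neg hT, if_neg (mt (h.isSpanningTree_iff hG _).mp hT)]

theorem grothendieckClass_eq (K : Type u) [Field K] [Finite G.edgeSet] [Fintype G.edgeSet]
    {ends : G.edgeSet → G.vertexSet × G.vertexSet} (h : G.IsEnds ends)
    (hG : G.vertexSet.Nonempty) :
    G.grothendieckClass K = complClass (treePoly K ends Set.univ ⊥) := by
  rw [← h.kirchhoff_eq K hG]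
  rfl

/-- Isomorphic graphs have the same class. -/
theorem Isomorphic.grothendieckClass_eq (K : Type u) [Field K] [Finite G.edgeSet]
    [Finite H.edgeSet] (h : G.Isomorphic H) (hG : G.vertexSet.Nonempty) :
    G.grothendieckClass K = H.grothendieckClass K := by
  classical
  have := Fintype.ofFinite G.edgeSet
  have := Fintype.ofFinite H.edgeSet
  obtain ⟨f, g, hfg⟩ := h
  obtain ⟨ends, he⟩ := G.exists_isEnds
  obtain ⟨ends', he'⟩ := H.exists_isEnds
  have hH : H.vertexSet.Nonempty := by
    obtain ⟨x, hx⟩ := hG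
    exact ⟨_, (f ⟨x, hx⟩).2⟩
  -- The orientations of the edges of `G` and `H` were chosen independently, so the ends match only
  -- up to a swap.
  have h1 := treePoly_relabel K (ends := ends) (ends' := ends') g f (fun e => by
    have h2 := (he e (ends e).1 (ends e).2).mpr (.inl rfl)
    rw [hfg] at h2
    exact (he' (g e) _ _).mp h2) Set.univ ⊥
  have hb : (⊥ : Setoid H.vertexSet).comap f = ⊥ := by
    ext a b
    exact f.injective.eq_iff
  rw [Set.image_univ, f.surjective.range_eq, hb] at h1
  rw [Graph.grothendieckClass_eq K he hG, Graph.grothendieckClass_eq K he' hH, h1,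
    complClass_rename_equiv]

end

end Graph

/-- The unlabelled edge of a labelled edge. -/
def LabelledEdge.pair (e : LabelledEdge) : ℕ × ℕ := (e.src, e.tgt)

theorem MelonicState.grothendieckClass_toGraph (K : Type u) [Field K] (P : MelonicState)
    (h : 0 < P.numV) :
    P.toGraph.grothendieckClass K =
      edgeClass K {v | v < P.numV} (P.edges.map LabelledEdge.pair) := by
  classical
  have := Fintype.ofFinite P.toGraph.edgeSet
  let ends : P.toGraph.edgeSet → P.toGraph.vertexSet × P.toGraph.vertexSet := fun e =>
    (⟨⟨_, P.src_lt _ (List.getElem_mem e.1.2)⟩, trivial⟩,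
      ⟨⟨_, P.tgt_lt _ (List.getElem_mem e.1.2)⟩, trivial⟩)
  have he : P.toGraph.IsEnds ends := by
    rintro e ⟨x, hx⟩ ⟨y, hy⟩
    change (P.edges[e.1].src = x ∧ P.edges[e.1].tgt = y) ∨
      (P.edges[e.1].src = y ∧ P.edges[e.1].tgt = x) ↔ _
    simp only [ends, Prod.ext_iff, Subtype.ext_iff, Fin.ext_iff]
    rfl
  rw [Graph.grothendieckClass_eq K he ⟨⟨0, h⟩, trivial⟩, edgeClass_coe]
  let e : P.toGraph.edgeSet ≃ Fin (P.edges.map LabelledEdge.pair).length :=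
    (Equiv.Set.univ _).trans (finCongr (List.length_map _).symm)
  have h1 := treePoly_relabel K (ends := ends) (ends' := (P.edges.map LabelledEdge.pair).get) e
    (fun v => v.1.1) (fun i => .inl (by simp [e, ends, LabelledEdge.pair]; exact ⟨rfl, rfl⟩))
    Set.univ ⊥
  have hb : (⊥ : Setoid ℕ).comap (fun v : P.toGraph.vertexSet => v.1.1) = ⊥ := by
    ext a b
    exact (Fin.ext_iff.symm.trans Subtype.ext_iff.symm)
  have hr : (fun v : P.toGraph.vertexSet => v.1.1) '' Set.univ = {v | v < P.numV} := by
    ext v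
    refine ⟨?_, fun hv => ⟨⟨⟨v, hv⟩, trivial⟩, trivial, rfl⟩⟩
    rintro ⟨w, -, rfl⟩
    exact w.1.2
  rw [hb, hr] at h1
  rw [listClass, h1, complClass_rename_equiv]

/-! ## Melonic constructions with arbitrary new vertices -/

/-- The string of bananas of sizes `b` along the list of vertices `vs`, the labels of the bananas
starting with `j`. -/
def stringEdges (s : ℕ) : ℕ → List ℕ → List ℕ → Multiset LabelledEdge
  | j, x :: y :: vs, a :: b =>
    Multiset.replicate a ⟨s, j, x, y⟩ + stringEdges s (j + 1) (y :: vs) b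
  | _, _, _ => 0

theorem stringEdges_cons (s j x y : ℕ) (vs : List ℕ) (a : ℕ) (b : List ℕ) :
    stringEdges s j (x :: y :: vs) (a :: b) =
      Multiset.replicate a ⟨s, j, x, y⟩ + stringEdges s (j + 1) (y :: vs) b := rfl

theorem stringEdges_nil (s j : ℕ) (vs : List ℕ) : stringEdges s j vs [] = 0 := by
  rcases vs with _ | ⟨x, _ | ⟨y, vs⟩⟩ <;> rfl

/-- The vertex `x` ends the first string and starts the second; the labels of the second continue
after those of the first. -/
theorem stringEdges_append (s j x : ℕ) (vs₁ vs₂ b₁ b₂ : List ℕ) (h : vs₁.length = b₁.length) :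
    stringEdges s j (vs₁ ++ x :: vs₂) (b₁ ++ b₂) =
      stringEdges s j (vs₁ ++ [x]) b₁ + stringEdges s (j + b₁.length) (x :: vs₂) b₂ := by
  induction vs₁ generalizing j b₁ with
  | nil =>
    obtain rfl := List.length_eq_zero_iff.mp h.symm
    simp [stringEdges_nil]
  | cons y vs₁ ih =>
    obtain _ | ⟨a, b₁⟩ := b₁
    · simp at h
    have h' : vs₁.length = b₁.length := by simpa using h
    have := ih (j + 1) b₁ h'
    rcases vs₁ with _ | ⟨z, vs₁⟩
    · simp only [List.nil_append, List.cons_append, stringEdges_cons, List.length_cons] at this ⊢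
      rw [this, add_assoc, add_assoc, add_comm 1 b₁.length]
    · simp only [List.cons_append, stringEdges_cons, List.length_cons] at this ⊢
      rw [this, add_assoc, add_assoc, add_comm 1]

theorem stringEdges_bounds {s j : ℕ} {vs b : List ℕ} {e : LabelledEdge}
    (he : e ∈ stringEdges s j vs b) :
    e.stage = s ∧ j ≤ e.banana ∧ e.banana < j + b.length ∧ e.src ∈ vs ∧ e.tgt ∈ vs := by
  induction b generalizing j vs with
  | nil => simp [stringEdges_nil] at he
  | cons a b ih =>
    rcases vs with _ | ⟨x, _ | ⟨y, vs⟩⟩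
    · simp [stringEdges] at he
    · simp [stringEdges] at he
    · rw [stringEdges_cons, Multiset.mem_add] at he
      rcases he with he | he
      · obtain rfl := Multiset.eq_of_mem_replicate he
        simp
      · obtain ⟨h1, h2, h3, h4, h5⟩ := ih he
        refine ⟨h1, by omega, by rw [List.length_cons]; omega, ?_, ?_⟩
        · exact List.mem_cons_of_mem _ h4
        · exact List.mem_cons_of_mem _ h5

theorem stringEdges_unique {s j : ℕ} {vs b : List ℕ} {e e' : LabelledEdge}
    (he : e ∈ stringEdges s j vs b) (he' : e' ∈ stringEdges s j vs b)
    (h : e.banana = e'.banana) : e = e' := by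
  induction b generalizing j vs with
  | nil => simp [stringEdges_nil] at he
  | cons a b ih =>
    rcases vs with _ | ⟨x, _ | ⟨y, vs⟩⟩
    · simp [stringEdges] at he
    · simp [stringEdges] at he
    · rw [stringEdges_cons, Multiset.mem_add] at he he'
      rcases he with he | he <;> rcases he' with he' | he'
      · rw [Multiset.eq_of_mem_replicate he, Multiset.eq_of_mem_replicate he']
      · have := (stringEdges_bounds he').2.1
        rw [← h, Multiset.eq_of_mem_replicate he] at this
        simp at this
      · have := (stringEdges_bounds he).2.1
        rw [h, Multiset.eq_of_mem_replicate he'] at this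
        simp at this
      · exact ih he he'

/-- The label of an edge. -/
abbrev LabelledEdge.HasLabel (e : LabelledEdge) (p k : ℕ) : Prop := e.stage = p ∧ e.banana = k

theorem countP_stringEdges (s j k : ℕ) (vs b : List ℕ) (h : vs.length = b.length + 1) :
    (stringEdges s j vs b).countP (fun e => e.HasLabel s k) =
      if j ≤ k then (b[k - j]?).getD 0 else 0 := by
  induction b generalizing j vs with
  | nil => simp [stringEdges_nil]
  | cons a b ih =>
    rcases vs with _ | ⟨x, _ | ⟨y, vs⟩⟩
    · simp at h
    · simp at h
    · have h1 : (y :: vs).length = b.length + 1 := by simpa using h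
      rw [stringEdges_cons, Multiset.countP_add, ih _ _ h1]
      obtain hlt | rfl | hgt := lt_trichotomy j k
      · have h2 : (Multiset.replicate a (⟨s, j, x, y⟩ : LabelledEdge)).countP
            (fun e => e.HasLabel s k) = 0 := by
          rw [Multiset.countP_eq_zero]
          intro e he
          rw [Multiset.eq_of_mem_replicate he]
          simp; omega
        obtain ⟨d, rfl⟩ := Nat.exists_eq_add_of_lt hlt
        rw [h2, if_pos (by omega), if_pos (by omega)]
        have e1 : j + d + 1 - (j + 1) = d := by omega
        have e2 : j + d + 1 - j = d + 1 := by omega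
        rw [e1, e2, List.getElem?_cons_succ, zero_add]
      · have h2 : (Multiset.replicate a (⟨s, j, x, y⟩ : LabelledEdge)).countP
            (fun e => e.HasLabel s j) = a := by
          rw [Multiset.countP_eq_card.mpr, Multiset.card_replicate]
          intro e he
          rw [Multiset.eq_of_mem_replicate he]
          exact ⟨rfl, rfl⟩
        rw [h2, if_neg (by omega)]
        simp
      · have h2 : (Multiset.replicate a (⟨s, j, x, y⟩ : LabelledEdge)).countP
            (fun e => e.HasLabel s k) = 0 := by
          rw [Multiset.countP_eq_zero]
          intro e he
          rw [Multiset.eq_of_mem_replicate he]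
          simp; omega
        rw [h2, if_neg (by omega), if_neg (by omega)]

/-- The graphs with vertices `V` and edges `E` obtained by a construction `T`, the new vertices
being arbitrary. -/
inductive Builds : List MelonicTuple → Finset ℕ → Multiset LabelledEdge → Prop
  | nil (x y : ℕ) (h : x ≠ y) : Builds [] {x, y} {⟨0, 1, x, y⟩}
  | snoc {T : List MelonicTuple} {V : Finset ℕ} {E : Multiset LabelledEdge} (t : MelonicTuple)
      (e : LabelledEdge) (ws : List ℕ) (hT : Builds T V E) (he : e ∈ E)
      (hl : e.HasLabel t.p t.k) (hws : ws.Nodup) (hV : ∀ v ∈ ws, v ∉ V)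
      (hlen : ws.length + 1 = t.b.length) :
      Builds (T ++ [t]) (V ∪ ws.toFinset)
        (E.erase e + stringEdges (T.length + 1) 1 (e.src :: (ws ++ [e.tgt])) t.b)

namespace Builds

variable {T : List MelonicTuple} {V : Finset ℕ} {E : Multiset LabelledEdge}

theorem mem_vertices (h : Builds T V E) {e : LabelledEdge} (he : e ∈ E) :
    e.src ∈ V ∧ e.tgt ∈ V := by
  induction h generalizing e with
  | nil x y h =>
    obtain rfl := Multiset.mem_singleton.mp he
    simp
  | snoc t f ws hT hf hl hws hV hlen ih =>
    rcases Multiset.mem_add.mp he with he | he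
    · have := ih (Multiset.mem_of_mem_erase he)
      exact ⟨Finset.mem_union_left _ this.1, Finset.mem_union_left _ this.2⟩
    · have h1 := (stringEdges_bounds he).2.2.2
      have h2 := ih hf
      simp only [List.mem_cons, List.mem_append, List.not_mem_nil, or_false] at h1
      simp only [Finset.mem_union, List.mem_toFinset]
      constructor
      · rcases h1.1 with h | h | h
        · exact .inl (h ▸ h2.1)
        · exact .inr h
        · exact .inl (h ▸ h2.2)
      · rcases h1.2 with h | h | h
        · exact .inl (h ▸ h2.1)
        · exact .inr h
        · exact .inl (h ▸ h2.2)

theorem stage_le (h : Builds T V E) {e : LabelledEdge} (he : e ∈ E) :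
    e.stage ≤ T.length ∧ 1 ≤ e.banana := by
  induction h with
  | nil x y h =>
    obtain rfl := Multiset.mem_singleton.mp he
    simp
  | snoc t f ws hT hf hl hws hV hlen ih =>
    rw [List.length_append, List.length_singleton]
    rcases Multiset.mem_add.mp he with he | he
    · have := ih (Multiset.mem_of_mem_erase he)
      exact ⟨by omega, this.2⟩
    · have := stringEdges_bounds he
      exact ⟨this.1.le, this.2.1⟩

/-- All edges left in one banana are equal entries, so a tuple determines the edge it replaces. -/
theorem label_unique (h : Builds T V E) {e e' : LabelledEdge} (he : e ∈ E) (he' : e' ∈ E)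
    (h1 : e.stage = e'.stage) (h2 : e.banana = e'.banana) : e = e' := by
  induction h with
  | nil x y h =>
    rw [Multiset.mem_singleton.mp he, Multiset.mem_singleton.mp he']
  | snoc t f ws hT hf hl hws hV hlen ih =>
    rcases Multiset.mem_add.mp he with he | he <;> rcases Multiset.mem_add.mp he' with he' | he'
    · exact ih (Multiset.mem_of_mem_erase he) (Multiset.mem_of_mem_erase he')
    · have := (hT.stage_le (Multiset.mem_of_mem_erase he)).1
      rw [h1, (stringEdges_bounds he').1] at this
      omega
    · have := (hT.stage_le (Multiset.mem_of_mem_erase he')).1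
      rw [← h1, (stringEdges_bounds he).1] at this
      omega
    · exact stringEdges_unique he he' h2

end Builds

/-! ### Counting the edges left in a banana -/

/-- The size of the `k`-th banana of stage `p`. -/
def bananaSize (T : List MelonicTuple) (p k : ℕ) : ℕ := ((stageBananas T p)[k - 1]?).getD 0

theorem stageBananas_append_of_le {T : List MelonicTuple} {p : ℕ} (h : p ≤ T.length)
    (T' : List MelonicTuple) : stageBananas (T ++ T') p = stageBananas T p := by
  cases p with
  | zero => rfl
  | succ p =>
    rw [stageBananas, stageBananas, List.map_append, List.getElem?_append_left (by simpa using h)]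

theorem stageBananas_append_singleton (T : List MelonicTuple) (t : MelonicTuple) :
    stageBananas (T ++ [t]) (T.length + 1) = t.b := by
  rw [stageBananas, List.map_append, List.getElem?_append_right (by simp)]
  simp

theorem stageBananas_of_lt {T : List MelonicTuple} {p : ℕ} (h : T.length < p) :
    stageBananas T p = [] := by
  cases p with
  | zero => simp at h
  | succ p =>
    rw [stageBananas, List.getElem?_eq_none (by simp; omega)]
    rfl

theorem numReplaced_append (T T' : List MelonicTuple) (p k : ℕ) :
    numReplaced (T ++ T') p k = numReplaced T p k + numReplaced T' p k := by
  simp [numReplaced, List.countP_append]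

theorem stageBananas_succ {T : List MelonicTuple} {i : ℕ} (hi : i < T.length) :
    stageBananas T (i + 1) = T[i].b := by
  rw [stageBananas, List.getElem?_map, List.getElem?_eq_getElem hi]
  rfl

theorem bananaSize_succ {T : List MelonicTuple} {i j : ℕ} (hi : i < T.length)
    (hj : j < T[i].b.length) : bananaSize T (i + 1) (j + 1) = T[i].b[j] := by
  rw [bananaSize, stageBananas_succ hi, Nat.add_sub_cancel, List.getElem?_eq_getElem hj]
  rfl

namespace Builds

variable {T : List MelonicTuple} {V : Finset ℕ} {E : Multiset LabelledEdge}

/-- A conservation law: each replacement removes one edge from its banana and is counted once. The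
condition `1 ≤ k` is needed because `bananaSize` reads the index `k - 1`, which would confuse `k =
0` with `k = 1`. -/
theorem countP_add (h : Builds T V E) (p k : ℕ) (hk : 1 ≤ k) :
    E.countP (fun e => e.HasLabel p k) + numReplaced T p k = bananaSize T p k := by
  induction h with
  | nil x y h =>
    have h0 : numReplaced [] p k = 0 := rfl
    rw [h0, add_zero, ← Multiset.cons_zero, Multiset.countP_cons, Multiset.countP_zero, zero_add,
      bananaSize]
    rcases p with _ | p
    · obtain rfl | ⟨k, rfl⟩ : k = 1 ∨ ∃ k', k = k' + 2 := by
        obtain _ | _ | k := k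
        · simp at hk
        · exact .inl rfl
        · exact .inr ⟨k, rfl⟩
      · rfl
      · rw [if_neg (by simp)]
        simp [stageBananas]
    · rw [if_neg (by simp), stageBananas_of_lt (by simp)]
      rfl
  | @snoc T V E t f ws hT hf hl hws hV hlen ih =>
    rw [Multiset.countP_add, numReplaced_append]
    have h1 : E.countP (fun e => e.HasLabel p k) =
        (E.erase f).countP (fun e => e.HasLabel p k) + numReplaced [t] p k := by
      conv_lhs => rw [← Multiset.cons_erase hf, Multiset.countP_cons]
      congr 1
      simp only [numReplaced, List.countP_singleton, LabelledEdge.HasLabel, hl.1, hl.2,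
        decide_eq_true_eq]
    have h2 := (hT.stage_le hf).1
    rw [hl.1] at h2
    obtain hlt | hp := lt_or_ge T.length p
    · have h3 : bananaSize T p k = 0 := by rw [bananaSize, stageBananas_of_lt hlt]; rfl
      obtain rfl | hp := eq_or_lt_of_le (Nat.succ_le_of_lt hlt)
      · rw [Nat.succ_eq_add_one, countP_stringEdges _ _ _ _ _ (by simp; omega), if_pos hk,
          bananaSize, stageBananas_append_singleton]
        rw [Nat.succ_eq_add_one] at *
        omega
      · have h4 : (stringEdges (T.length + 1) 1 (f.src :: (ws ++ [f.tgt])) t.b).countP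
            (fun e => e.HasLabel p k) = 0 := by
          rw [Multiset.countP_eq_zero]
          intro e he hl
          have := (stringEdges_bounds he).1
          have := hl.1
          omega
        have h5 : bananaSize (T ++ [t]) p k = 0 := by
          rw [bananaSize, stageBananas_of_lt (by simp; omega)]; rfl
        omega
    · have h4 : (stringEdges (T.length + 1) 1 (f.src :: (ws ++ [f.tgt])) t.b).countP
            (fun e => e.HasLabel p k) = 0 := by
        rw [Multiset.countP_eq_zero]
        intro e he hl
        have := (stringEdges_bounds he).1
        have := hl.1
        omega
      rw [bananaSize, stageBananas_append_of_le hp, ← bananaSize]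
      omega

end Builds

/-! ### Melonic constructions are exactly those with a graph and positive sizes -/

/-- All the bananas of a construction have positive size. -/
def AllPos (T : List MelonicTuple) : Prop := ∀ t ∈ T, ∀ a ∈ t.b, 0 < a

theorem allPos_append {T T' : List MelonicTuple} : AllPos (T ++ T') ↔ AllPos T ∧ AllPos T' :=
  List.forall_mem_append

theorem allPos_singleton {t : MelonicTuple} : AllPos [t] ↔ ∀ a ∈ t.b, 0 < a :=
  List.forall_mem_singleton

theorem exists_fresh (V : Finset ℕ) (n : ℕ) :
    ∃ ws : List ℕ, ws.length = n ∧ ws.Nodup ∧ ∀ v ∈ ws, v ∉ V := by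
  obtain ⟨W, hW, hc⟩ := (Set.Finite.infinite_compl V.finite_toSet).exists_subset_card_eq n
  exact ⟨W.toList, by simpa using hc, W.nodup_toList, fun v hv => hW (by simpa using hv)⟩

namespace Builds

variable {T : List MelonicTuple} {V : Finset ℕ} {E : Multiset LabelledEdge}

theorem bananaSize_pos (h : Builds T V E) {e : LabelledEdge} (he : e ∈ E) :
    numReplaced T e.stage e.banana + 1 ≤ bananaSize T e.stage e.banana := by
  have := h.countP_add e.stage e.banana (h.stage_le he).2
  have h1 : 0 < E.countP (fun f => f.HasLabel e.stage e.banana) :=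
    Multiset.countP_pos.mpr ⟨e, he, rfl, rfl⟩
  omega

theorem exists_mem (h : Builds T V E) {p k : ℕ} (hk : 1 ≤ k)
    (hlt : numReplaced T p k < bananaSize T p k) : ∃ e ∈ E, e.HasLabel p k := by
  have := h.countP_add p k hk
  exact Multiset.countP_pos.mp (by omega : 0 < E.countP (fun f => f.HasLabel p k))

theorem le_length_of_bananaSize_pos {p k : ℕ} (hk : 1 ≤ k) (h : 0 < bananaSize T p k) :
    k ≤ (stageBananas T p).length := by
  by_contra hlt
  rw [bananaSize, List.getElem?_eq_none (by omega)] at h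
  simp at h

/-- The bound on the number of replacements is `countP_add`. Positivity is a separate hypothesis
because `Builds` tolerates bananas of size zero. -/
theorem isMelonic (h : Builds T V E) (hT : AllPos T) : IsMelonic T := by
  have href : (∀ t ∈ T, t.b ≠ []) ∧
      (∀ (s : ℕ) (hs : s < T.length), T[s].p < s + 1) ∧ (∀ t ∈ T, 1 ≤ t.k) ∧
      (∀ t ∈ T, t.k ≤ (stageBananas T t.p).length) ∧
      (∀ (s : ℕ) (hs : s < T.length), 0 < s → 0 < T[s].p) := by
    clear hT
    induction h with
    | nil => simp
    | @snoc T V E t f ws hT hf hl hws hV hlen ih =>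
      obtain ⟨h1, h2, h3, h4, h5⟩ := ih
      have hp := hT.stage_le hf
      rw [hl.1, hl.2] at hp
      have hlt := hT.bananaSize_pos hf
      rw [hl.1, hl.2] at hlt
      have get (s : ℕ) (hs : s < (T ++ [t]).length) :
          (∃ h : s < T.length, (T ++ [t])[s] = T[s]) ∨ s = T.length ∧ (T ++ [t])[s] = t := by
        rw [List.getElem_append]
        split_ifs with h
        · exact .inl ⟨h, rfl⟩
        · simp only [List.length_append, List.length_singleton] at hs
          have : s = T.length := by omega
          exact .inr ⟨this, by simp⟩
      refine ⟨?_, fun s hs => ?_, ?_, ?_, fun s hs h0 => ?_⟩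
      · rw [List.forall_mem_append]
        refine ⟨h1, List.forall_mem_singleton.mpr fun h => ?_⟩
        rw [h] at hlen
        simp at hlen
      · obtain ⟨h, h'⟩ | ⟨h, h'⟩ := get s hs <;> rw [h']
        · exact h2 s h
        · omega
      · rw [List.forall_mem_append]
        exact ⟨h3, List.forall_mem_singleton.mpr hp.2⟩
      · rw [List.forall_mem_append]
        constructor
        · intro t' ht'
          obtain ⟨s, hs, rfl⟩ := List.getElem_of_mem ht'
          have := h2 s hs
          rw [stageBananas_append_of_le (by omega)]
          exact h4 _ ht'
        · rw [List.forall_mem_singleton, stageBananas_append_of_le hp.1]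
          exact le_length_of_bananaSize_pos hp.2 (by omega)
      · obtain ⟨h, h'⟩ | ⟨h, h'⟩ := get s hs <;> rw [h']
        · exact h5 s h h0
        -- Stage 0 has a single edge, and the first tuple has already replaced it.
        · by_contra h6
          have h7 : t.p = 0 := by omega
          rw [h7] at hlt
          have h8 : bananaSize T 0 t.k ≤ 1 := by
            rw [bananaSize]
            rcases hk : t.k - 1 with _ | n <;> simp [stageBananas]
          have h9 : bananaSize T 0 t.k = 1 := by omega
          have h10 : t.k ≤ (stageBananas T 0).length :=
            le_length_of_bananaSize_pos hp.2 (by omega)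
          have h11 : t.k = 1 := by simp [stageBananas] at h10; omega
          have hpos : 0 < T.length := by omega
          have h12 : 0 < numReplaced T 0 t.k := by
            rw [numReplaced, List.countP_pos_iff]
            refine ⟨T[0], List.getElem_mem hpos, ?_⟩
            have := h2 0 hpos
            have h13 := h4 _ (List.getElem_mem hpos)
            have h14 := h3 _ (List.getElem_mem hpos)
            have h15 : T[0].p = 0 := by omega
            rw [h15] at h13
            simp [stageBananas] at h13
            simp only [decide_eq_true_eq]
            omega
          omega
  obtain ⟨h1, h2, h3, h4, h5⟩ := href
  refine ⟨h1, hT, h2, h3, h4, h5, fun i hi j hj => ?_⟩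
  have := h.countP_add (i + 1) (j + 1) (by omega)
  rw [bananaSize_succ hi hj] at this
  omega

end Builds

/-- The inequality says that an edge is still available for the last stage; this drives the
construction of a graph in `IsMelonic.exists_builds`. -/
theorem IsMelonic.of_append {T : List MelonicTuple} {t : MelonicTuple} (h : IsMelonic (T ++ [t])) :
    IsMelonic T ∧ numReplaced T t.p t.k < bananaSize T t.p t.k := by
  have get (s : ℕ) (hs : s < T.length) : (T ++ [t])[s]'(by simp; omega) = T[s] :=
    List.getElem_append_left hs
  have hplt (s : ℕ) (hs : s < T.length) : T[s].p < s + 1 := by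
    have := h.p_lt s (by simp; omega)
    rwa [get s hs] at this
  have htp : t.p ≤ T.length := by
    have := h.p_lt T.length (by simp)
    simp at this
    omega
  have hnum := h.numReplaced_le
  have mem {t'} (ht' : t' ∈ T) : t' ∈ T ++ [t] := List.mem_append_left _ ht'
  have htm : t ∈ T ++ [t] := by simp
  refine ⟨⟨fun t' ht' => h.ne_nil _ (mem ht'), fun t' ht' => h.pos _ (mem ht'), hplt,
    fun t' ht' => h.one_le_k _ (mem ht'), fun t' ht' => ?_, fun s hs h0 => ?_,
    fun i hi j hj => ?_⟩, ?_⟩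
  · have := h.k_le _ (mem ht')
    obtain ⟨s, hs, rfl⟩ := List.getElem_of_mem ht'
    have := hplt s hs
    rwa [stageBananas_append_of_le (by omega)] at *
  · have := h.p_pos s (by simp; omega) h0
    rwa [get s hs] at this
  · have := hnum i (by simp; omega) j (by rw [get i hi]; exact hj)
    simp only [get i hi] at this
    rw [numReplaced_append] at this
    omega
  · have hk := h.one_le_k t htm
    have hkl := h.k_le t htm
    rw [stageBananas_append_of_le htp] at hkl
    have hone : numReplaced [t] t.p t.k = 1 := by simp [numReplaced]
    rcases hp : t.p with _ | i
    · have hT : T = [] := by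
        by_contra hne
        have := h.p_pos T.length (by simp) (List.length_pos_iff.mpr hne)
        simp [hp] at this
      subst hT
      rw [hp] at hkl
      simp [stageBananas] at hkl
      have hk1 : t.k = 1 := by omega
      rw [hk1]
      simp [numReplaced, bananaSize, stageBananas]
    · have hi : i < T.length := by omega
      rw [hp, stageBananas_succ hi] at hkl
      obtain ⟨j, hj⟩ := Nat.exists_eq_add_of_le' hk
      have := hnum i (by simp; omega) j (by rw [get i hi]; omega)
      simp only [get i hi] at this
      rw [numReplaced_append] at this
      rw [hp, hj] at hone
      rw [hj, bananaSize_succ hi (by omega)]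
      omega

theorem IsMelonic.exists_builds {T : List MelonicTuple} (h : IsMelonic T) :
    ∃ V E, Builds T V E := by
  induction T using List.reverseRecOn with
  | nil => exact ⟨_, _, .nil 0 1 (by simp)⟩
  | append_singleton T t ih =>
    obtain ⟨h1, h2⟩ := h.of_append
    obtain ⟨V, E, hB⟩ := ih h1
    have hk := h.one_le_k t (by simp)
    obtain ⟨e, he, hl⟩ := hB.exists_mem hk h2
    obtain ⟨ws, hws, hnd, hf⟩ := exists_fresh V (t.b.length - 1)
    have hb : 0 < t.b.length := List.length_pos_iff.mpr (h.ne_nil t (by simp))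
    exact ⟨_, _, hB.snoc t e ws he hl hnd hf (by omega)⟩

/-! ### Changing the size of a banana -/

theorem Multiset.erase_add_of_mem {α : Type*} [DecidableEq α] {s : Multiset α} (t : Multiset α)
    {a : α} (h : a ∈ s) : (s + t).erase a = s.erase a + t :=
  Multiset.erase_add_left_pos t h

theorem Multiset.mem_erase_of_mem_erase {α : Type*} [DecidableEq α] {s : Multiset α} {a b : α}
    (ha : a ∈ s.erase b) (hb : b ∈ s) : b ∈ s.erase a := by
  by_cases h : b = a
  · subst h
    exact ha
  · exact (Multiset.mem_erase_of_ne h).mpr hb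

/-- The condition on `φ` says that one edge gives way to `d` copies. It covers the decrease by 1 (`d
= 0`) and the increase by `a - 1` (`d = a`); positivity of `c` guards against truncated subtraction.
-/
theorem stringEdges_modify {s j : ℕ} {vs b : List ℕ} {e : LabelledEdge}
    (he : e ∈ stringEdges s j vs b) {φ : ℕ → ℕ} {d : ℕ} (hφ : ∀ c, 0 < c → φ c + 1 = c + d) :
    stringEdges s j vs (b.modify (e.banana - j) φ) =
      (stringEdges s j vs b).erase e + Multiset.replicate d e := by
  induction b generalizing j vs with
  | nil => simp [stringEdges_nil] at he
  | cons a b ih =>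
    rcases vs with _ | ⟨x, _ | ⟨y, vs⟩⟩
    · simp [stringEdges] at he
    · simp [stringEdges] at he
    · rw [stringEdges_cons] at he ⊢
      by_cases h : e ∈ Multiset.replicate a (⟨s, j, x, y⟩ : LabelledEdge)
      · have ha : 0 < a := by
          rw [Multiset.mem_replicate] at h
          omega
        rw [Multiset.erase_add_of_mem _ h]
        obtain rfl := Multiset.eq_of_mem_replicate h
        rw [Nat.sub_self, List.modify_zero_cons, stringEdges_cons, add_right_comm]
        congr 1
        obtain ⟨a, rfl⟩ := Nat.exists_eq_add_of_lt ha
        rw [zero_add, Multiset.replicate_succ, Multiset.erase_cons_head, ← Multiset.replicate_add]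
        congr 1
        have := hφ (a + 1) (by omega)
        omega
      · have he' := (Multiset.mem_add.mp he).resolve_left h
        have hb := (stringEdges_bounds he').2.1
        have e1 : e.banana - j = (e.banana - (j + 1)) + 1 := by omega
        rw [Multiset.erase_add_right_neg _ h, e1, List.modify_succ_cons, stringEdges_cons, ih he',
          add_assoc]

theorem List.modify_append_of_lt {α : Type*} {l : List α} (l' : List α) {i : ℕ}
    (h : i < l.length) (f : α → α) : (l ++ l').modify i f = l.modify i f ++ l' := by
  induction l generalizing i with
  | nil => simp at h
  | cons a l ih =>
    cases i with
    | zero => rfl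
    | succ i => simp [ih (Nat.lt_of_succ_lt_succ h)]

theorem List.modify_length_append_cons {α : Type*} (l l' : List α) (a : α) (f : α → α) :
    (l ++ a :: l').modify l.length f = l ++ f a :: l' := by
  induction l with
  | nil => rfl
  | cons b l ih => simp [ih]

theorem resize_append_of_le {T T' : List MelonicTuple} {p : ℕ} (h1 : 1 ≤ p) (hp : p ≤ T.length)
    (k : ℕ) (φ : ℕ → ℕ) : resize (T ++ T') p k φ = resize T p k φ ++ T' := by
  rw [resize, resize, List.modify_append_of_lt _ (by omega)]

theorem resize_append_singleton (T : List MelonicTuple) (t : MelonicTuple) (k : ℕ) (φ : ℕ → ℕ) :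
    resize (T ++ [t]) (T.length + 1) k φ = T ++ [{ t with b := t.b.modify (k - 1) φ }] := by
  rw [resize, Nat.add_sub_cancel, List.modify_length_append_cons]

namespace Builds

variable {T : List MelonicTuple} {V : Finset ℕ} {E : Multiset LabelledEdge}

/-- Changing the size of a banana amounts to replacing an edge by `d` copies of it. -/
theorem resize (h : Builds T V E) {e : LabelledEdge} (he : e ∈ E) (hp : 1 ≤ e.stage)
    {φ : ℕ → ℕ} {d : ℕ} (hφ : ∀ c, 0 < c → φ c + 1 = c + d) :
    Builds (_root_.resize T e.stage e.banana φ) V (E.erase e + Multiset.replicate d e) := by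
  induction h with
  | nil x y h =>
    rw [Multiset.mem_singleton.mp he] at hp
    simp at hp
  | @snoc T V E t f ws hT hf hl hws hV hlen ih =>
    have hle := (snoc t f ws hT hf hl hws hV hlen).stage_le he
    by_cases h1 : e ∈ E.erase f
    · have he' := Multiset.mem_of_mem_erase h1
      -- Even if `e = f`, a further copy of `e` survives the last stage, so the two operations
      -- concern different copies and commute.
      have hfe : f ∈ E.erase e := Multiset.mem_erase_of_mem_erase h1 hf
      rw [resize_append_of_le hp (hT.stage_le he').1, Multiset.erase_add_of_mem _ h1]
      have hlen' : T.length = (_root_.resize T e.stage e.banana φ).length := by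
        rw [_root_.resize, List.length_modify]
      have := (ih he').snoc t f ws (Multiset.mem_add.mpr (.inl hfe)) hl hws hV hlen
      rwa [Multiset.erase_add_of_mem _ hfe, ← hlen', Multiset.erase_comm, add_right_comm] at this
    · have he' := (Multiset.mem_add.mp he).resolve_left h1
      have hs := (stringEdges_bounds he').1
      rw [hs, resize_append_singleton, Multiset.erase_add_right_neg _ h1, add_assoc,
        ← stringEdges_modify he' hφ]
      exact hT.snoc { t with b := t.b.modify (e.banana - 1) φ } f ws hf hl hws hV
        (by rw [List.length_modify, hlen])

end Builds

theorem AllPos.resize {T : List MelonicTuple} (h : AllPos T) (p k : ℕ) {φ : ℕ → ℕ}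
    (hφ : ∀ i (hi : i < T.length), i = p - 1 → ∀ j (hj : j < T[i].b.length), j = k - 1 →
      0 < φ (T[i].b[j])) : AllPos (resize T p k φ) := by
  intro t ht a ha
  obtain ⟨i, hi, rfl⟩ := List.getElem_of_mem ht
  rw [_root_.resize, List.length_modify] at hi
  have hT := h _ (List.getElem_mem hi)
  by_cases hip : i = p - 1
  · simp only [_root_.resize, List.getElem_modify, if_pos hip.symm] at ha
    obtain ⟨j, hj, rfl⟩ := List.getElem_of_mem ha
    rw [List.length_modify] at hj
    rw [List.getElem_modify]
    split_ifs with hjk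
    · exact hφ i hi hip j hj hjk.symm
    · exact hT _ (List.getElem_mem hj)
  · simp only [_root_.resize, List.getElem_modify, if_neg (Ne.symm hip)] at ha
    exact hT _ ha

/-! ### Uniqueness of the graph up to relabelling -/

/-- Relabelling the vertices of an edge. -/
def LabelledEdge.map (σ : ℕ → ℕ) (e : LabelledEdge) : LabelledEdge :=
  ⟨e.stage, e.banana, σ e.src, σ e.tgt⟩

theorem stringEdges_map (σ : ℕ → ℕ) (s j : ℕ) (vs b : List ℕ) :
    (stringEdges s j vs b).map (LabelledEdge.map σ) = stringEdges s j (vs.map σ) b := by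
  induction b generalizing j vs with
  | nil => simp [stringEdges_nil]
  | cons a b ih =>
    rcases vs with _ | ⟨x, _ | ⟨y, vs⟩⟩
    · rfl
    · rfl
    · rw [stringEdges_cons, Multiset.map_add, ih, Multiset.map_replicate]
      rfl

theorem exists_map_eq {ws ws' : List ℕ} (h : ws.Nodup) (hl : ws.length = ws'.length) :
    ∃ τ : ℕ → ℕ, ws.map τ = ws' := by
  refine ⟨fun v => ws'[ws.idxOf v]?.getD 0, List.ext_getElem (by simpa using hl) fun i hi hi' => ?_⟩
  rw [List.getElem_map, h.idxOf_getElem, List.getElem?_eq_getElem hi']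
  rfl

namespace Builds

variable {T : List MelonicTuple} {V V' : Finset ℕ} {E E' : Multiset LabelledEdge}

/-- A construction determines its graph up to isomorphism. -/
theorem exists_relabel (h : Builds T V E) (h' : Builds T V' E') :
    ∃ σ : ℕ → ℕ, Set.InjOn σ V ∧ σ '' V = V' ∧ E' = E.map (LabelledEdge.map σ) := by
  induction h generalizing V' E' with
  | nil x y hxy =>
    generalize hT : ([] : List MelonicTuple) = T' at h'
    cases h' with
    | nil x' y' hxy' =>
      refine ⟨fun v => if v = x then x' else y', ?_, ?_, ?_⟩
      · intro a ha b hb hab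
        simp only [Finset.coe_insert, Finset.coe_singleton, Set.mem_insert_iff,
          Set.mem_singleton_iff] at ha hb
        grind
      · simp [Set.image_insert_eq, hxy.symm]
      · simp [LabelledEdge.map, hxy.symm]
    | snoc => simp at hT
  | @snoc T V E t f ws hT hf hl hws hV hlen ih =>
    generalize hT' : T ++ [t] = T' at h'
    cases h' with
    | nil x' y' hxy' => simp at hT'
    | @snoc T₁ V₁ E₁ t₁ f₁ ws₁ hT₁ hf₁ hl₁ hws₁ hV₁ hlen₁ =>
      obtain ⟨rfl, h1⟩ := List.append_inj' hT' rfl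
      obtain rfl : t = t₁ := by simpa using h1
      obtain ⟨σ, hinj, himg, rfl⟩ := ih hT₁
      obtain ⟨τ, hτ⟩ := exists_map_eq (ws' := ws₁) hws (by omega)
      -- Keep the relabelling of the earlier stages on `V`, and match the new vertices in order.
      let ρ : ℕ → ℕ := fun v => if v ∈ V then σ v else τ v
      have hρV : ∀ v ∈ V, ρ v = σ v := fun v hv => if_pos hv
      have hρw : ws.map ρ = ws₁ := by
        rw [← hτ]
        exact List.map_congr_left fun v hv => if_neg (hV v hv)
      have hEρ : E.map (LabelledEdge.map σ) = E.map (LabelledEdge.map ρ) := by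
        refine Multiset.map_congr rfl fun e he => ?_
        have := hT.mem_vertices he
        rw [LabelledEdge.map, LabelledEdge.map, hρV _ this.1, hρV _ this.2]
      have hρimg : ρ '' V = V₁ := by
        rw [← himg]
        exact Set.image_congr hρV
      -- Both graphs replace an edge with the label prescribed by `t`, and that label determines the
      -- edge.
      have hf₁' : f₁ = f.map ρ := by
        refine hT₁.label_unique hf₁ ?_ (hl₁.1.trans hl.1.symm) (hl₁.2.trans hl.2.symm)
        rw [hEρ]
        exact Multiset.mem_map_of_mem _ hf
      refine ⟨ρ, ?_, ?_, ?_⟩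
      · rw [Finset.coe_union]
        refine (Set.injOn_union ?_).mpr ⟨?_, ?_, ?_⟩
        · rw [Set.disjoint_right]
          intro v hv
          exact hV v (by simpa using hv)
        · intro a ha b hb hab
          rw [hρV a ha, hρV b hb] at hab
          exact hinj ha hb hab
        · intro a ha b hb hab
          rw [← hρw] at hws₁
          exact List.inj_on_of_nodup_map hws₁ (by simpa using ha) (by simpa using hb) hab
        · intro a ha b hb hab
          refine hV₁ (ρ b) ?_ ?_
          · rw [← hρw]
            exact List.mem_map_of_mem (by simpa using hb)
          · rw [← hab, ← Finset.mem_coe, ← hρimg]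
            exact Set.mem_image_of_mem _ ha
      · rw [Finset.coe_union, Set.image_union, hρimg, Finset.coe_union, ← hρw]
        congr 1
        ext v
        simp
      · rw [hEρ, hf₁', Multiset.map_add, stringEdges_map,
          Multiset.map_erase_of_mem _ _ hf, List.map_cons, List.map_append, hρw]
        rfl

end Builds

/-! ### The standard graph is an instance -/

theorem melonicState_append_singleton (T : List MelonicTuple) (t : MelonicTuple) :
    melonicState (T ++ [t]) = (melonicState T).step (T.length + 1) t := by
  rw [melonicState, List.zipIdx_append, List.foldl_append]
  simp [melonicState]

/-- The starting index `n` is free for the induction; `f` and `g` list the sources and targets along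
the path `vs`. -/
theorem flatMap_zipIdx_eq_stringEdges (s n : ℕ) (vs b : List ℕ) (f g : ℕ → ℕ)
    (h : ∀ i < b.length, vs[i]? = some (f (n + i)) ∧ vs[i + 1]? = some (g (n + i))) :
    (((b.zipIdx n).flatMap fun (a, j) => List.replicate a
      (⟨s, j + 1, f j, g j⟩ : LabelledEdge) : List LabelledEdge) : Multiset LabelledEdge) =
      stringEdges s (n + 1) vs b := by
  induction b generalizing n vs with
  | nil => simp [stringEdges_nil]
  | cons a b ih =>
    rcases vs with _ | ⟨x, _ | ⟨y, vs⟩⟩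
    · simpa using h 0
    · simpa using h 0
    · obtain ⟨h1, h2⟩ := h 0 (by simp)
      simp only [List.getElem?_cons_zero, List.getElem?_cons_succ, Option.some.injEq,
        add_zero, zero_add] at h1 h2
      rw [List.zipIdx_cons, List.flatMap_cons, ← Multiset.coe_add, stringEdges_cons,
        ih (n + 1) (y :: vs), h1, h2, Multiset.coe_replicate]
      intro i hi
      have := h (i + 1) (by simpa using hi)
      rw [show n + 1 + i = n + (i + 1) by omega]
      simpa using this

theorem bananaString_eq (s N u w : ℕ) (b : List ℕ) (hb : b ≠ []) :
    (bananaString s N u w b : Multiset LabelledEdge) =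
      stringEdges s 1 (u :: (List.range' N (b.length - 1) ++ [w])) b := by
  have hb' := List.length_pos_iff.mpr hb
  refine flatMap_zipIdx_eq_stringEdges s 0 _ b (fun j => if j = 0 then u else N + (j - 1))
    (fun j => if j + 1 = b.length then w else N + j) fun i hi => ⟨?_, ?_⟩
  · rcases i with _ | i
    · simp
    · rw [List.getElem?_cons_succ, List.getElem?_append_left (by simp; omega),
        List.getElem?_range' (by omega)]
      simp
  · rw [List.getElem?_cons_succ, zero_add]
    by_cases h : i + 1 = b.length
    · rw [List.getElem?_append_right (by simp; omega), if_pos h]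
      simp [← h]
    · rw [List.getElem?_append_left (by simp; omega), List.getElem?_range' (by omega), if_neg h]
      simp

theorem MelonicState.step_eq {P : MelonicState} {t : MelonicTuple} {e : LabelledEdge}
    (he : e ∈ P.edges) (hl : e.HasLabel t.p t.k)
    (hu : ∀ f ∈ P.edges, f.HasLabel t.p t.k → f = e) (s : ℕ) :
    (P.step s t).numV = P.numV + (t.b.length - 1) ∧
      (P.step s t).edges = P.edges.erase e ++ bananaString s P.numV e.src e.tgt t.b := by
  unfold MelonicState.step
  split
  · rename_i h
    rw [List.find?_eq_none] at h
    exact absurd (decide_eq_true hl) (h e he)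
  · rename_i f h
    obtain rfl := hu f (List.mem_of_find?_eq_some h) (by simpa using List.find?_some h)
    exact ⟨rfl, rfl⟩

/-- The graph of a construction. -/
theorem Builds.melonicState {T : List MelonicTuple} {V : Finset ℕ} {E : Multiset LabelledEdge}
    (h : Builds T V E) :
    Builds T (Finset.range (melonicState T).numV) (melonicState T).edges := by
  induction h with
  | nil => exact .nil 0 1 (by simp)
  | @snoc T V E t f ws hT hf hl hws hV hlen ih =>
    have hk := (hT.stage_le hf).2
    have hlt := hT.bananaSize_pos hf
    rw [hl.1, hl.2] at hlt
    -- The count of remaining edges depends only on the construction, so the search in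
    -- `MelonicState.step` succeeds.
    obtain ⟨e, he, hle⟩ := ih.exists_mem (hl.2 ▸ hk) hlt
    have hb : t.b ≠ [] := by
      rintro h
      rw [h] at hlen
      simp at hlen
    obtain ⟨h1, h2⟩ := MelonicState.step_eq (P := _root_.melonicState T) he hle
      (fun f hf hlf => ih.label_unique hf he (hlf.1.trans hle.1.symm) (hlf.2.trans hle.2.symm))
      (T.length + 1)
    rw [melonicState_append_singleton, h1, h2, ← Multiset.coe_add, ← Multiset.coe_erase,
      bananaString_eq _ _ _ _ _ hb]
    have h3 := ih.snoc t e (List.range' (_root_.melonicState T).numV (t.b.length - 1)) he hle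
      List.nodup_range' (fun v hv => by
        rw [List.mem_range'_1] at hv
        simp
        omega) (by rw [List.length_range']; omega)
    convert h3 using 1
    ext v
    simp
    omega

/-! ## The class of a construction -/

theorem MelonicState.isomorphic {P Q : MelonicState} (ρ : ℕ → ℕ)
    (hinj : Set.InjOn ρ (Finset.range P.numV : Finset ℕ))
    (himg : ρ '' (Finset.range P.numV : Finset ℕ) = (Finset.range Q.numV : Finset ℕ))
    (hE : (Q.edges.map LabelledEdge.pair : Multiset (ℕ × ℕ)) =
      (P.edges : Multiset LabelledEdge).map (Prod.map ρ ρ ∘ LabelledEdge.pair)) :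
    P.toGraph.Isomorphic Q.toGraph := by
  have hlt (v : ℕ) (hv : v < P.numV) : ρ v < Q.numV := by
    have : ρ v ∈ ((Finset.range Q.numV : Finset ℕ) : Set ℕ) :=
      himg ▸ Set.mem_image_of_mem ρ (by simpa using hv)
    simpa using this
  let f : P.toGraph.vertexSet → Q.toGraph.vertexSet := fun v => ⟨⟨ρ v.1, hlt v.1 v.1.2⟩, trivial⟩
  have hf : Function.Bijective f := by
    constructor
    · intro v w hvw
      have h1 : ρ v.1 = ρ w.1 := congrArg (fun x : Q.toGraph.vertexSet => (x.1 : ℕ)) hvw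
      exact Subtype.ext (Fin.ext (hinj (by simp) (by simp) h1))
    · rintro ⟨w, hw⟩
      have h1 : (w : ℕ) ∈ ((Finset.range Q.numV : Finset ℕ) : Set ℕ) := by simp
      rw [← himg] at h1
      obtain ⟨v, hv, hvw⟩ := h1
      exact ⟨⟨⟨v, by simpa using hv⟩, trivial⟩, Subtype.ext (Fin.ext hvw)⟩
  rw [Multiset.map_coe, Multiset.coe_eq_coe] at hE
  obtain ⟨g, hg⟩ := hE.symm.exists_equiv_get
  let g' : P.toGraph.edgeSet ≃ Q.toGraph.edgeSet :=
    (Equiv.Set.univ _).trans (((finCongr (List.length_map _).symm).trans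
      (g.trans (finCongr (List.length_map _)))).trans (Equiv.Set.univ _).symm)
  have hg' (e : P.toGraph.edgeSet) : Q.edges[(g' e).1].src = ρ P.edges[e.1].src ∧
      Q.edges[(g' e).1].tgt = ρ P.edges[e.1].tgt := by
    have := hg (finCongr (List.length_map _).symm e.1)
    simp only [List.get_eq_getElem, List.getElem_map, finCongr_apply, Fin.val_cast,
      Function.comp_apply, LabelledEdge.pair, Prod.map_apply, Prod.mk.injEq] at this
    exact this
  refine ⟨Equiv.ofBijective f hf, g', fun e x y => ?_⟩
  change (P.edges[e.1].src = x.1 ∧ P.edges[e.1].tgt = y.1) ∨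
      (P.edges[e.1].src = y.1 ∧ P.edges[e.1].tgt = x.1) ↔
    (Q.edges[(g' e).1].src = ρ x.1 ∧ Q.edges[(g' e).1].tgt = ρ y.1) ∨
      (Q.edges[(g' e).1].src = ρ y.1 ∧ Q.edges[(g' e).1].tgt = ρ x.1)
  have hs : P.edges[e.1].src < P.numV := P.src_lt _ (List.getElem_mem e.1.2)
  have ht : P.edges[e.1].tgt < P.numV := P.tgt_lt _ (List.getElem_mem e.1.2)
  have hi {v w : ℕ} (hv : v < P.numV) (hw : w < P.numV) : ρ v = ρ w ↔ v = w :=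
    hinj.eq_iff (by simpa using hv) (by simpa using hw)
  rw [(hg' e).1, (hg' e).2, hi hs x.1.2, hi hs y.1.2, hi ht x.1.2, hi ht y.1.2]

namespace Builds

variable {T T' : List MelonicTuple} {V V' : Finset ℕ} {E E' : Multiset LabelledEdge}

theorem numV_pos (h : Builds T V E) : 0 < (_root_.melonicState T).numV := by
  have hne : V.Nonempty := by
    cases h with
    | nil x y h => exact ⟨x, by simp⟩
    | snoc t f ws hT hf => exact ⟨_, Finset.mem_union_left _ (hT.mem_vertices hf).1⟩
  obtain ⟨σ, -, himg, -⟩ := h.exists_relabel h.melonicState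
  obtain ⟨v, hv⟩ := hne
  have : σ v ∈ ((Finset.range (_root_.melonicState T).numV : Finset ℕ) : Set ℕ) :=
    himg ▸ Set.mem_image_of_mem σ hv
  rw [Finset.mem_coe, Finset.mem_range] at this
  omega

theorem pair_mem (h : Builds T V E) : ∀ p ∈ E.map LabelledEdge.pair, p.1 ∈ (V : Set ℕ) ∧
    p.2 ∈ (V : Set ℕ) := by
  intro p hp
  obtain ⟨e, he, rfl⟩ := Multiset.mem_map.mp hp
  exact h.mem_vertices he

/-- The class may be computed on any realisation, with whatever vertices are convenient. -/
theorem melonicClass_eq (K : Type u) [Field K] (h : Builds T V E) :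
    melonicClass K T = edgeClass K V (E.map LabelledEdge.pair) := by
  obtain ⟨σ, hinj, himg, hE⟩ := h.exists_relabel h.melonicState
  have h1 := edgeClass_image (K := K) h.pair_mem hinj
  rw [himg, Multiset.map_map] at h1
  have h2 : melonicClass K T = (_root_.melonicState T).toGraph.grothendieckClass K := rfl
  rw [h2, MelonicState.grothendieckClass_toGraph K _ h.numV_pos, ← h1]
  congr 1
  · ext v
    simp
  · rw [← Multiset.map_coe, hE, Multiset.map_map]
    rfl

theorem card_eq (h : Builds T V E) : (melonicGraph T).edgeSet.ncard = Multiset.card E := by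
  obtain ⟨σ, hinj, himg, hE⟩ := h.exists_relabel h.melonicState
  change Set.univ.ncard = _
  rw [Set.ncard_univ, Nat.card_eq_fintype_card, Fintype.card_fin, ← Multiset.coe_card, hE,
    Multiset.card_map]

/-- Constructions with the same vertices and edges, up to labels, have isomorphic graphs. -/
theorem isomorphic (h : Builds T V E) (h' : Builds T' V E')
    (hE : E.map LabelledEdge.pair = E'.map LabelledEdge.pair) :
    (melonicGraph T).Isomorphic (melonicGraph T') := by
  obtain ⟨σ, hinj, himg, hσ⟩ := h.melonicState.exists_relabel h
  obtain ⟨σ', hinj', himg', hσ'⟩ := h'.exists_relabel h'.melonicState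
  refine MelonicState.isomorphic (σ' ∘ σ) (hinj'.comp hinj (himg ▸ Set.mapsTo_image σ _))
    (by rw [Set.image_comp, himg, himg']) ?_
  rw [← Multiset.map_coe, hσ', Multiset.map_map]
  have h1 (τ : ℕ → ℕ) : LabelledEdge.pair ∘ LabelledEdge.map τ = Prod.map τ τ ∘ LabelledEdge.pair :=
    rfl
  rw [h1, ← Multiset.map_map, ← hE, hσ, Multiset.map_map, Multiset.map_map]
  rfl

end Builds

/-! ## Strings of bananas in a graph -/

/-- The edges of a string of bananas of sizes `b` along the list of vertices `vs`. -/
def stringPairs : List ℕ → List ℕ → Multiset (ℕ × ℕ)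
  | x :: y :: vs, a :: b => Multiset.replicate a (x, y) + stringPairs (y :: vs) b
  | _, _ => 0

theorem stringPairs_cons (x y : ℕ) (vs : List ℕ) (a : ℕ) (b : List ℕ) :
    stringPairs (x :: y :: vs) (a :: b) =
      Multiset.replicate a (x, y) + stringPairs (y :: vs) b := rfl

theorem stringEdges_map_pair (s j : ℕ) (vs b : List ℕ) :
    (stringEdges s j vs b).map LabelledEdge.pair = stringPairs vs b := by
  induction b generalizing j vs with
  | nil => rcases vs with _ | ⟨x, _ | ⟨y, vs⟩⟩ <;> rfl
  | cons a b ih =>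
    rcases vs with _ | ⟨x, _ | ⟨y, vs⟩⟩
    · rfl
    · rfl
    · rw [stringEdges_cons, Multiset.map_add, ih, Multiset.map_replicate]
      rfl

theorem stringPairs_nil (vs : List ℕ) : stringPairs vs [] = 0 := by
  rcases vs with _ | ⟨x, _ | ⟨y, vs⟩⟩ <;> rfl

theorem stringPairs_append (x : ℕ) (vs₁ vs₂ b₁ b₂ : List ℕ) (h : vs₁.length = b₁.length) :
    stringPairs (vs₁ ++ x :: vs₂) (b₁ ++ b₂) =
      stringPairs (vs₁ ++ [x]) b₁ + stringPairs (x :: vs₂) b₂ := by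
  rw [← stringEdges_map_pair 0 0, stringEdges_append 0 0 x vs₁ vs₂ b₁ b₂ h, Multiset.map_add,
    stringEdges_map_pair, stringEdges_map_pair]

theorem stringPairs_map (f : ℕ → ℕ) (vs b : List ℕ) :
    (stringPairs vs b).map (Prod.map f f) = stringPairs (vs.map f) b := by
  rw [← stringEdges_map_pair 0 0 (vs.map f), ← stringEdges_map, ← stringEdges_map_pair 0 0,
    Multiset.map_map, Multiset.map_map]
  rfl

theorem stringPairs_mem {vs b : List ℕ} {p : ℕ × ℕ} (hp : p ∈ stringPairs vs b) :
    p.1 ∈ vs ∧ p.2 ∈ vs := by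
  rw [← stringEdges_map_pair 0 0] at hp
  obtain ⟨e, he, rfl⟩ := Multiset.mem_map.mp hp
  exact (stringEdges_bounds he).2.2.2

section

variable {K : Type u} [Field K] {s : Set ℕ} {M : Multiset (ℕ × ℕ)}

theorem Avoids.of_notMem (hM : ∀ p ∈ M, p.1 ∈ s ∧ p.2 ∈ s) {z : ℕ} (hz : z ∉ s) : Avoids M z :=
  fun p hp => ⟨fun h => hz (h ▸ (hM p hp).1), fun h => hz (h ▸ (hM p hp).2)⟩

theorem forall_mem_replicate_add (hM : ∀ p ∈ M, p.1 ∈ s ∧ p.2 ∈ s) {x y : ℕ} (hx : x ∈ s) (a : ℕ) :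
    ∀ p ∈ Multiset.replicate a (x, y) + M, p.1 ∈ insert y s ∧ p.2 ∈ insert y s := by
  intro p hp
  rcases Multiset.mem_add.mp hp with hp | hp
  · rw [Multiset.eq_of_mem_replicate hp]
    exact ⟨.inr hx, .inl rfl⟩
  · exact ⟨.inr (hM p hp).1, .inr (hM p hp).2⟩

theorem insert_union_setOf_mem (y : ℕ) (ws : List ℕ) :
    insert y s ∪ {v | v ∈ ws} = s ∪ {v | v ∈ y :: ws} := by
  ext v
  simp only [Set.mem_union, Set.mem_insert_iff, Set.mem_ofPred_eq, List.mem_cons]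
  tauto

/-- A string of bananas starting at a vertex and ending outside of the graph. -/
theorem edgeClass_pendant_string {u : ℕ} {ws b : List ℕ} (hu : u ∈ s)
    (hlen : ws.length = b.length) (hws : ws.Nodup) (hs : ∀ v ∈ ws, v ∉ s)
    (hM : ∀ p ∈ M, p.1 ∈ s ∧ p.2 ∈ s) :
    edgeClass K (s ∪ {v | v ∈ ws}) (stringPairs (u :: ws) b + M) =
      (b.map fun a => Polynomial.aeval (torus K) (bananaPoly a)).prod * edgeClass K s M := by
  induction b generalizing u ws s M with
  | nil =>
    obtain rfl := List.length_eq_zero_iff.mp hlen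
    simp [stringPairs_nil]
  | cons a b ih =>
    obtain _ | ⟨y, ws⟩ := ws
    · simp at hlen
    have hy : y ∉ s := hs y (by simp)
    rw [List.nodup_cons] at hws
    -- The first banana is counted with the graph while the induction detaches the rest of the
    -- string at `y`; then it is itself attached at the single vertex `u`.
    rw [stringPairs_cons, add_comm (Multiset.replicate a (u, y)), add_assoc,
      ← insert_union_setOf_mem, ih (Set.mem_insert y s) (by simpa using hlen) hws.2
      (fun v hv h => ?_) (forall_mem_replicate_add hM hu a),
      edgeClass_pendant hu hy a (.of_notMem hM hy), List.map_cons, List.prod_cons]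
    · ring
    · rcases h with rfl | h
      · exact hws.1 hv
      · exact hs v (by simp [hv]) h

/-- A string of bananas starting outside of the graph and ending at a vertex. -/
theorem edgeClass_pendant_string_reverse {w : ℕ} {ws b : List ℕ} (hw : w ∈ s)
    (hlen : ws.length = b.length) (hws : ws.Nodup) (hs : ∀ v ∈ ws, v ∉ s)
    (hM : ∀ p ∈ M, p.1 ∈ s ∧ p.2 ∈ s) :
    edgeClass K (s ∪ {v | v ∈ ws}) (stringPairs (ws ++ [w]) b + M) =
      (b.map fun a => Polynomial.aeval (torus K) (bananaPoly a)).prod * edgeClass K s M := by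
  induction b using List.reverseRecOn generalizing w ws s M with
  | nil =>
    obtain rfl := List.length_eq_zero_iff.mp hlen
    simp [stringPairs_nil]
  | append_singleton b a ih =>
    obtain rfl | ⟨ws, y, rfl⟩ := List.eq_nil_or_concat' ws
    · simp at hlen
    have hy : y ∉ s := hs y (by simp)
    rw [List.nodup_append] at hws
    have hlen' : ws.length = b.length := by simpa using hlen
    have hset : s ∪ {v | v ∈ ws ++ [y]} = insert y s ∪ {v | v ∈ ws} := by
      ext v
      simp only [Set.mem_union, Set.mem_insert_iff, Set.mem_ofPred_eq, List.mem_append,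
        List.mem_singleton]
      tauto
    have hM' : ∀ p ∈ Multiset.replicate a (y, w) + M, p.1 ∈ insert y s ∧ p.2 ∈ insert y s := by
      intro p hp
      rcases Multiset.mem_add.mp hp with hp | hp
      · rw [Multiset.eq_of_mem_replicate hp]
        exact ⟨.inl rfl, .inr hw⟩
      · exact ⟨.inr (hM p hp).1, .inr (hM p hp).2⟩
    rw [List.append_assoc, List.singleton_append, stringPairs_append _ _ _ _ _ hlen',
      stringPairs_cons, stringPairs_nil, add_zero, add_assoc, hset,
      ih (Set.mem_insert y s) hlen' hws.1 (fun v hv h => ?_) hM', edgeClass_swap,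
      edgeClass_pendant hw hy a (.of_notMem hM hy), List.map_append, List.prod_append,
      List.map_singleton, List.prod_singleton]
    · ring
    · rcases h with rfl | h
      · exact hws.2.2 v hv v (by simp) rfl
      · exact hs v (by simp [hv]) h

/-- Replacing an edge by a string of edges. -/
theorem edgeClass_string_one {u w : ℕ} {ws : List ℕ} (hu : u ∈ s) (hw : w ∈ s)
    (hws : ws.Nodup) (hs : ∀ v ∈ ws, v ∉ s) (hM : ∀ p ∈ M, p.1 ∈ s ∧ p.2 ∈ s) :
    edgeClass K (s ∪ {v | v ∈ ws})
      (stringPairs (u :: (ws ++ [w])) (List.replicate (ws.length + 1) 1) + M) =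
      lefschetz K ^ ws.length * edgeClass K s ((u, w) ::ₘ M) := by
  induction ws generalizing u s M with
  | nil => simp [stringPairs]
  | cons z ws ih =>
    have hz : z ∉ s := hs z (by simp)
    rw [List.nodup_cons] at hws
    rw [List.length_cons, List.replicate_succ, List.cons_append, stringPairs_cons,
      add_comm (Multiset.replicate 1 (u, z)), add_assoc, ← insert_union_setOf_mem,
      ih (Set.mem_insert z s) (.inr hw) hws.2 (fun v hv h => ?_)
      (forall_mem_replicate_add hM hu 1), Multiset.replicate_one, Multiset.singleton_add,
      Multiset.cons_swap, edgeClass_subdivide hu hw hz (.of_notMem hM hz), pow_succ]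
    · ring
    · rcases h with rfl | h
      · exact hws.1 hv
      · exact hs v (by simp [hv]) h

/-- The variant in which the contraction eliminates `x`. It is needed when `y` is an old vertex and
`x` a new one, so that the old graph stays fixed. -/
theorem edgeClass_replicate_reverse {x y : ℕ} (h : x ≠ y) (m : ℕ) :
    edgeClass K s (Multiset.replicate m (x, y) + M) =
      Polynomial.aeval (torus K) (fPoly m) * edgeClass K s ((x, y) ::ₘ M) +
      Polynomial.aeval (torus K) (gPoly m) *
        edgeClass K (subst x y '' s) (M.map (Prod.map (subst x y) (subst x y))) +
      Polynomial.aeval (torus K) (hPoly m) * edgeClass K s M := by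
  have := edgeClass_swap (K := K) s x y 1 M
  rw [Multiset.replicate_one, Multiset.replicate_one, Multiset.singleton_add,
    Multiset.singleton_add] at this
  rw [edgeClass_swap, edgeClass_replicate h.symm, this]

theorem map_subst_of_notMem {x y : ℕ} {l : List ℕ} (h : y ∉ l) : l.map (subst y x) = l := by
  conv_rhs => rw [← List.map_id l]
  exact List.map_congr_left fun v hv => subst_of_ne fun h' => h (h' ▸ hv)

theorem map_subst_pairs {x y : ℕ} (h : Avoids M y) :
    M.map (Prod.map (subst y x) (subst y x)) = M := by
  conv_rhs => rw [← Multiset.map_id M]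
  refine Multiset.map_congr rfl fun p hp => ?_
  exact Prod.ext (subst_of_ne (h p hp).1) (subst_of_ne (h p hp).2)

theorem image_subst {x y : ℕ} {t : Set ℕ} (hx : x ∈ t) (hy : y ∉ t) :
    subst y x '' (insert y t) = t := by
  rw [Set.image_insert_eq, subst_self]
  have : subst y x '' t = t := by
    conv_rhs => rw [← Set.image_id t]
    exact Set.image_congr fun v hv => subst_of_ne fun h' => hy (h' ▸ hv)
  rw [this, Set.insert_eq_of_mem hx]

/-- The recursion formula, for a string of bananas in a graph. -/
theorem edgeClass_string {u w a : ℕ} {ws₁ ws₂ as bs : List ℕ} (hu : u ∈ s) (hw : w ∈ s)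
    (h₁ : ws₁.length = as.length) (h₂ : ws₂.length = bs.length) (hws : (ws₁ ++ ws₂).Nodup)
    (hs : ∀ v ∈ ws₁ ++ ws₂, v ∉ s) (hM : ∀ p ∈ M, p.1 ∈ s ∧ p.2 ∈ s) (hne : as ++ bs ≠ []) :
    ∃ ws : List ℕ, ws.Nodup ∧ (∀ v ∈ ws, v ∉ s) ∧ ws.length + 1 = (as ++ bs).length ∧
      edgeClass K (s ∪ {v | v ∈ ws₁ ++ ws₂})
        (stringPairs (u :: (ws₁ ++ ws₂ ++ [w])) (as ++ a :: bs) + M) =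
      Polynomial.aeval (torus K) (fPoly a) * edgeClass K (s ∪ {v | v ∈ ws₁ ++ ws₂})
        (stringPairs (u :: (ws₁ ++ ws₂ ++ [w])) (as ++ 1 :: bs) + M) +
      Polynomial.aeval (torus K) (gPoly a) * edgeClass K (s ∪ {v | v ∈ ws})
        (stringPairs (u :: (ws ++ [w])) (as ++ bs) + M) +
      (as.map fun x => Polynomial.aeval (torus K) (bananaPoly x)).prod *
        (bs.map fun x => Polynomial.aeval (torus K) (bananaPoly x)).prod *
        Polynomial.aeval (torus K) (hPoly a) * edgeClass K s M := by
  -- The vertices `x` and `y` bound the distinguished banana: the last vertex before it and the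
  -- first one after it.
  obtain ⟨L₁, x, hx⟩ : ∃ L₁ x, u :: ws₁ = L₁ ++ [x] := by
    obtain h | ⟨L, x, h⟩ := List.eq_nil_or_concat' (u :: ws₁)
    · simp at h
    · exact ⟨L, x, h⟩
  obtain ⟨y, L₂, hy⟩ : ∃ y L₂, ws₂ ++ [w] = y :: L₂ := by
    cases ws₂ with
    | nil => exact ⟨w, [], rfl⟩
    | cons y L => exact ⟨y, L ++ [w], rfl⟩
  have hl₁ : L₁.length = as.length := by
    have := congrArg List.length hx
    simp at this
    omega
  have hpath : u :: (ws₁ ++ ws₂ ++ [w]) = L₁ ++ x :: y :: L₂ := by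
    rw [List.append_assoc, hy, ← List.cons_append, hx, List.append_assoc, List.singleton_append]
  have hsplit (m : ℕ) : stringPairs (u :: (ws₁ ++ ws₂ ++ [w])) (as ++ m :: bs) + M =
      Multiset.replicate m (x, y) +
        (stringPairs (u :: ws₁) as + (stringPairs (ws₂ ++ [w]) bs + M)) := by
    rw [hpath, stringPairs_append _ _ _ _ _ hl₁, stringPairs_cons, ← hx, ← hy]
    abel
  rw [List.nodup_append] at hws
  obtain ⟨hn₁, hn₂, hdisj⟩ := hws
  -- Without the distinguished banana the string falls into a chain hanging from `u` and a chain
  -- hanging from `w`.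
  have hrest : edgeClass K (s ∪ {v | v ∈ ws₁ ++ ws₂})
      (stringPairs (u :: ws₁) as + (stringPairs (ws₂ ++ [w]) bs + M)) =
      (as.map fun x => Polynomial.aeval (torus K) (bananaPoly x)).prod *
        (bs.map fun x => Polynomial.aeval (torus K) (bananaPoly x)).prod * edgeClass K s M := by
    have hset : s ∪ {v | v ∈ ws₁ ++ ws₂} = (s ∪ {v | v ∈ ws₂}) ∪ {v | v ∈ ws₁} := by
      ext v
      simp only [Set.mem_union, Set.mem_ofPred_eq, List.mem_append]
      tauto
    rw [hset, edgeClass_pendant_string (.inl hu) h₁ hn₁ (fun v hv h => ?_) (fun p hp => ?_),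
      edgeClass_pendant_string_reverse hw h₂ hn₂ (fun v hv => hs v (by simp [hv])) hM, mul_assoc]
    · rcases h with h | h
      · exact hs v (by simp [hv]) h
      · exact hdisj v hv v h rfl
    · rcases Multiset.mem_add.mp hp with hp | hp
      · have := stringPairs_mem hp
        simp only [List.mem_append, List.mem_singleton] at this
        refine ⟨?_, ?_⟩
        · rcases this.1 with h | h
          · exact .inr h
          · exact .inl (h ▸ hw)
        · rcases this.2 with h | h
          · exact .inr h
          · exact .inl (h ▸ hw)
      · exact ⟨.inl (hM p hp).1, .inl (hM p hp).2⟩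
  have hxmem : x ∈ u :: ws₁ := hx ▸ by simp
  have hymem : y ∈ ws₂ ++ [w] := hy ▸ by simp
  -- The contraction must absorb a new vertex. If `bs` is empty then `y = w` is old, and `as` is not
  -- empty, so `x` is new and is merged into `w`; otherwise `y` is new and is merged into `x`.
  rcases List.eq_nil_or_concat' bs with rfl | hbs
  · obtain rfl := List.length_eq_zero_iff.mp h₂
    obtain rfl | ⟨ws, x', rfl⟩ := List.eq_nil_or_concat' ws₁
    · rw [List.length_eq_zero_iff.mp h₁.symm] at hne
      simp at hne
    obtain ⟨rfl, hx'⟩ : u :: ws = L₁ ∧ [x'] = [x] := List.append_inj' (t₁ := [x']) hx rfl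
    obtain rfl : x' = x := by simpa using hx'
    obtain ⟨rfl, rfl⟩ : w = y ∧ [] = L₂ := by simpa using hy
    have hxs : x' ∉ s := hs x' (by simp)
    have hxw : x' ∉ ws := fun h => by
      rw [List.nodup_append] at hn₁
      exact hn₁.2.2 x' h x' (by simp) rfl
    refine ⟨ws, (List.nodup_append.mp hn₁).1, fun v hv => hs v (by simp [hv]), by
      simpa using h₁, ?_⟩
    have hset : s ∪ {v | v ∈ ws ++ [x'] ++ []} = insert x' (s ∪ {v | v ∈ ws}) := by
      ext v
      simp only [Set.mem_union, Set.mem_insert_iff, Set.mem_ofPred_eq, List.mem_append,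
        List.mem_singleton, List.not_mem_nil]
      tauto
    have hxu : x' ≠ u := fun h => hxs (h ▸ hu)
    have hxw' : x' ≠ w := fun h => hxs (h ▸ hw)
    rw [hsplit, hsplit, edgeClass_replicate_reverse hxw', hrest, Multiset.replicate_one,
      Multiset.singleton_add]
    have hkey : edgeClass K (subst x' w '' (s ∪ {v | v ∈ ws ++ [x'] ++ []}))
        ((stringPairs (u :: (ws ++ [x'])) as + (stringPairs ([] ++ [w]) [] + M)).map
          (Prod.map (subst x' w) (subst x' w))) =
        edgeClass K (s ∪ {v | v ∈ ws}) (stringPairs (u :: (ws ++ [w])) (as ++ []) + M) := by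
      rw [hset, image_subst (.inl hw) (fun h => h.elim hxs hxw), Multiset.map_add,
        Multiset.map_add, stringPairs_map, stringPairs_nil, Multiset.map_zero, zero_add,
        map_subst_pairs (.of_notMem hM hxs), List.map_cons, List.map_append,
        map_subst_of_notMem hxw, List.map_singleton, subst_self, subst_of_ne hxu.symm,
        List.append_nil]
    rw [hkey]
    ring
  · obtain _ | ⟨y', ws⟩ := ws₂
    · obtain ⟨L, b, rfl⟩ := hbs
      simp at h₂
    obtain ⟨rfl, rfl⟩ : y' = y ∧ ws ++ [w] = L₂ := by simpa using hy
    have hys : y' ∉ s := hs y' (by simp)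
    have hyw : y' ∉ ws := (List.nodup_cons.mp hn₂).1
    have hyw₁ : y' ∉ ws₁ := fun h => hdisj y' h y' (by simp) rfl
    have hyu : y' ≠ u := fun h => hys (h ▸ hu)
    have hyw' : y' ≠ w := fun h => hys (h ▸ hw)
    have hyu₁ : y' ∉ u :: ws₁ := by simp [hyu, hyw₁]
    have hxy : x ≠ y' := fun h => hyu₁ (h ▸ hxmem)
    refine ⟨ws₁ ++ ws, ?_, fun v hv => hs v ?_, by simp at h₂ ⊢; omega, ?_⟩
    · rw [List.nodup_append]
      exact ⟨hn₁, (List.nodup_cons.mp hn₂).2, fun v hv v' hv' => hdisj v hv v' (by simp [hv'])⟩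
    · rcases List.mem_append.mp hv with h | h <;> simp [h]
    have hset : s ∪ {v | v ∈ ws₁ ++ y' :: ws} = insert y' (s ∪ {v | v ∈ ws₁ ++ ws}) := by
      ext v
      simp only [Set.mem_union, Set.mem_insert_iff, Set.mem_ofPred_eq, List.mem_append,
        List.mem_cons]
      tauto
    rw [hsplit, hsplit, edgeClass_replicate hxy, hrest, Multiset.replicate_one,
      Multiset.singleton_add]
    have hkey : edgeClass K (subst y' x '' (s ∪ {v | v ∈ ws₁ ++ y' :: ws}))
        ((stringPairs (u :: ws₁) as + (stringPairs (y' :: ws ++ [w]) bs + M)).map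
          (Prod.map (subst y' x) (subst y' x))) =
        edgeClass K (s ∪ {v | v ∈ ws₁ ++ ws})
          (stringPairs (u :: (ws₁ ++ ws ++ [w])) (as ++ bs) + M) := by
      have hp : u :: (ws₁ ++ ws ++ [w]) = L₁ ++ x :: (ws ++ [w]) := by
        rw [List.append_assoc, ← List.cons_append, hx, List.append_assoc, List.singleton_append]
      rw [hset, image_subst ?_ (fun h => ?_), Multiset.map_add, Multiset.map_add,
        stringPairs_map, stringPairs_map, map_subst_of_notMem hyu₁,
        map_subst_pairs (.of_notMem hM hys), List.map_append, List.map_cons, subst_self,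
        map_subst_of_notMem hyw, List.map_singleton, subst_of_ne hyw'.symm, hp,
        stringPairs_append _ _ _ _ _ hl₁, ← hx, add_assoc]
      · rfl
      · rcases List.mem_cons.mp hxmem with h | h
        · exact .inl (h ▸ hu)
        · exact .inr (by simp [h])
      · rcases h with h | h
        · exact hys h
        · exact (List.mem_append.mp h).elim hyw₁ hyw
    rw [hkey]
    ring

end

/-! ## The rules of the recursion -/

/-- The empty set is the only spanning tree, and the hypersurface complement is a point. -/
theorem edgeClass_singleton_zero (K : Type u) [Field K] (x : ℕ) :
    edgeClass K {x} 0 = 1 := by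
  have h : treePoly K ([] : List (ℕ × ℕ)).get {x} ⊥ = 1 := by
    have hT (S : Set (Fin ([] : List (ℕ × ℕ)).length)) :
        IsTree ([] : List (ℕ × ℕ)).get {x} ⊥ S := by
      refine ⟨?_, fun i => i.elim0⟩
      rintro _ rfl _ rfl
      exact Setoid.refl' _ _
    have : IsEmpty (Fin ([] : List (ℕ × ℕ)).length) := Fin.isEmpty
    rw [treePoly, Fintype.sum_unique, if_pos (hT _)]
    exact Finset.prod_of_isEmpty _
  have : IsEmpty (Fin ([] : List (ℕ × ℕ)).length) := Fin.isEmpty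
  rw [← Multiset.coe_nil, edgeClass_coe, listClass, h, complClass_isEmpty_one]

theorem card_stringEdges (s j : ℕ) {vs b : List ℕ} (h : vs.length = b.length + 1) :
    Multiset.card (stringEdges s j vs b) = b.sum := by
  induction b generalizing j vs with
  | nil => simp [stringEdges_nil]
  | cons a b ih =>
    rcases vs with _ | ⟨x, _ | ⟨y, vs⟩⟩
    · simp at h
    · simp at h
    · rw [stringEdges_cons, Multiset.card_add, ih (j + 1) (by simpa using h),
        Multiset.card_replicate, List.sum_cons]

namespace Builds

variable {T : List MelonicTuple} {V : Finset ℕ} {E : Multiset LabelledEdge} {t : MelonicTuple}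
  {e : LabelledEdge} {ws : List ℕ}

/-- Places constructions which differ only in the sizes of the last string around the same rest
graph `E.erase e`. -/
theorem melonicClass_snoc (K : Type u) [Field K] (hT : Builds T V E) (he : e ∈ E)
    (hl : e.HasLabel t.p t.k) (hws : ws.Nodup) (hV : ∀ v ∈ ws, v ∉ V)
    (hlen : ws.length + 1 = t.b.length) :
    melonicClass K (T ++ [t]) = edgeClass K ((V : Set ℕ) ∪ {v | v ∈ ws})
      (stringPairs (e.src :: (ws ++ [e.tgt])) t.b + (E.erase e).map LabelledEdge.pair) := by
  rw [(hT.snoc t e ws he hl hws hV hlen).melonicClass_eq K, Multiset.map_add,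
    stringEdges_map_pair, add_comm, Finset.coe_union]
  congr 2
  ext v
  simp

theorem card_snoc (hT : Builds T V E) (he : e ∈ E) (hl : e.HasLabel t.p t.k) (hb : t.b ≠ []) :
    (melonicGraph (T ++ [t])).edgeSet.ncard + 1 = Multiset.card E + t.b.sum := by
  obtain ⟨ws, hlen, hws, hV⟩ := exists_fresh V (t.b.length - 1)
  have hb' := List.length_pos_iff.mpr hb
  rw [(hT.snoc t e ws he hl hws hV (by omega)).card_eq, Multiset.card_add,
    card_stringEdges _ _ (by simp; omega)]
  have := Multiset.card_erase_add_one he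
  omega

theorem isMelonic_snoc (hT : Builds T V E) (he : e ∈ E) (hl : e.HasLabel t.p t.k) (hb : t.b ≠ [])
    (hpos : AllPos (T ++ [t])) : IsMelonic (T ++ [t]) := by
  obtain ⟨ws, hlen, hws, hV⟩ := exists_fresh V (t.b.length - 1)
  have hb' := List.length_pos_iff.mpr hb
  exact (hT.snoc t e ws he hl hws hV (by omega)).isMelonic hpos

theorem pair_mem_erase (hT : Builds T V E) (e : LabelledEdge) :
    ∀ p ∈ (E.erase e).map LabelledEdge.pair, p.1 ∈ (V : Set ℕ) ∧ p.2 ∈ (V : Set ℕ) :=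
  fun p hp => hT.pair_mem p (Multiset.mem_of_le (Multiset.map_le_map (Multiset.erase_le _ _)) hp)

end Builds

section

variable {T : List MelonicTuple} {t : MelonicTuple}

theorem IsMelonic.exists_builds_snoc (h : IsMelonic (T ++ [t])) :
    ∃ V E e, Builds T V E ∧ e ∈ E ∧ e.HasLabel t.p t.k := by
  obtain ⟨h1, h2⟩ := h.of_append
  obtain ⟨V, E, hB⟩ := h1.exists_builds
  obtain ⟨e, he, hl⟩ := hB.exists_mem (h.one_le_k t (by simp)) h2
  exact ⟨V, E, e, hB, he, hl⟩

theorem IsMelonic.p_pos_last (h : IsMelonic (T ++ [t])) (hT : T ≠ []) : 1 ≤ t.p := by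
  have := h.p_pos T.length (by simp) (List.length_pos_iff.mpr hT)
  simp at this
  omega

/-- The last stage of a reduced construction does not replace the edge of a `1`-banana. -/
theorem IsReducedMelonic.ne_one (h : IsReducedMelonic (T ++ [t])) {i j : ℕ} (hi : i < T.length)
    (hj : j < T[i].b.length) (hp : t.p = i + 1) (hk : t.k = j + 1) : T[i].b[j] ≠ 1 := by
  intro h1
  have hget : (T ++ [t])[i]'(by simp; omega) = T[i] := List.getElem_append_left hi
  have := h i (by simp; omega) j (by rw [hget]; exact hj)
  simp only [hget] at this
  exact this h1 t (by simp) ⟨hp, hk⟩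

/-- Here reducedness enters: the banana that loses an edge has at least two, so none of size zero
appears. -/
theorem allPos_resize_sub_one (h : IsMelonic (T ++ [t])) (hr : IsReducedMelonic (T ++ [t]))
    (hT : T ≠ []) : AllPos (resize T t.p t.k (· - 1)) := by
  refine (allPos_append.mp h.pos).1.resize _ _ fun i hi hip j hj hjk => ?_
  have hp := h.p_pos_last hT
  have hk := h.one_le_k t (by simp)
  have h1 := hr.ne_one hi hj (by omega) (by omega)
  have h2 := h.of_append.1.pos _ (List.getElem_mem hi) _ (List.getElem_mem hj)
  omega

end

/-- The recursion formula. -/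
theorem melonic_recursion (K : Type u) [Field K] {T : List MelonicTuple} {as bs : List ℕ}
    {a p k : ℕ} (hT : T ≠ []) (h : IsMelonic (T ++ [⟨as ++ a :: bs, p, k⟩]))
    (hr : IsReducedMelonic (T ++ [⟨as ++ a :: bs, p, k⟩])) (hne : as ++ bs ≠ []) (ha : 1 < a) :
    (IsMelonic (T ++ [⟨as ++ 1 :: bs, p, k⟩]) ∧
      (melonicGraph (T ++ [⟨as ++ 1 :: bs, p, k⟩])).edgeSet.ncard <
        (melonicGraph (T ++ [⟨as ++ a :: bs, p, k⟩])).edgeSet.ncard) ∧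
    (IsMelonic (T ++ [⟨as ++ bs, p, k⟩]) ∧
      (melonicGraph (T ++ [⟨as ++ bs, p, k⟩])).edgeSet.ncard <
        (melonicGraph (T ++ [⟨as ++ a :: bs, p, k⟩])).edgeSet.ncard) ∧
    (IsMelonic (resize T p k (· - 1)) ∧
      (melonicGraph (resize T p k (· - 1))).edgeSet.ncard <
        (melonicGraph (T ++ [⟨as ++ a :: bs, p, k⟩])).edgeSet.ncard) ∧
    melonicClass K (T ++ [⟨as ++ a :: bs, p, k⟩]) =
      Polynomial.aeval (torus K) (fPoly a) * melonicClass K (T ++ [⟨as ++ 1 :: bs, p, k⟩]) +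
      Polynomial.aeval (torus K) (gPoly a) * melonicClass K (T ++ [⟨as ++ bs, p, k⟩]) +
      (as.map fun x => Polynomial.aeval (torus K) (bananaPoly x)).prod *
        (bs.map fun x => Polynomial.aeval (torus K) (bananaPoly x)).prod *
        Polynomial.aeval (torus K) (hPoly a) * melonicClass K (resize T p k (· - 1)) := by
  obtain ⟨V, E, e, hB, he, hl⟩ := h.exists_builds_snoc
  have hpos := allPos_append.mp h.pos
  have hpos' := allPos_singleton.mp hpos.2
  have h1 : ∀ x ∈ as ++ 1 :: bs, 0 < x := by
    intro x hx
    rcases List.mem_append.mp hx with hx | hx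
    · exact hpos' x (List.mem_append_left _ hx)
    · rcases List.mem_cons.mp hx with rfl | hx
      · exact one_pos
      · exact hpos' x (by simp [hx])
  have h2 : ∀ x ∈ as ++ bs, 0 < x := by
    intro x hx
    rcases List.mem_append.mp hx with hx | hx <;> exact hpos' x (by simp [hx])
  have hp : 1 ≤ e.stage := hl.1 ▸ h.p_pos_last hT
  change e.HasLabel p k at hl
  -- Decreasing the size by 1 deletes the edge `e` without replacing it, leaving the common rest
  -- graph.
  have hB3 := hB.resize he hp (φ := (· - 1)) (d := 0) fun c hc => by omega
  rw [hl.1, hl.2, Multiset.replicate_zero, add_zero] at hB3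
  have c1 := hB.card_snoc (t := ⟨as ++ 1 :: bs, p, k⟩) he hl (by simp)
  have c2 := hB.card_snoc (t := ⟨as ++ bs, p, k⟩) he hl hne
  have c := hB.card_snoc (t := ⟨as ++ a :: bs, p, k⟩) he hl (by simp)
  have c3 := hB3.card_eq
  have cE := Multiset.card_erase_add_one he
  simp only [List.sum_append, List.sum_cons] at c c1 c2
  refine ⟨⟨hB.isMelonic_snoc he hl (by simp) (allPos_append.mpr
    ⟨hpos.1, allPos_singleton.mpr h1⟩), by omega⟩, ⟨hB.isMelonic_snoc he hl hne
    (allPos_append.mpr ⟨hpos.1, allPos_singleton.mpr h2⟩), by omega⟩,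
    ⟨hB3.isMelonic (allPos_resize_sub_one h hr hT), by omega⟩, ?_⟩
  -- `T` and `T'` share these new vertices; `T''` needs one fewer, and its list comes from
  -- `edgeClass_string`.
  obtain ⟨ws, hlen, hws, hV⟩ := exists_fresh V (as ++ bs).length
  obtain ⟨ws₁, ws₂, rfl, h₁⟩ : ∃ ws₁ ws₂, ws = ws₁ ++ ws₂ ∧ ws₁.length = as.length :=
    ⟨ws.take as.length, ws.drop as.length, (List.take_append_drop _ _).symm, by
      rw [List.length_take, hlen, List.length_append]
      omega⟩
  have h₂ : ws₂.length = bs.length := by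
    simp only [List.length_append] at hlen
    omega
  obtain ⟨ws', hws', hV', hlen', hrec⟩ := edgeClass_string (K := K) (a := a)
    (hB.mem_vertices he).1 (hB.mem_vertices he).2 h₁ h₂ hws hV (hB.pair_mem_erase e) hne
  rw [hB.melonicClass_snoc K (t := ⟨as ++ a :: bs, p, k⟩) he hl hws hV
      (by simp only [List.length_append, List.length_cons] at hlen ⊢; omega),
    hB.melonicClass_snoc K (t := ⟨as ++ 1 :: bs, p, k⟩) he hl hws hV
      (by simp only [List.length_append, List.length_cons] at hlen ⊢; omega),
    hB.melonicClass_snoc K (t := ⟨as ++ bs, p, k⟩) he hl hws' hV' hlen', hB3.melonicClass_eq K]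
  exact hrec

theorem melonicClass_depth_one (K : Type u) [Field K] {b : List ℕ} (h : IsMelonic [⟨b, 0, 1⟩]) :
    melonicClass K [⟨b, 0, 1⟩] =
      (b.map fun a => Polynomial.aeval (torus K) (bananaPoly a)).prod := by
  have hb : 0 < b.length := List.length_pos_iff.mpr (h.ne_nil ⟨b, 0, 1⟩ (by simp))
  obtain ⟨ws, hlen, hws, hV⟩ := exists_fresh {0, 1} (b.length - 1)
  have := (Builds.nil 0 1 (by simp)).melonicClass_snoc K (t := ⟨b, 0, 1⟩)
    (Multiset.mem_singleton_self _) ⟨rfl, rfl⟩ hws hV (by simp only; omega)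
  rw [List.nil_append] at this
  rw [this]
  -- The initial edge is gone, so its end 1 can be counted as the last vertex of a string hanging
  -- from the one-vertex graph 0.
  have hset : (({0, 1} : Finset ℕ) : Set ℕ) ∪ {v | v ∈ ws} = {0} ∪ {v | v ∈ ws ++ [1]} := by
    ext v
    simp only [Finset.coe_insert, Finset.coe_singleton, Set.mem_union, Set.mem_insert_iff,
      Set.mem_singleton_iff, Set.mem_ofPred_eq, List.mem_append, List.mem_singleton]
    tauto
  rw [hset, ← Multiset.cons_zero, Multiset.erase_cons_head, Multiset.map_zero,
    edgeClass_pendant_string (Set.mem_singleton 0) (by simp; omega) ?_ ?_ (by simp),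
    edgeClass_singleton_zero, mul_one]
  · rw [List.nodup_append]
    refine ⟨hws, List.nodup_singleton 1, fun v hv w hw => ?_⟩
    rintro rfl
    exact hV v hv (by simp [List.mem_singleton.mp hw])
  · intro v hv
    rcases List.mem_append.mp hv with hv | hv
    · have := hV v hv
      simp only [Finset.mem_insert, not_or] at this
      exact this.1
    · simp [List.mem_singleton.mp hv]

theorem Builds.resize_single {T : List MelonicTuple} {V : Finset ℕ} {E : Multiset LabelledEdge}
    {e : LabelledEdge} (hB : Builds T V E) (he : e ∈ E) {a p k : ℕ} (hl : e.HasLabel p k)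
    (hp : 1 ≤ p) (ha : 0 < a) :
    Builds (_root_.resize T p k (· + (a - 1))) V (E.erase e + Multiset.replicate a e) := by
  have := hB.resize he (hl.1 ▸ hp) (φ := (· + (a - 1))) (d := a) fun c hc => by omega
  rwa [hl.1, hl.2] at this

/-- A string consisting of one banana is parallel to the other edges of the banana it meets, so up
to labels both constructions produce the same edges. -/
theorem melonicClass_single (K : Type u) [Field K] {T : List MelonicTuple} {a p k : ℕ}
    (hT : T ≠ []) (h : IsMelonic (T ++ [⟨[a], p, k⟩])) :
    melonicClass K (T ++ [⟨[a], p, k⟩]) = melonicClass K (resize T p k (· + (a - 1))) := by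
  obtain ⟨V, E, e, hB, he, hl⟩ := h.exists_builds_snoc
  have ha : 0 < a := h.pos ⟨[a], p, k⟩ (by simp) a (by simp)
  rw [hB.melonicClass_snoc K (ws := []) (t := ⟨[a], p, k⟩) he hl (by simp) (by simp) (by simp),
    (hB.resize_single he hl (h.p_pos_last hT) ha).melonicClass_eq K, Multiset.map_add,
    Multiset.map_replicate, add_comm]
  simp [stringPairs, LabelledEdge.pair]

theorem lefschetz_eq (K : Type u) [Field K] : lefschetz K = torus K + 1 :=
  (sub_add_cancel _ _).symm

theorem melonicClass_ones (K : Type u) [Field K] {T : List MelonicTuple} {r p k : ℕ}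
    (h : IsMelonic (T ++ [⟨List.replicate r 1, p, k⟩])) :
    melonicClass K (T ++ [⟨List.replicate r 1, p, k⟩]) =
      (torus K + 1) ^ (r - 1) * melonicClass K T := by
  obtain ⟨V, E, e, hB, he, hl⟩ := h.exists_builds_snoc
  have hb := h.ne_nil ⟨List.replicate r 1, p, k⟩ (by simp)
  obtain _ | r := r
  · simp at hb
  obtain ⟨ws, rfl, hws, hV⟩ := exists_fresh V r
  rw [hB.melonicClass_snoc K (t := ⟨List.replicate _ 1, p, k⟩) he hl hws hV (by simp),
    edgeClass_string_one (hB.mem_vertices he).1 (hB.mem_vertices he).2 hws hV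
      (hB.pair_mem_erase e), hB.melonicClass_eq K, lefschetz_eq, Nat.add_sub_cancel]
  congr 2
  conv_rhs => rw [← Multiset.cons_erase he, Multiset.map_cons]
  rfl

theorem melonicRecursion_melonicClass (K : Type u) [Field K] :
    MelonicRecursion (torus K) (melonicClass K) where
  equivalent T T' h h' hiso := by
    obtain ⟨V, E, hB⟩ := h.exists_builds
    exact hiso.grothendieckClass_eq K ⟨⟨0, hB.numV_pos⟩, trivial⟩
  depth_one b h := melonicClass_depth_one K h
  single T a p k hT h _ := melonicClass_single K hT h
  ones T r p k _ h _ := melonicClass_ones K h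
  main T as bs a p k hT h hr hne ha _ := (melonic_recursion K hT h hr hne ha).2.2.2

/-! ## Reduced constructions -/

/-- The shift of the labels of the bananas of stage `i` after the `j`-th one by `d`. -/
def shiftBanana (i j d p k : ℕ) : ℕ := if p = i ∧ j < k then k + d else k

theorem shiftBanana_of_ne {i j d p k : ℕ} (h : p ≠ i) : shiftBanana i j d p k = k :=
  if_neg fun h' => h h'.1

theorem shiftBanana_of_le {i j d p k : ℕ} (h : k ≤ j) : shiftBanana i j d p k = k :=
  if_neg fun h' => by omega

theorem shiftBanana_of_lt {i j d k : ℕ} (h : j < k) : shiftBanana i j d i k = k + d :=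
  if_pos ⟨rfl, h⟩

/-- The shift of the labels of edges. -/
def LabelledEdge.shift (i j d : ℕ) (e : LabelledEdge) : LabelledEdge :=
  ⟨e.stage, shiftBanana i j d e.stage e.banana, e.src, e.tgt⟩

/-- The shift of the labels in a tuple. -/
def MelonicTuple.shift (i j d : ℕ) (t : MelonicTuple) : MelonicTuple :=
  ⟨t.b, t.p, shiftBanana i j d t.p t.k⟩

/-- The construction in which a `1`-banana, the `(j + 1)`-st of the stage `i + 1`, is replaced by
a string of bananas of sizes `b`. -/
def splice (T : List MelonicTuple) (i j : ℕ) (b : List ℕ) : List MelonicTuple :=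
  (T.map (MelonicTuple.shift (i + 1) (j + 1) (b.length - 1))).modify i fun t =>
    { t with b := t.b.take j ++ (b ++ t.b.drop (j + 1)) }

theorem length_splice (T : List MelonicTuple) (i j : ℕ) (b : List ℕ) :
    (splice T i j b).length = T.length := by
  rw [splice, List.length_modify, List.length_map]

theorem splice_append_of_lt {T : List MelonicTuple} {i : ℕ} (hi : i < T.length) (j : ℕ)
    (b : List ℕ) (t : MelonicTuple) :
    splice (T ++ [t]) i j b =
      splice T i j b ++ [t.shift (i + 1) (j + 1) (b.length - 1)] := by
  rw [splice, List.map_append, List.modify_append_of_lt _ (by simpa using hi)]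
  rfl

theorem mem_splice {T : List MelonicTuple} {i j : ℕ} {b : List ℕ} {t : MelonicTuple}
    (h : t ∈ splice T i j b) : ∃ t' ∈ T, t.p = t'.p ∧
      t.k = shiftBanana (i + 1) (j + 1) (b.length - 1) t'.p t'.k ∧ ∀ a ∈ t.b, a ∈ b ∨ a ∈ t'.b := by
  obtain ⟨n, hn, rfl⟩ := List.getElem_of_mem h
  rw [length_splice] at hn
  refine ⟨T[n], List.getElem_mem hn, ?_⟩
  simp only [splice, List.getElem_modify, List.getElem_map]
  split_ifs
  · refine ⟨rfl, rfl, fun a ha => ?_⟩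
    simp only [List.mem_append] at ha
    rcases ha with ha | ha | ha
    · exact .inr (List.mem_of_mem_take ha)
    · exact .inl ha
    · exact .inr (List.mem_of_mem_drop ha)
  · exact ⟨rfl, rfl, fun a ha => .inr ha⟩

theorem AllPos.splice {T : List MelonicTuple} (h : AllPos T) (i j : ℕ) {b : List ℕ}
    (hb : ∀ a ∈ b, 0 < a) : AllPos (splice T i j b) := by
  intro t ht a ha
  obtain ⟨t', ht', -, -, h3⟩ := mem_splice ht
  exact (h3 a ha).elim (hb a) (h t' ht' a)

/-- References to any banana other than the spliced one keep their meaning after the shift of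
labels. -/
theorem bananaSize_splice {T : List MelonicTuple} {i j : ℕ} (hi : i < T.length)
    (hj : j < T[i].b.length) {b : List ℕ} (hb : b ≠ []) {p k : ℕ} (hk : 1 ≤ k)
    (hne : ¬ (p = i + 1 ∧ k = j + 1)) :
    bananaSize (splice T i j b) p (shiftBanana (i + 1) (j + 1) (b.length - 1) p k) =
      bananaSize T p k := by
  have hb' := List.length_pos_iff.mpr hb
  rcases p with _ | p
  · rw [shiftBanana_of_ne (by omega)]
    rfl
  by_cases hp : p = i
  · subst hp
    have hi' : p < (splice T p j b).length := by rwa [length_splice]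
    have hget : (splice T p j b)[p].b = T[p].b.take j ++ (b ++ T[p].b.drop (j + 1)) := by
      simp only [splice, List.getElem_modify_eq, List.getElem_map]
      rfl
    rw [bananaSize, stageBananas_succ hi', hget, bananaSize, stageBananas_succ hi]
    by_cases hkj : j + 1 < k
    · rw [shiftBanana_of_lt hkj, List.getElem?_append_right (by simp; omega),
        List.getElem?_append_right (by simp; omega), List.getElem?_drop]
      congr 2
      simp
      omega
    · rw [shiftBanana_of_le (by omega), List.getElem?_append_left (by simp; omega),
        List.getElem?_take_of_lt (by omega)]
  · rw [shiftBanana_of_ne (by omega), bananaSize, bananaSize, stageBananas, stageBananas,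
      List.getElem?_map, List.getElem?_map, splice, List.getElem?_modify_ne _ _ (Ne.symm hp),
      List.getElem?_map, Option.map_map]
    rfl

theorem stringEdges_shift_of_ne {s i : ℕ} (h : s ≠ i) (j d n : ℕ) (vs b : List ℕ) :
    (stringEdges s n vs b).map (LabelledEdge.shift i j d) = stringEdges s n vs b := by
  conv_rhs => rw [← Multiset.map_id (stringEdges s n vs b)]
  refine Multiset.map_congr rfl fun e he => ?_
  rw [LabelledEdge.shift, shiftBanana_of_ne ((stringEdges_bounds he).1.trans_ne h)]
  rfl

theorem stringEdges_shift_of_le {s j n : ℕ} {vs b : List ℕ} (h : n + b.length ≤ j + 1) (d : ℕ) :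
    (stringEdges s n vs b).map (LabelledEdge.shift s j d) = stringEdges s n vs b := by
  conv_rhs => rw [← Multiset.map_id (stringEdges s n vs b)]
  refine Multiset.map_congr rfl fun e he => ?_
  have := (stringEdges_bounds he).2.2.1
  rw [LabelledEdge.shift, shiftBanana_of_le (by omega)]
  rfl

theorem stringEdges_shift_of_lt {s j n : ℕ} (h : j < n) (d : ℕ) (vs b : List ℕ) :
    (stringEdges s n vs b).map (LabelledEdge.shift s j d) = stringEdges s (n + d) vs b := by
  induction b generalizing n vs with
  | nil => simp [stringEdges_nil]
  | cons a b ih =>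
    rcases vs with _ | ⟨x, _ | ⟨y, vs⟩⟩
    · rfl
    · rfl
    · rw [stringEdges_cons, Multiset.map_add, ih (by omega), Multiset.map_replicate,
        stringEdges_cons, LabelledEdge.shift, shiftBanana_of_lt h, add_right_comm n 1 d]

namespace Builds

variable {T : List MelonicTuple} {V : Finset ℕ} {E : Multiset LabelledEdge}

theorem p_le (h : Builds T V E) : ∀ t ∈ T, t.p ≤ T.length ∧ 1 ≤ t.k := by
  induction h with
  | nil => simp
  | @snoc T V E t f ws hT hf hl hws hV hlen ih =>
    rw [List.forall_mem_append, List.forall_mem_singleton, List.length_append]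
    refine ⟨fun t' ht' => ⟨(ih t' ht').1.trans (by omega), (ih t' ht').2⟩, ?_⟩
    have := hT.stage_le hf
    rw [hl.1, hl.2] at this
    exact ⟨by omega, this.2⟩

theorem map_shift_of_lt (h : Builds T V E) {i : ℕ} (hi : T.length < i) (j d : ℕ)
    (E' : Multiset LabelledEdge) (hE' : E' ≤ E) : E'.map (LabelledEdge.shift i j d) = E' := by
  conv_rhs => rw [← Multiset.map_id E']
  refine Multiset.map_congr rfl fun e he => ?_
  have := (h.stage_le (Multiset.mem_of_le hE' he)).1
  rw [LabelledEdge.shift, shiftBanana_of_ne (by omega)]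
  rfl

theorem splice_length (h : Builds T V E) (t : MelonicTuple) (ht : t.p ≤ T.length) (j : ℕ)
    (b : List ℕ) : _root_.splice (T ++ [t]) T.length j b =
      T ++ [{ t with b := t.b.take j ++ (b ++ t.b.drop (j + 1)) }] := by
  have h1 : T.map (MelonicTuple.shift (T.length + 1) (j + 1) (b.length - 1)) = T := by
    conv_rhs => rw [← List.map_id T]
    refine List.map_congr_left fun t' ht' => ?_
    have := (h.p_le t' ht').1
    rw [MelonicTuple.shift, shiftBanana_of_ne (by omega)]
    rfl
  have h2 : t.shift (T.length + 1) (j + 1) (b.length - 1) = t := by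
    rw [MelonicTuple.shift, shiftBanana_of_ne (by omega)]
  rw [_root_.splice, List.map_append, h1, List.map_singleton, h2, List.modify_length_append_cons]

/-- The construction in which a `1`-banana is replaced by a string of bananas. -/
theorem splice (h : Builds T V E) {e : LabelledEdge} (he : e ∈ E) {i j : ℕ}
    (hl : e.HasLabel (i + 1) (j + 1)) (hsize : bananaSize T (i + 1) (j + 1) = 1) {b ws : List ℕ}
    (hws : ws.Nodup) (hV : ∀ v ∈ ws, v ∉ V) (hlen : ws.length + 1 = b.length) :
    Builds (_root_.splice T i j b) (V ∪ ws.toFinset)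
      ((E.erase e).map (LabelledEdge.shift (i + 1) (j + 1) (b.length - 1)) +
        stringEdges (i + 1) (j + 1) (e.src :: (ws ++ [e.tgt])) b) := by
  induction h with
  | nil x y hxy =>
    obtain rfl := Multiset.mem_singleton.mp he
    exact absurd hl.1 (Nat.succ_ne_zero i).symm
  | @snoc T V E t f ws' hT hf hlf hws' hV' hlen' ih =>
    have htp : t.p ≤ T.length := hlf.1 ▸ (hT.stage_le hf).1
    -- If the `1`-banana is older than the last stage, splicing commutes with that stage; otherwise
    -- the splice takes place within its list of sizes.
    by_cases hi : i < T.length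
    · have he₁ : e ∈ E.erase f := by
        refine (Multiset.mem_add.mp he).resolve_right fun h' => ?_
        have := (stringEdges_bounds h').1
        have := hl.1
        omega
      have heE := Multiset.mem_of_mem_erase he₁
      rw [bananaSize, stageBananas_append_of_le (by omega), ← bananaSize] at hsize
      -- A banana of size 1 has only one edge, and `e` is still present after `f` was removed.
      have hne : f ≠ e := by
        rintro rfl
        have h1 := hT.countP_add (i + 1) (j + 1) (by omega)
        have h2 : 0 < (E.erase f).countP (fun g => g.HasLabel (i + 1) (j + 1)) :=
          Multiset.countP_pos.mpr ⟨f, he₁, hl⟩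
        rw [← Multiset.cons_erase hf,
          Multiset.countP_cons_of_pos
            (p := fun g : LabelledEdge => g.HasLabel (i + 1) (j + 1)) _ hl] at h1
        omega
      have hfe : f ∈ E.erase e := (Multiset.mem_erase_of_ne hne).mpr hf
      have hB := ih heE hsize fun v hv hv' => hV v hv (Finset.mem_union_left _ hv')
      have hmem := Multiset.mem_map_of_mem
        (LabelledEdge.shift (i + 1) (j + 1) (b.length - 1)) hfe
      have := hB.snoc (t.shift (i + 1) (j + 1) (b.length - 1))
        (f.shift (i + 1) (j + 1) (b.length - 1)) ws' (Multiset.mem_add.mpr (.inl hmem))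
        ⟨hlf.1, by
          change shiftBanana _ _ _ _ _ = shiftBanana _ _ _ _ _
          rw [hlf.1, hlf.2]⟩ hws'
        (fun v hv hv' => by
          rcases Finset.mem_union.mp hv' with h' | h'
          · exact hV' v hv h'
          · exact hV v (List.mem_toFinset.mp h')
              (Finset.mem_union_right _ (List.mem_toFinset.mpr hv))) hlen'
      rw [length_splice, Multiset.erase_add_of_mem _ hmem, ← Multiset.map_erase_of_mem _ _ hfe,
        Finset.union_right_comm, add_right_comm, Multiset.erase_comm] at this
      rw [splice_append_of_lt hi, Multiset.erase_add_of_mem _ he₁, Multiset.map_add,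
        stringEdges_shift_of_ne (by omega)]
      exact this
    · have hiT : i = T.length := by
        have h1 := (hT.snoc t f ws' hf hlf hws' hV' hlen').stage_le he
        rw [hl.1, List.length_append, List.length_singleton] at h1
        omega
      subst hiT
      have he₁ : e ∉ E.erase f := fun h' => by
        have := (hT.stage_le (Multiset.mem_of_mem_erase h')).1
        rw [hl.1] at this
        omega
      have he₂ := (Multiset.mem_add.mp he).resolve_left he₁
      rw [bananaSize, stageBananas_append_singleton, Nat.add_sub_cancel] at hsize
      have hj : j < t.b.length := by
        by_contra hj
        rw [List.getElem?_eq_none (by omega)] at hsize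
        simp at hsize
      rw [List.getElem?_eq_getElem hj, Option.getD_some] at hsize
      -- Cut the last string at the `1`-banana, whose only edge runs from `x` to `y`. The new string
      -- is inserted between them, and only the bananas of `b₂` change labels.
      obtain ⟨b₁, b₂, hb, hb₁⟩ : ∃ b₁ b₂, t.b = b₁ ++ 1 :: b₂ ∧ b₁.length = j :=
        ⟨t.b.take j, t.b.drop (j + 1), (List.take_append_drop j t.b).symm.trans (by
          rw [List.drop_eq_getElem_cons hj, hsize]), by
          rw [List.length_take]
          omega⟩
      have hnew : t.b.take j ++ (b ++ t.b.drop (j + 1)) = b₁ ++ (b ++ b₂) := by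
        subst hb₁
        rw [hb, List.take_left, List.drop_append]
        simp
      rw [hT.splice_length t htp, hnew]
      have hlenb : ws'.length = b₁.length + b₂.length := by
        rw [hb, List.length_append, List.length_cons] at hlen'
        omega
      obtain ⟨w₁, w₂, rfl, hw₁⟩ : ∃ w₁ w₂, ws' = w₁ ++ w₂ ∧ w₁.length = b₁.length :=
        ⟨ws'.take b₁.length, ws'.drop b₁.length, (List.take_append_drop _ _).symm, by
          rw [List.length_take]
          omega⟩
      obtain ⟨L₁, x, hx⟩ : ∃ L₁ x, f.src :: w₁ = L₁ ++ [x] := by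
        obtain h | ⟨L, x, h⟩ := List.eq_nil_or_concat' (f.src :: w₁)
        · simp at h
        · exact ⟨L, x, h⟩
      obtain ⟨y, L₂, hy⟩ : ∃ y L₂, w₂ ++ [f.tgt] = y :: L₂ := by
        cases w₂ with
        | nil => exact ⟨f.tgt, [], rfl⟩
        | cons y L => exact ⟨y, L ++ [f.tgt], rfl⟩
      have hL₁ : L₁.length = b₁.length := by
        have := congrArg List.length hx
        simp at this
        omega
      have hpath : f.src :: (w₁ ++ w₂ ++ [f.tgt]) = L₁ ++ x :: y :: L₂ := by
        rw [List.append_assoc, hy, ← List.cons_append, hx, List.append_assoc,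
          List.singleton_append]
      have hpath' : f.src :: (w₁ ++ ws ++ w₂ ++ [f.tgt]) = L₁ ++ x :: (ws ++ y :: L₂) := by
        rw [List.append_assoc, hy, List.append_assoc, ← List.cons_append, hx, List.append_assoc,
          List.singleton_append]
      have hold : stringEdges (T.length + 1) 1 (f.src :: (w₁ ++ w₂ ++ [f.tgt])) t.b =
          ⟨T.length + 1, j + 1, x, y⟩ ::ₘ (stringEdges (T.length + 1) 1 (L₁ ++ [x]) b₁ +
            stringEdges (T.length + 1) (j + 2) (y :: L₂) b₂) := by
        rw [hpath, hb, stringEdges_append _ _ _ _ _ _ _ hL₁, stringEdges_cons,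
          Multiset.replicate_one, Multiset.singleton_add, Multiset.add_cons, hb₁, add_comm 1 j]
      have hee : e = ⟨T.length + 1, j + 1, x, y⟩ := by
        refine stringEdges_unique he₂ ?_ hl.2
        rw [hold]
        exact Multiset.mem_cons_self _ _
      subst hee
      have hdisj : ∀ v ∈ ws, v ∉ w₁ ++ w₂ := fun v hv hv' =>
        hV v hv (Finset.mem_union_right _ (List.mem_toFinset.mpr hv'))
      rw [List.nodup_append] at hws'
      have hB := hT.snoc { t with b := b₁ ++ (b ++ b₂) } f (w₁ ++ ws ++ w₂) hf hlf ?_ ?_ ?_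
      · convert hB using 1
        · ext v
          simp only [Finset.mem_union, List.mem_toFinset, List.mem_append]
          tauto
        · have hA : (stringEdges (T.length + 1) 1 (L₁ ++ [x]) b₁).map
              (LabelledEdge.shift (T.length + 1) (j + 1) (b.length - 1)) =
              stringEdges (T.length + 1) 1 (L₁ ++ [x]) b₁ :=
            stringEdges_shift_of_le (by omega) _
          have hB' (n : ℕ) : stringEdges (T.length + 1) n (x :: (ws ++ y :: L₂)) (b ++ b₂) =
              stringEdges (T.length + 1) n (x :: (ws ++ [y])) b +
                stringEdges (T.length + 1) (n + b.length) (y :: L₂) b₂ :=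
            stringEdges_append _ _ y (x :: ws) L₂ b b₂ hlen
          rw [Multiset.erase_add_right_neg _ he₁, hold, Multiset.erase_cons_head,
            Multiset.map_add, Multiset.map_add, hA, stringEdges_shift_of_lt (by omega),
            hT.map_shift_of_lt (by omega) _ _ _ (Multiset.erase_le _ _), hpath',
            stringEdges_append _ _ _ _ _ _ _ hL₁, hB', hb₁, add_comm 1 j,
            show j + 2 + (b.length - 1) = j + 1 + b.length by omega]
          abel
      · rw [List.append_assoc, List.nodup_append, List.nodup_append]
        refine ⟨hws'.1, ⟨hws, hws'.2.1, fun v hv w hw => ?_⟩, fun v hv w hw => ?_⟩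
        · rintro rfl
          exact hdisj v hv (List.mem_append_right _ hw)
        · rintro rfl
          rcases List.mem_append.mp hw with hw | hw
          · exact hdisj v hw (List.mem_append_left _ hv)
          · exact hws'.2.2 v hv v hw rfl
      · intro v hv
        rcases List.mem_append.mp hv with hv | hv
        · rcases List.mem_append.mp hv with hv | hv
          · exact hV' v (List.mem_append_left _ hv)
          · exact fun h' => hV v hv (Finset.mem_union_left _ h')
        · exact hV' v (List.mem_append_right _ hv)
      · simp only [List.length_append] at hlenb ⊢
        omega

end Builds

/-- No stage replaces the edge of a `1`-banana past stage `0`. -/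
def NoSingleReplaced (T : List MelonicTuple) : Prop :=
  ∀ t ∈ T, 1 ≤ t.p → bananaSize T t.p t.k ≠ 1

theorem NoSingleReplaced.isReducedMelonic {T : List MelonicTuple} (h : NoSingleReplaced T) :
    IsReducedMelonic T := by
  rintro i hi j hj h1 t ht ⟨hp, hk⟩
  refine h t ht (by omega) ?_
  rw [hp, hk, bananaSize_succ hi hj, h1]

/-- No tuple refers to the `1`-banana that disappears, so all references keep the sizes they had. -/
theorem NoSingleReplaced.splice {T : List MelonicTuple} (h : NoSingleReplaced T) {i j : ℕ}
    (hi : i < T.length) (hj : j < T[i].b.length) (h1 : T[i].b[j] = 1) {b : List ℕ} (hb : b ≠ [])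
    (hk : ∀ t ∈ T, 1 ≤ t.k) : NoSingleReplaced (splice T i j b) := by
  intro t ht hp
  obtain ⟨t', ht', hp', hk', -⟩ := mem_splice ht
  have hne : ¬ (t'.p = i + 1 ∧ t'.k = j + 1) := fun h' => by
    have := h t' ht' (hp' ▸ hp)
    rw [h'.1, h'.2, bananaSize_succ hi hj] at this
    exact this h1
  rw [hp', hk', bananaSize_splice hi hj hb (hk t' ht') hne]
  exact h t' ht' (hp' ▸ hp)

/-- Every construction has an equivalent reduced one which is not longer. -/
theorem Builds.exists_reduced {T : List MelonicTuple} {V : Finset ℕ} {E : Multiset LabelledEdge}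
    (h : Builds T V E) (hT : AllPos T) :
    ∃ T₀ E₀, Builds T₀ V E₀ ∧ AllPos T₀ ∧ NoSingleReplaced T₀ ∧ T₀.length ≤ T.length ∧
      E₀.map LabelledEdge.pair = E.map LabelledEdge.pair := by
  induction h with
  | nil x y hxy => exact ⟨[], _, .nil x y hxy, hT, by simp [NoSingleReplaced], le_rfl, rfl⟩
  | @snoc T V E t f ws hB hf hlf hws hV hlen ih =>
    rw [allPos_append, allPos_singleton] at hT
    obtain ⟨T₀, E₀, hB₀, hpos, hred, hle, hE⟩ := ih hT.1
    have hb : t.b ≠ [] := by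
      rintro h
      rw [h] at hlen
      simp at hlen
    -- The edge to be replaced is found in the reduced construction by its end vertices; its label
    -- there may be different.
    obtain ⟨e, he, hef⟩ : ∃ e ∈ E₀, e.pair = f.pair :=
      Multiset.mem_map.mp (hE ▸ Multiset.mem_map_of_mem _ hf)
    have herase : (E₀.erase e).map LabelledEdge.pair = (E.erase f).map LabelledEdge.pair := by
      rw [Multiset.map_erase_of_mem _ _ he, Multiset.map_erase_of_mem _ _ hf, hE, hef]
    obtain ⟨hsrc, htgt⟩ : e.src = f.src ∧ e.tgt = f.tgt := by
      simpa [LabelledEdge.pair] using hef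
    -- Appending the tuple would violate reducedness exactly when `e` is a `1`-banana past stage 0;
    -- then its string is spliced in instead, without adding a stage.
    by_cases h1 : 1 ≤ e.stage ∧ bananaSize T₀ e.stage e.banana = 1
    · obtain ⟨i, hi⟩ := Nat.exists_eq_add_of_le' h1.1
      obtain ⟨j, hj⟩ := Nat.exists_eq_add_of_le' (hB₀.stage_le he).2
      have hsize := h1.2
      rw [hi, hj] at hsize
      have hiT : i < T₀.length := by
        have := (hB₀.stage_le he).1
        omega
      have hjT : j < T₀[i].b.length := by
        have := Builds.le_length_of_bananaSize_pos (T := T₀) (p := i + 1) (k := j + 1) (by omega)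
          (by omega)
        rw [stageBananas_succ hiT] at this
        omega
      refine ⟨_, _, hB₀.splice he ⟨hi, hj⟩ hsize hws hV hlen, hpos.splice i j hT.2,
        hred.splice hiT hjT ?_ hb fun t' ht' => (hB₀.p_le t' ht').2, ?_, ?_⟩
      · rwa [bananaSize_succ hiT hjT] at hsize
      · rw [length_splice, List.length_append]
        omega
      · rw [Multiset.map_add, Multiset.map_add, stringEdges_map_pair, stringEdges_map_pair,
          Multiset.map_map, hsrc, htgt, ← herase]
        rfl
    · refine ⟨_, _, hB₀.snoc ⟨t.b, e.stage, e.banana⟩ e ws he ⟨rfl, rfl⟩ hws hV hlen,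
        allPos_append.mpr ⟨hpos, allPos_singleton.mpr hT.2⟩, ?_, ?_, ?_⟩
      · intro t' ht' hp
        rcases List.mem_append.mp ht' with ht' | ht'
        · rw [bananaSize, stageBananas_append_of_le (hB₀.p_le t' ht').1]
          exact hred t' ht' hp
        · obtain rfl := List.mem_singleton.mp ht'
          rw [bananaSize, stageBananas_append_of_le (hB₀.stage_le he).1]
          exact fun h' => h1 ⟨hp, h'⟩
      · simpa using hle
      · rw [Multiset.map_add, Multiset.map_add, stringEdges_map_pair, stringEdges_map_pair, herase,
          hsrc, htgt]

/-! ## The recursion determines the class -/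

/-- The empty construction is covered by no rule of its own; replacing the single edge by a
`1`-banana brings it under the depth-one rule. -/
theorem Builds.isomorphic_banana {V : Finset ℕ} {E : Multiset LabelledEdge}
    (h : Builds [] V E) : (melonicGraph []).Isomorphic (melonicGraph [⟨[1], 0, 1⟩]) := by
  obtain ⟨e, he, hl⟩ := h.exists_mem (p := 0) (k := 1) le_rfl one_pos
  have hE : E = {e} := by
    generalize hT : ([] : List MelonicTuple) = T at h
    cases h with
    | nil x y hxy => rw [Multiset.mem_singleton.mp he]
    | snoc => simp at hT
  have hB := h.snoc ⟨[1], 0, 1⟩ e [] he hl List.nodup_nil (by simp) rfl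
  rw [List.toFinset_nil, Finset.union_empty] at hB
  refine h.isomorphic hB ?_
  rw [Multiset.map_add, stringEdges_map_pair, hE, ← Multiset.cons_zero,
    Multiset.erase_cons_head]
  rfl

theorem IsMelonic.eq_of_singleton {t : MelonicTuple} (h : IsMelonic [t]) : ∃ b, t = ⟨b, 0, 1⟩ := by
  have hp := h.p_lt 0 (by simp)
  rw [List.getElem_cons_zero] at hp
  have hp0 : t.p = 0 := by omega
  have hk := h.one_le_k t (by simp)
  have hk' := h.k_le t (by simp)
  rw [hp0, stageBananas, List.length_singleton] at hk'
  obtain ⟨b, p, k⟩ := t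
  obtain rfl : p = 0 := hp0
  obtain rfl : k = 1 := le_antisymm hk' hk
  exact ⟨b, rfl⟩

theorem List.exists_eq_append_cons_max {b : List ℕ} (hb : b ≠ []) :
    ∃ as a bs, b = as ++ a :: bs ∧ ∀ x ∈ b, x ≤ a := by
  obtain ⟨a, ha, hmax⟩ := b.toFinset.exists_max_image id (List.toFinset_nonempty_iff b |>.mpr hb)
  obtain ⟨as, bs, h⟩ := List.append_of_mem (List.mem_toFinset.mp ha)
  exact ⟨as, a, bs, h, fun x hx => hmax x (List.mem_toFinset.mpr hx)⟩

/-- The rules of the recursion determine the class. -/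
theorem MelonicRecursion.eq_melonicClass {K : Type u} [Field K] {F : List MelonicTuple → K0 K}
    (hF : MelonicRecursion (torus K) F) {T : List MelonicTuple} (hT : IsMelonic T) :
    F T = melonicClass K T := by
  have hG := melonicRecursion_melonicClass K
  -- Past depth one, every rule lowers the number of edges except `single`, which keeps it and
  -- shortens the construction. Passing to a reduced construction keeps the number of edges and does
  -- not lengthen it.
  induction hn : (melonicGraph T).edgeSet.ncard using Nat.strong_induction_on
    generalizing T with
  | _ n ihn =>
  induction hm : T.length using Nat.strong_induction_on generalizing T with
  | _ m ihm =>
  obtain ⟨V, E', hB'⟩ := hT.exists_builds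
  obtain ⟨T₀, E, hB, hpos, hred, hle, hE⟩ := hB'.exists_reduced hT.pos
  have hmel := hB.isMelonic hpos
  have hiso := hB'.isomorphic hB hE.symm
  rw [hF.equivalent _ _ hT hmel hiso, hG.equivalent _ _ hT hmel hiso]
  have hcard : (melonicGraph T₀).edgeSet.ncard = n := by
    rw [hB.card_eq, ← hn, hB'.card_eq, ← Multiset.card_map LabelledEdge.pair, hE,
      Multiset.card_map]
  have hr := hred.isReducedMelonic
  obtain rfl | ⟨S, t, rfl⟩ := List.eq_nil_or_concat' T₀
  · have hiso' := hB.isomorphic_banana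
    have hban : IsMelonic [⟨[1], 0, 1⟩] := by
      obtain ⟨e, he, hl⟩ := hB.exists_mem (p := 0) (k := 1) le_rfl one_pos
      exact hB.isMelonic_snoc (t := ⟨[1], 0, 1⟩) he hl (by simp) (by simp [AllPos])
    rw [hF.equivalent _ _ hmel hban hiso', hG.equivalent _ _ hmel hban hiso',
      hF.depth_one _ hban, hG.depth_one _ hban]
  by_cases hS : S = []
  · subst hS
    rw [List.nil_append] at hmel ⊢
    obtain ⟨b, rfl⟩ := hmel.eq_of_singleton
    rw [hF.depth_one _ hmel, hG.depth_one _ hmel]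
  obtain ⟨V₁, E₁, e, hB₁, he, hl⟩ := hmel.exists_builds_snoc
  have hb := hmel.ne_nil t (by simp)
  have hbpos := hmel.pos t (by simp)
  have hc := hB₁.card_snoc he hl hb
  have hp := hmel.p_pos_last hS
  rw [List.length_append, List.length_singleton] at hle
  obtain ⟨b, p, k⟩ := t
  change e.HasLabel p k at hl
  change b ≠ [] at hb
  change ∀ a ∈ b, 0 < a at hbpos
  change 1 ≤ p at hp
  by_cases h1 : b.length = 1
  · obtain ⟨a, rfl⟩ := List.length_eq_one_iff.mp h1
    have ha := hbpos a (by simp)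
    rw [hF.single S a p k hS hmel hr, hG.single S a p k hS hmel hr]
    have hB₂ := hB₁.resize_single he hl hp ha
    refine ihm S.length (by omega) (hB₂.isMelonic ?_) ?_ ?_
    · refine (allPos_append.mp hpos).1.resize _ _ fun i hi _ j hj _ => ?_
      have := (allPos_append.mp hpos).1 _ (List.getElem_mem hi) _ (List.getElem_mem hj)
      omega
    · have := Multiset.card_erase_add_one he
      rw [hB₂.card_eq, Multiset.card_add, Multiset.card_replicate]
      simp only [List.sum_singleton] at hc
      omega
    · rw [resize, List.length_modify]
  by_cases h2 : ∀ a ∈ b, a = 1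
  · obtain ⟨r, rfl⟩ : ∃ r, b = List.replicate r 1 := ⟨_, List.eq_replicate_of_mem h2⟩
    rw [hF.ones S r p k hS hmel hr, hG.ones S r p k hS hmel hr]
    congr 1
    refine ihn _ ?_ hmel.of_append.1 rfl
    rw [List.length_replicate] at h1
    simp only [List.sum_replicate, smul_eq_mul, mul_one] at hc
    rw [hB₁.card_eq]
    -- Together with `h1` this gives `r ≥ 2`, so omitting the last stage does lose edges.
    have : r ≠ 0 := by
      rintro rfl
      exact hb rfl
    omega
  obtain ⟨as, a, bs, rfl, hmax⟩ := List.exists_eq_append_cons_max hb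
  have ha : 1 < a := by
    push Not at h2
    obtain ⟨x, hx, hx1⟩ := h2
    have := hbpos x hx
    have := hmax x hx
    omega
  have hne : as ++ bs ≠ [] := by
    intro h
    obtain ⟨rfl, rfl⟩ := List.append_eq_nil_iff.mp h
    simp at h1
  have hmax' : ∀ x ∈ as ++ bs, x ≤ a := by
    intro x hx
    refine hmax x ?_
    rcases List.mem_append.mp hx with hx | hx <;> simp [hx]
  obtain ⟨⟨m1, l1⟩, ⟨m2, l2⟩, ⟨m3, l3⟩, -⟩ := melonic_recursion K hS hmel hr hne ha
  rw [hcard] at l1 l2 l3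
  rw [hF.main S as bs a p k hS hmel hr hne ha hmax', hG.main S as bs a p k hS hmel hr hne ha hmax',
    ihn _ l1 m1 rfl, ihn _ l2 m2 rfl, ihn _ l3 m3 rfl]

end

theorem mainTheorem4 (K : Type u) [Field K] :
    -- every melonic graph has a reduced construction
    (∀ T : List MelonicTuple, IsMelonic T →
      ∃ T₀ : List MelonicTuple, IsMelonic T₀ ∧ IsReducedMelonic T₀ ∧
        (melonicGraph T).Isomorphic (melonicGraph T₀)) ∧
    -- the recursion formula: here `init = (t₁, …, tₙ₋₁)` with `n ≥ 2`
    (∀ (init : List MelonicTuple) (as bs : List ℕ) (a p k : ℕ)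
      (T T' T'' T''' : List MelonicTuple),
      init ≠ [] →
      T = init ++ [⟨as ++ a :: bs, p, k⟩] →
      T' = init ++ [⟨as ++ 1 :: bs, p, k⟩] →
      T'' = init ++ [⟨as ++ bs, p, k⟩] →
      T''' = resize init p k (· - 1) →
      IsMelonic T → IsReducedMelonic T →
      as ++ bs ≠ [] → 1 < a → (∀ x ∈ as ++ bs, x ≤ a) →
      (IsMelonic T' ∧ (melonicGraph T').edgeSet.ncard < (melonicGraph T).edgeSet.ncard) ∧
      (IsMelonic T'' ∧ (melonicGraph T'').edgeSet.ncard < (melonicGraph T).edgeSet.ncard) ∧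
      (IsMelonic T''' ∧ (melonicGraph T''').edgeSet.ncard < (melonicGraph T).edgeSet.ncard) ∧
      melonicClass K T =
        Polynomial.aeval (torus K) (fPoly a) * melonicClass K T' +
        Polynomial.aeval (torus K) (gPoly a) * melonicClass K T'' +
        (as.map fun x => Polynomial.aeval (torus K) (bananaPoly x)).prod *
          (bs.map fun x => Polynomial.aeval (torus K) (bananaPoly x)).prod *
          Polynomial.aeval (torus K) (hPoly a) * melonicClass K T''') ∧
    -- the recursion, with the depth-one and trivial cases, holds and determines `𝕌`
    MelonicRecursion (torus K) (melonicClass K) ∧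
    ∀ F : List MelonicTuple → K0 K, MelonicRecursion (torus K) F →
      ∀ T : List MelonicTuple, IsMelonic T → F T = melonicClass K T := by
  refine ⟨fun T hT => ?_, ?_, melonicRecursion_melonicClass K, fun F hF T hT =>
    hF.eq_melonicClass hT⟩
  · obtain ⟨V, E, hB⟩ := hT.exists_builds
    obtain ⟨T₀, E₀, hB₀, hpos, hred, -, hE⟩ := hB.exists_reduced hT.pos
    exact ⟨T₀, hB₀.isMelonic hpos, hred.isReducedMelonic, hB.isomorphic hB₀ hE.symm⟩
  · rintro init as bs a p k _ _ _ _ hinit rfl rfl rfl rfl h hr hne ha -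
    exact melonic_recursion K hinit h hr hne ha
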